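/- Let $N\ge 2$ be an even integer, $\kappa_N=(-1)^{1+N/2}$, and let $p(t;\cdot)$ be the elementary solution of $\partial_t u=\kappa_N\,\partial_x^N u$, i.e. $\int_{\mathbb R}e^{i\mu x}p(t;x)\,dx=e^{\kappa_N t(-i\mu)^N}=e^{-t\mu^N}$. Let $X$ be the pseudo-process started at $0$ and driven by $p$, and $T(t)=\int_0^t \mathbf 1_{[0,\infty)}(X(u))\,du$ its sojourn time in $[0,\infty)$. Pseudo-expectations are understood as follows. For a bounded Borel function $F$ on $\mathbb R^k$, put (with $x_0=0$) $$\mathbb E\big[F(X(\tfrac1{2^n}),\dots,X(\tfrac k{2^n}))\big]=\int_{\mathbb R^k}F(x_1,\dots,x_k)\prod_{i=1}^k p(2^{-n};x_{i-1}-x_i)\,dx_1\cdots dx_k .$$ Let $X_n(t)=X(k/2^n)$ for $t\in[k/2^n,(k+1)/2^n)$ and $T_n(t)=\int_0^t\mathbf 1_{[0,\infty)}(X_n(u))\,du$. Then $\mathbb E\big[\int_0^\infty e^{-\lambda t+i\mu X(t)-\nu T(t)}dt\big]$ denotes the limit as $n\to\infty$ of the series $\sum_{k\ge0}\mathbb E\big[\int_{k/2^n}^{(k+1)/2^n}e^{-\lambda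 t+i\mu X_n(t)-\nu T_n(t)}dt\big]$, which is required to converge absolutely for every $n$. A joint density of $(T(t),X(t))$ is a real function $q(t,s,x)$, vanishing unless $0<s<t$, continuous in $(t,s,x)$ on $0<s<t$, such that $e^{-\lambda t}q(t,s,x)$ is integrable on $\mathbb R^3$ for every $\lambda>0$ and, for all $\lambda,\nu>0$ and $\mu\in\mathbb R$, the pseudo-expectation below exists and $$\mathbb E\Big[\int_0^\infty e^{-\lambda t+i\mu X(t)-\nu T(t)}dt\Big]=\int_0^\infty e^{-\lambda t}\int_0^\infty\!\int_{\mathbb R}e^{i\mu x-\nu s}\,q(t,s,x)\,dx\,ds\,dt .$$ Let $\theta_1,\dots,\theta_N$ be the $N$-th roots of $\kappa_N$, $J=\{j:\Re\theta_j>0\}$, $K=\{k:\Re\theta_k<0\}$, $A_j=\prod_{i\in J\setminus\{j\}}\frac{\theta_i}{\theta_i-\theta_j}$ for $j\in J$, $B_k=\prod_{i\in K\setminus\{k\}}\frac{\theta_i}{\theta_i-\theta_k}$ for $k\in K$, $E_{a,b}(\xi)=\sum_{r\ge0}\frac{\xi^r}{\Gamma(ar+b)}$, and, for $j\in J$, $0\le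 m\le N-1$, $\tau>0$, $x\ge0$, $$I_{j,m}(\tau;x)=\frac{Ni}{2\pi}\Big(e^{-i\frac mN\pi}\int_0^\infty\xi^{N-m-1}e^{-\tau\xi^N-\theta_je^{i\pi/N}x\xi}\,d\xi-e^{i\frac mN\pi}\int_0^\infty\xi^{N-m-1}e^{-\tau\xi^N-\theta_je^{-i\pi/N}x\xi}\,d\xi\Big).$$ Theorem. A joint density $q$ of $(T(t),X(t))$ exists. For every joint density $q$, all $\lambda>0$, $s>0$ and $x\ge 0$ (with $x>0$ if $N=2$), the integrals below converge absolutely and $$\int_0^\infty e^{-\lambda t}q(t,s,x)\,dt=-\frac{e^{-\lambda s}}{\lambda^{(\#K-1)/N}}\sum_{j\in J,\,k\in K}A_jB_k\theta_k\int_0^s\sigma^{\frac1N-1}E_{\frac1N,\frac1N}\Big(\frac{\theta_k}{\theta_j}(\lambda\sigma)^{1/N}\Big)I_{j,\#J-1}(s-\sigma;x)\,d\sigma .$$ Moreover, for $j\in J$, $\lambda>0$ and $x\ge0$ (with $x>0$ if $N=2$), the following integral converges absolutely and $$\int_0^\infty e^{-\lambda\tau}I_{j,\#J-1}(\tau;x)\,d\tau=\lambda^{-(\#J-1)/N}e^{-\theta_j\lambda^{1/N}x}.$$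 -/

import Mathlib

open Complex Filter Topology MeasureTheory

namespace PseudoProcess

noncomputable section

/-! ### The heat kernel and the pseudo-process -/

/-- The coefficient `κ_N = (-1)^(1 + N/2)` of the equation `∂u/∂t = κ_N ∂^N u/∂x^N` (`N` even). -/
def kappa (N : ℕ) : ℂ := (-1) ^ (1 + N / 2)

/-- The elementary solution `p(t;x)` of `∂u/∂t = κ_N ∂^N u/∂x^N`, i.e. the real function of `x` whose
Fourier transform `∫ e^{iμx} p(t;x) dx` is `e^{κ_N t (-iμ)^N}`, given by Fourier inversion
(for even `N` the exponent is `-t μ^N` and the integral is real). -/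
def heatKernel (N : ℕ) (t x : ℝ) : ℝ :=
  ((1 / (2 * Real.pi) : ℂ) *
    ∫ μ : ℝ, cexp (-(I * μ * x)) * cexp (kappa N * t * (-(I * μ)) ^ N)).re

/-- The values `X_0 = 0, X_1 = x_1, …, X_k = x_k` at the times `j / 2^n` of the pseudo-process started
at `0`; the (irrelevant) values after index `k` are set to `0`. -/
def samplePath {k : ℕ} (x : Fin k → ℝ) : ℕ → ℝ
  | 0 => 0
  | i + 1 => if h : i < k then x ⟨i, h⟩ else 0

/-- A tame function of `k` observations: a bounded Borel function. -/
def IsTame {k : ℕ} (F : (Fin k → ℝ) → ℂ) : Prop :=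
  Measurable F ∧ ∃ C : ℝ, ∀ x, ‖F x‖ ≤ C

/-- The pseudo-expectation of the tame function `F(X(1/2^n), …, X(k/2^n))`, with `X(0) = 0`:
`∫ F(x_1,…,x_k) p(1/2^n; x_0 - x_1) ⋯ p(1/2^n; x_{k-1} - x_k) dx_1 ⋯ dx_k`, `x_0 = 0`. -/
def tameExpectation (N n k : ℕ) (F : (Fin k → ℝ) → ℂ) : ℂ :=
  ∫ x : Fin k → ℝ, F x *
    ∏ i : Fin k, (heatKernel N (1 / 2 ^ n) (samplePath x i - samplePath x (i + 1)) : ℂ)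

/-- `e` is the pseudo-expectation of the admissible functional that is the limit in `n` of the
functions of discrete observations `∑ₖ F n k`: all `F n k` are tame, the series of their
pseudo-expectations converges absolutely for each `n`, and its sum tends to `e`. -/
def HasPseudoExpectation (N : ℕ) (F : ∀ _n k : ℕ, (Fin k → ℝ) → ℂ) (e : ℂ) : Prop :=
  (∀ n k, IsTame (F n k)) ∧
  (∀ n, Summable fun k => ‖tameExpectation N n k (F n k)‖) ∧
  Tendsto (fun n => ∑' k, tameExpectation N n k (F n k)) atTop (𝓝 e)

/-- The step process `X_n(t) = X_{k}` for `t ∈ [k/2^n, (k+1)/2^n)`. -/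
def stepProcess (n : ℕ) (X : ℕ → ℝ) (t : ℝ) : ℝ := X ⌊2 ^ n * t⌋₊

/-- The sojourn time `T_n(t) = ∫_0^t 1_{[0,∞)}(X_n(u)) du`. -/
def sojournTime (n : ℕ) (X : ℕ → ℝ) (t : ℝ) : ℝ :=
  ∫ u in (0 : ℝ)..t, Set.indicator (Set.Ici (0 : ℝ)) (fun _ => (1 : ℝ)) (stepProcess n X u)

/-- The part `∫_{k/2^n}^{(k+1)/2^n} e^{-λt + iμ X_n(t) - ν T_n(t)} dt` of the functional
`∫_0^∞ e^{-λt + iμ X_n(t) - ν T_n(t)} dt`; it depends on `X(1/2^n), …, X(k/2^n)` only. -/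
def laplaceFourierTerm (lam μ ν : ℝ) (n k : ℕ) (x : Fin k → ℝ) : ℂ :=
  ∫ t in ((k : ℝ) / 2 ^ n)..(((k : ℝ) + 1) / 2 ^ n),
    cexp (-(lam * t) + I * μ * stepProcess n (samplePath x) t
      - ν * sojournTime n (samplePath x) t)

/-- `q t s x` is the joint density `P{T(t) ∈ ds, X(t) ∈ dx}/(ds dx)` of the sojourn time in `[0,∞)` up to
time `t` and the pseudo-process at time `t`, started at `0`: `q` lives on `0 < s < t`, is continuous
there, `e^{-λt} q` is integrable, and the transform
`∫_0^∞ e^{-λt} ∬ e^{iμx - νs} q(t,s,x) ds dx dt` is the pseudo-expectation of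
`∫_0^∞ e^{-λt + iμX(t) - νT(t)} dt` for all `λ, ν > 0` and `μ ∈ ℝ`. -/
structure IsJointDensity (N : ℕ) (q : ℝ → ℝ → ℝ → ℝ) : Prop where
  eq_zero : ∀ t s x, ¬ (0 < s ∧ s < t) → q t s x = 0
  continuousOn : ContinuousOn (fun z : ℝ × ℝ × ℝ => q z.1 z.2.1 z.2.2)
    {z | 0 < z.2.1 ∧ z.2.1 < z.1}
  integrable : ∀ lam : ℝ, 0 < lam →
    Integrable fun z : ℝ × ℝ × ℝ => Real.exp (-(lam * z.1)) * q z.1 z.2.1 z.2.2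
  transform : ∀ lam μ ν : ℝ, 0 < lam → 0 < ν →
    HasPseudoExpectation N (laplaceFourierTerm lam μ ν)
      (∫ z : ℝ × ℝ × ℝ, cexp (-(lam * z.1) + I * μ * z.2.2 - ν * z.2.1) * q z.1 z.2.1 z.2.2)

/-! ### The roots and the special functions -/

/-- The `N`-th roots of `κ_N` with positive real part (`θ_j`, `j ∈ J`). -/
def rootsJ (N : ℕ) : Finset ℂ := (Polynomial.nthRootsFinset N (kappa N)).filter fun θ => 0 < θ.re

/-- The `N`-th roots of `κ_N` with negative real part (`θ_k`, `k ∈ K`). -/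
def rootsK (N : ℕ) : Finset ℂ := (Polynomial.nthRootsFinset N (kappa N)).filter fun θ => θ.re < 0

/-- `∏_{θ' ∈ S \ {θ}} θ' / (θ' - θ)`: this is `A_j` for `S = rootsJ N` and `B_k` for `S = rootsK N`. -/
def rootCoeff (S : Finset ℂ) (θ : ℂ) : ℂ := ∏ θ' ∈ S.erase θ, θ' / (θ' - θ)

/-- The Mittag-Leffler function `E_{a,b}(ξ) = ∑_{r ≥ 0} ξ^r / Γ(ar + b)`. -/
def mittagLeffler (a b : ℝ) (ξ : ℂ) : ℂ := ∑' r : ℕ, ξ ^ r / (Real.Gamma (a * r + b) : ℂ)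

/-- The function `I_{j,m}(τ;x)` with `θ = θ_j`, for `0 ≤ m ≤ N - 1`. -/
def kernelI (N m : ℕ) (θ : ℂ) (τ x : ℝ) : ℂ :=
  (N * I / (2 * Real.pi)) *
    (cexp (-(I * (m / N * Real.pi))) *
        (∫ ξ in Set.Ioi (0 : ℝ), (ξ : ℂ) ^ (N - m - 1) *
          cexp (-(τ * ξ ^ N) - θ * cexp (I * (Real.pi / N)) * x * ξ))
      - cexp (I * (m / N * Real.pi)) *
        (∫ ξ in Set.Ioi (0 : ℝ), (ξ : ℂ) ^ (N - m - 1) *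
          cexp (-(τ * ξ ^ N) - θ * cexp (-(I * (Real.pi / N))) * x * ξ)))

/-- `σ^{1/N-1} E_{1/N,1/N}((θ_k/θ_j)(λσ)^{1/N}) I_{j,#J-1}(s-σ;x)`. -/
def convolutionIntegrand (N : ℕ) (θj θk : ℂ) (lam s x σ : ℝ) : ℂ :=
  ((σ ^ ((1 : ℝ) / N - 1) : ℝ) : ℂ) *
    mittagLeffler (1 / N) (1 / N) (θk / θj * (((lam * σ) ^ ((1 : ℝ) / N) : ℝ) : ℂ)) *
    kernelI N ((rootsJ N).card - 1) θj (s - σ) x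

end

end PseudoProcess

open PseudoProcess

namespace PseudoProcess

/-! ### The roots of `κ_N` -/

/-! Write N = 2M. The proof computes the Laplace–Fourier transform of (T(t), X(t)) in closed form,
writes down an explicit function with that transform, and shows that no other function has it.

The transform comes from a discrete Wiener–Hopf (Spitzer) argument that never uses positivity of the
kernel. With step h, put φ = e^{-hμ^N}, w = e^{-νh} and z = e^{-λh}. Cutting the heat kernel at 0
gives the power series E⁻ and E⁺, exponentials of series built from the transforms of p(kh;·) on
(-∞,0) and on [0,∞), and they satisfy E⁻(1 - zφ) = E⁺(1 - zwφ). A function on the line splits in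
only one way into a part on [0,∞) and a part on (-∞,0), so an induction on the number of steps
identifies the transform of the weighted path density, on each half-line, with a Taylor coefficient
of E⁺ or E⁻ (`integral_stepDensity`, `hasSum_tameExpectation`). As h → 0 the logarithm of E⁻ is a
Riemann sum, the factorization eliminates E⁺, and the limit is E/(λ + ν + μ^N), where log E = ∫
e^{-λt}(1 - e^{-νt})/t ∫_{x<0} e^{iμx}p(t;x) dx dt (`hasPseudoExpectation_laplaceFourierTerm`).

To evaluate E, put a₀ = λ^{1/N} and a₁ = (λ+ν)^{1/N}. A Frullani integral in a, together with the
splitting of N a^{N-1}/(a^N + μ^N) into simple fractions attached to the two half-lines, gives E =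
∏_J (a₁ + iμ/θ)/(a₀ + iμ/θ) (`exp_integral_logIntegrand`). Since a₁^N + μ^N = ∏_J (a₁ - iμ/θ)(a₁ +
iμ/θ), the full transform is ∏_J (a₁ - iμ/θ)⁻¹ (a₀ + iμ/θ)⁻¹.

Each product is the transform of one half-line density. By partial fractions ∏_J (a - iμ/θ)⁻¹ is the
Fourier transform of a^{-(M-1)} ∑ A_θ θ e^{-θay} on y > 0, and a^{-(M-1)} e^{-θay} is the Laplace
transform of the kernel I_θ(·;y) (`laplace_kernelI`, by rotating rays and computing one residue).
Convolving in time and space, with the second factor reflected in space, gives `jointDensity`.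
Injectivity of the transform together with continuity gives uniqueness (`IsJointDensity.unique`).

For the formula, the Laplace transform in t of `jointDensity` is a double sum of integrals ∫_0^∞
I_θ(s;x+y) e^{-θ'by} dy, where b = λ^{1/N} (`laplace_jointDensity`). As functions of s, these and
the Mittag-Leffler convolutions have Laplace transforms which, up to the factor θ, equal a^{-(M-1)}
e^{-θax}/(θa + θ'b), so they coincide (`integral_convolutionIntegrand`). -/

lemma kappa_two_mul (M : ℕ) : kappa (2 * M) = (-1) ^ (1 + M) := by
  simp [kappa]

lemma mem_rootsJ {M : ℕ} (hM : 1 ≤ M) {θ : ℂ} :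
    θ ∈ rootsJ (2 * M) ↔ θ ^ (2 * M) = kappa (2 * M) ∧ 0 < θ.re := by
  rw [rootsJ, Finset.mem_filter, Polynomial.mem_nthRootsFinset (by omega)]

lemma mem_rootsK {M : ℕ} (hM : 1 ≤ M) {θ : ℂ} :
    θ ∈ rootsK (2 * M) ↔ θ ^ (2 * M) = kappa (2 * M) ∧ θ.re < 0 := by
  rw [rootsK, Finset.mem_filter, Polynomial.mem_nthRootsFinset (by omega)]

/-- N is even, so θ and -θ are roots together. Everything about K is reduced to J in this way. -/
lemma rootsK_eq_image_neg {M : ℕ} (hM : 1 ≤ M) :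
    rootsK (2 * M) = (rootsJ (2 * M)).image fun θ => -θ := by
  ext θ
  simp only [Finset.mem_image, mem_rootsK hM, mem_rootsJ hM]
  constructor
  · rintro ⟨h, h'⟩
    exact ⟨-θ, ⟨by rw [(even_two_mul M).neg_pow, h], by simpa using h'⟩, by simp⟩
  · rintro ⟨z, ⟨h, h'⟩, rfl⟩
    exact ⟨by rw [(even_two_mul M).neg_pow, h], by simpa using h'⟩

lemma norm_eq_one_of_pow_eq_kappa {M : ℕ} (hM : 1 ≤ M) {θ : ℂ}
    (h : θ ^ (2 * M) = kappa (2 * M)) : ‖θ‖ = 1 := by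
  have h1 : ‖θ‖ ^ (2 * M) = 1 := by rw [← norm_pow, h, kappa_two_mul]; simp
  exact (pow_eq_one_iff_of_nonneg (norm_nonneg _) (by omega)).1 h1

lemma conj_mem_rootsJ {M : ℕ} (hM : 1 ≤ M) {θ : ℂ} (h : θ ∈ rootsJ (2 * M)) :
    (starRingEnd ℂ) θ ∈ rootsJ (2 * M) := by
  rw [mem_rootsJ hM] at *
  refine ⟨?_, by simpa using h.2⟩
  rw [← map_pow, h.1, kappa_two_mul]
  simp

lemma ne_zero_of_mem_rootsJ {M : ℕ} (hM : 1 ≤ M) {θ : ℂ} (h : θ ∈ rootsJ (2 * M)) : θ ≠ 0 := by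
  rintro rfl
  simpa using ((mem_rootsJ hM).1 h).2

lemma norm_of_mem_rootsJ {M : ℕ} (hM : 1 ≤ M) {θ : ℂ} (h : θ ∈ rootsJ (2 * M)) : ‖θ‖ = 1 :=
  norm_eq_one_of_pow_eq_kappa hM ((mem_rootsJ hM).1 h).1

lemma inv_eq_conj_of_mem_rootsJ {M : ℕ} (hM : 1 ≤ M) {θ : ℂ} (h : θ ∈ rootsJ (2 * M)) :
    θ⁻¹ = (starRingEnd ℂ) θ := by
  rw [Complex.inv_def, Complex.normSq_eq_norm_sq, norm_of_mem_rootsJ hM h]; simp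

/-- A unit root on the imaginary axis has θ² = -1, so its N-th power is (-1)^M, the opposite of κ.
Hence J and K exhaust the roots. -/
lemma re_ne_zero_of_pow_eq_kappa {M : ℕ} (hM : 1 ≤ M) {θ : ℂ}
    (h : θ ^ (2 * M) = kappa (2 * M)) : θ.re ≠ 0 := by
  intro h0
  have h1 := norm_eq_one_of_pow_eq_kappa hM h
  have h2 : θ ^ 2 = -1 := by
    have h3 : θ = I * θ.im := by apply Complex.ext <;> simp [h0]
    have h4 : θ.im ^ 2 = 1 := by
      have := Complex.sq_norm θ
      rw [h1, Complex.normSq_apply, h0] at this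
      nlinarith
    rw [h3, mul_pow, I_sq, ← ofReal_pow, h4]; simp
  rw [pow_mul, h2, kappa_two_mul, pow_add] at h
  have : ((-1 : ℂ)) ^ M ≠ 0 := by simp
  have h5 : (2 : ℂ) * (-1) ^ M = 0 := by linear_combination h
  simp at h5

lemma nthRootsFinset_kappa {M : ℕ} (hM : 1 ≤ M) :
    Polynomial.nthRootsFinset (2 * M) (kappa (2 * M)) = rootsJ (2 * M) ∪ rootsK (2 * M) := by
  ext θ
  rw [Finset.mem_union, mem_rootsJ hM, mem_rootsK hM, Polynomial.mem_nthRootsFinset (by omega)]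
  constructor
  · intro h
    rcases lt_or_gt_of_ne (re_ne_zero_of_pow_eq_kappa hM h) with h' | h'
    · exact Or.inr ⟨h, h'⟩
    · exact Or.inl ⟨h, h'⟩
  · rintro (h | h) <;> exact h.1

lemma disjoint_rootsJ_rootsK (N : ℕ) : Disjoint (rootsJ N) (rootsK N) := by
  rw [Finset.disjoint_left]
  intro θ h h'
  have h1 := (Finset.mem_filter.1 h).2
  have h2 := (Finset.mem_filter.1 h').2
  exact absurd h1 (not_lt.2 h2.le)

lemma kappa_ne_zero (N : ℕ) : kappa N ≠ 0 := by simp [kappa]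

lemma card_nthRootsFinset_kappa {M : ℕ} (hM : 1 ≤ M) :
    (Polynomial.nthRootsFinset (2 * M) (kappa (2 * M))).card = 2 * M := by
  classical
  have hp := Complex.isPrimitiveRoot_exp (2 * M) (by omega)
  rw [Polynomial.nthRootsFinset_def,
    Multiset.toFinset_card_of_nodup (hp.nthRoots_nodup (kappa_ne_zero _)), hp.card_nthRoots,
    if_pos]
  obtain ⟨z, hz⟩ := IsAlgClosed.exists_pow_nat_eq (kappa (2 * M)) (n := 2 * M) (by omega)
  exact ⟨z, hz⟩

lemma card_rootsK_eq {M : ℕ} (hM : 1 ≤ M) : (rootsK (2 * M)).card = (rootsJ (2 * M)).card := by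
  rw [rootsK_eq_image_neg hM, Finset.card_image_of_injective _ neg_injective]

lemma card_rootsJ {M : ℕ} (hM : 1 ≤ M) : (rootsJ (2 * M)).card = M := by
  have h := card_nthRootsFinset_kappa hM
  rw [nthRootsFinset_kappa hM, Finset.card_union_of_disjoint (disjoint_rootsJ_rootsK _),
    card_rootsK_eq hM] at h
  omega

lemma card_rootsK {M : ℕ} (hM : 1 ≤ M) : (rootsK (2 * M)).card = M := by
  rw [card_rootsK_eq hM, card_rootsJ hM]

lemma kappa_eq_exp (M : ℕ) : kappa (2 * M) = cexp (Real.pi * I * (1 + M)) := by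
  rw [kappa_two_mul, show (Real.pi * I * (1 + M) : ℂ) = ((1 + M : ℕ) : ℂ) * (Real.pi * I) by
    push_cast; ring, Complex.exp_nat_mul, exp_pi_mul_I]

/-- The roots with positive real part keep an angular distance `π / N` to the imaginary axis. -/
lemma abs_arg_le_of_mem_rootsJ {M : ℕ} (hM : 1 ≤ M) {θ : ℂ} (h : θ ∈ rootsJ (2 * M)) :
    |arg θ| ≤ Real.pi / 2 - Real.pi / (2 * M) := by
  have hM' : (1 : ℝ) ≤ M := by exact_mod_cast hM
  have hpi := Real.pi_pos
  have hre := ((mem_rootsJ hM).1 h).2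
  have harg : |arg θ| < Real.pi / 2 :=
    Complex.abs_arg_lt_pi_div_two_iff.2 (Or.inl hre)
  have hθ : θ = cexp (arg θ * I) := by
    have := Complex.norm_mul_exp_arg_mul_I θ
    rw [norm_of_mem_rootsJ hM h] at this
    simpa using this.symm
  have h1 := ((mem_rootsJ hM).1 h).1
  rw [hθ, ← Complex.exp_nat_mul, kappa_eq_exp, Complex.exp_eq_exp_iff_exists_int] at h1
  obtain ⟨l, hl⟩ := h1
  have h2 : (2 * M : ℝ) * arg θ = Real.pi * (1 + M + 2 * l) := by
    have : (((2 * M : ℝ) * arg θ : ℝ) : ℂ) * I = ((Real.pi * (1 + M + 2 * l) : ℝ) : ℂ) * I := by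
      push_cast at hl ⊢
      linear_combination hl
    exact_mod_cast mul_right_cancel₀ I_ne_zero this
  rw [abs_lt] at harg
  have h3 : arg θ = Real.pi * (1 + M + 2 * l) / (2 * M) := by
    field_simp; linarith
  -- The strict bound |arg θ| < π/2 only says 1 + 2l < 0 and 1 + 2M + 2l > 0. Both integers are odd,
  -- so they are at most -1 and at least 1, and this parity gap is the angular gap π/(2M).
  have hl1 : (1 : ℤ) + 2 * l < 0 := by
    have : Real.pi * (1 + M + 2 * l) < Real.pi * M := by nlinarith
    have := lt_of_mul_lt_mul_left this hpi.le
    have h4 : ((1 + 2 * l : ℤ) : ℝ) < 0 := by push_cast; linarith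
    exact_mod_cast h4
  have hl2 : (0 : ℤ) < 1 + 2 * M + 2 * l := by
    have : Real.pi * (-M) < Real.pi * (1 + M + 2 * l) := by nlinarith
    have := lt_of_mul_lt_mul_left this hpi.le
    have h4 : (0 : ℝ) < ((1 + 2 * M + 2 * l : ℤ) : ℝ) := by push_cast; linarith
    exact_mod_cast h4
  have hl1' : (1 : ℝ) + 2 * l ≤ -1 := by exact_mod_cast (by omega : (1 : ℤ) + 2 * l ≤ -1)
  have hl2' : (1 : ℝ) ≤ 1 + 2 * M + 2 * l := by
    exact_mod_cast (by omega : (1 : ℤ) ≤ 1 + 2 * M + 2 * l)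
  have e : Real.pi / 2 - Real.pi / (2 * M) = Real.pi * (M - 1) / (2 * M) := by
    field_simp
  rw [e, h3, abs_le, ← neg_div]
  constructor
  · gcongr
    nlinarith
  · gcongr
    linarith

lemma re_mul_exp_of_mem_rootsJ {M : ℕ} (hM : 1 ≤ M) {θ : ℂ} (h : θ ∈ rootsJ (2 * M)) (ψ : ℝ) :
    (θ * cexp (I * ψ)).re = Real.cos (arg θ + ψ) := by
  have hθ : θ = cexp (arg θ * I) := by
    have := Complex.norm_mul_exp_arg_mul_I θ
    rw [norm_of_mem_rootsJ hM h] at this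
    simpa using this.symm
  conv_lhs => rw [hθ, ← Complex.exp_add, show (arg θ * I + I * ψ : ℂ) = ((arg θ + ψ : ℝ) : ℂ) * I by
    push_cast; ring]
  rw [Complex.exp_ofReal_mul_I_re]

lemma re_mul_exp_nonneg_of_mem_rootsJ {M : ℕ} (hM : 1 ≤ M) {θ : ℂ} (h : θ ∈ rootsJ (2 * M)) {ψ : ℝ}
    (hψ : |ψ| ≤ Real.pi / (2 * M)) : 0 ≤ (θ * cexp (I * ψ)).re := by
  rw [re_mul_exp_of_mem_rootsJ hM h]
  have h1 := abs_le.1 (abs_arg_le_of_mem_rootsJ hM h)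
  have h2 := abs_le.1 hψ
  exact Real.cos_nonneg_of_mem_Icc ⟨by linarith, by linarith⟩

/-- The factorization of X^N - κ at a/y, homogenized so that y = 0 is allowed. -/
lemma prod_sub_mul_roots {M : ℕ} (hM : 1 ≤ M) (a y : ℂ) :
    ∏ θ ∈ Polynomial.nthRootsFinset (2 * M) (kappa (2 * M)), (a - y * θ) =
      a ^ (2 * M) - kappa (2 * M) * y ^ (2 * M) := by
  classical
  rcases eq_or_ne y 0 with rfl | hy
  · rw [zero_pow (by omega)]
    simp [card_nthRootsFinset_kappa hM]
  have hp := Complex.isPrimitiveRoot_exp (2 * M) (by omega)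
  have hsplit : Polynomial.Splits (Polynomial.X ^ (2 * M) - Polynomial.C (kappa (2 * M)) :
      Polynomial ℂ) := IsAlgClosed.splits _
  have h1 := hsplit.eq_prod_roots
  have hmonic := Polynomial.monic_X_pow_sub_C (kappa (2 * M)) (n := 2 * M) (by omega)
  rw [hmonic.leadingCoeff] at h1
  have h2 := congrArg (Polynomial.eval (a / y)) h1
  have h3 : (Polynomial.X ^ (2 * M) - Polynomial.C (kappa (2 * M)) : Polynomial ℂ).roots =
    (Polynomial.nthRootsFinset (2 * M) (kappa (2 * M))).val := by
    rw [Polynomial.nthRootsFinset_def, Multiset.toFinset_val,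
      Multiset.dedup_eq_self.2 (hp.nthRoots_nodup (kappa_ne_zero _))]
    rfl
  rw [h3] at h2
  change _ = Polynomial.eval _ (_ * ∏ θ ∈ Polynomial.nthRootsFinset (2 * M) (kappa (2 * M)),
    (Polynomial.X - Polynomial.C θ)) at h2
  simp only [Polynomial.eval_sub, Polynomial.eval_pow, Polynomial.eval_X, Polynomial.eval_C,
    Polynomial.eval_mul, Polynomial.eval_prod] at h2
  have h4 : ∏ θ ∈ Polynomial.nthRootsFinset (2 * M) (kappa (2 * M)), (a - y * θ) =
      y ^ (2 * M) * ∏ θ ∈ Polynomial.nthRootsFinset (2 * M) (kappa (2 * M)), (a / y - θ) := by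
    conv_rhs => rw [← card_nthRootsFinset_kappa hM, ← Finset.prod_const, card_nthRootsFinset_kappa hM,
      ← Finset.prod_mul_distrib]
    refine Finset.prod_congr rfl fun θ _ => ?_
    field_simp
  have h5 : ∏ θ ∈ Polynomial.nthRootsFinset (2 * M) (kappa (2 * M)), (a / y - θ) =
    (a / y) ^ (2 * M) - kappa (2 * M) := by rw [h2]; simp
  rw [h4, h5, div_pow, mul_sub, mul_div_cancel₀ _ (pow_ne_zero _ hy), mul_comm (kappa _)]

/-- On the unit circle inversion is conjugation, which permutes J. -/
lemma prod_rootsJ_inv {M : ℕ} (hM : 1 ≤ M) {α : Type*} [CommMonoid α] (f : ℂ → α) :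
    ∏ θ ∈ rootsJ (2 * M), f θ⁻¹ = ∏ θ ∈ rootsJ (2 * M), f θ := by
  refine Finset.prod_nbij' (fun θ => (starRingEnd ℂ) θ) (fun θ => (starRingEnd ℂ) θ)
    (fun θ h => conj_mem_rootsJ hM h) (fun θ h => conj_mem_rootsJ hM h) (by simp) (by simp) ?_
  intro θ h
  rw [inv_eq_conj_of_mem_rootsJ hM h]

/-- The N linear factors are split over J and K = -J. At y = iμ the right side is a^N + μ^N, so this
is the Wiener–Hopf factorization of the symbol. -/
lemma prod_rootsJ_sub_mul_add {M : ℕ} (hM : 1 ≤ M) (a y : ℂ) :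
    (∏ θ ∈ rootsJ (2 * M), (a - y / θ)) * ∏ θ ∈ rootsJ (2 * M), (a + y / θ) =
      a ^ (2 * M) - kappa (2 * M) * y ^ (2 * M) := by
  rw [← prod_sub_mul_roots hM, nthRootsFinset_kappa hM,
    Finset.prod_union (disjoint_rootsJ_rootsK _), rootsK_eq_image_neg hM,
    Finset.prod_image (by simp)]
  simp only [div_eq_mul_inv]
  rw [prod_rootsJ_inv hM fun θ => a - y * θ, prod_rootsJ_inv hM fun θ => a + y * θ]
  simp

lemma kappa_mul_I_pow (M : ℕ) (y : ℂ) : kappa (2 * M) * (I * y) ^ (2 * M) = -y ^ (2 * M) := by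
  rw [kappa_two_mul, mul_pow, pow_mul I, I_sq, pow_add]
  have : ((-1 : ℂ) ^ M) * (-1) ^ M = 1 := by rw [← mul_pow]; simp
  linear_combination (-y ^ (2 * M)) * this

/-- Logarithmic derivative in a of `prod_rootsJ_sub_mul_add`. It turns the multiplicative
factorization of the symbol into the additive splitting of the resolvent used in `laplace_halfHeat`.
-/
lemma sum_rootsJ_inv_sub_add {M : ℕ} (hM : 1 ≤ M) (a y : ℂ)
    (h1 : ∀ θ ∈ rootsJ (2 * M), a - y / θ ≠ 0) (h2 : ∀ θ ∈ rootsJ (2 * M), a + y / θ ≠ 0) :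
    ∑ θ ∈ rootsJ (2 * M), (a - y / θ)⁻¹ + ∑ θ ∈ rootsJ (2 * M), (a + y / θ)⁻¹ =
      2 * M * a ^ (2 * M - 1) / (a ^ (2 * M) - kappa (2 * M) * y ^ (2 * M)) := by
  have e := funext fun a => prod_rootsJ_sub_mul_add hM a y
  have e2 := congrArg (fun f => logDeriv f a) e
  have hd1 : ∀ θ ∈ rootsJ (2 * M), DifferentiableAt ℂ (fun a => a - y / θ) a := fun θ _ => by fun_prop
  have hd2 : ∀ θ ∈ rootsJ (2 * M), DifferentiableAt ℂ (fun a => a + y / θ) a := fun θ _ => by fun_prop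
  rw [logDeriv_mul a (Finset.prod_ne_zero_iff.2 h1) (Finset.prod_ne_zero_iff.2 h2)
    (by fun_prop) (by fun_prop), logDeriv_prod (f := fun θ a => a - y / θ) h1 hd1,
    logDeriv_prod (f := fun θ a => a + y / θ) h2 hd2] at e2
  have e3 : ∀ c : ℂ, logDeriv (fun a => a - c) a = (a - c)⁻¹ := fun c => by
    simp [logDeriv_apply]
  have e4 : ∀ c : ℂ, logDeriv (fun a => a + c) a = (a + c)⁻¹ := fun c => by
    simp [logDeriv_apply]
  simp only [e3, e4] at e2
  rw [e2, logDeriv_apply]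
  simp

/-- Partial fractions for the product over the roots with positive real part. -/
lemma prod_rootsJ_inv_sub {M : ℕ} (hM : 1 ≤ M) (a y : ℂ) (ha : a ≠ 0)
    (h1 : ∀ θ ∈ rootsJ (2 * M), θ * a - y ≠ 0) :
    ∏ θ ∈ rootsJ (2 * M), (a - y / θ)⁻¹ =
      (a ^ (M - 1))⁻¹ * ∑ θ ∈ rootsJ (2 * M), rootCoeff (rootsJ (2 * M)) θ * θ / (θ * a - y) := by
  classical
  set J := rootsJ (2 * M) with hJ
  have hne : J.Nonempty := by rw [← Finset.card_pos, card_rootsJ hM]; omega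
  have hinj : Set.InjOn (fun θ : ℂ => θ * a) J := fun x _ y _ h => mul_right_cancel₀ ha h
  -- The constant 1 is expanded in the Lagrange basis at the nodes θa. In each term the basis
  -- polynomial cancels all factors of the product but one, and the leftover ratios form
  -- `rootCoeff`.
  have h2 := congrArg (Polynomial.eval y) (Lagrange.sum_basis hinj hne)
  rw [Polynomial.eval_finsetSum, Polynomial.eval_one] at h2
  rw [← mul_one (∏ θ ∈ J, _), ← h2, Finset.mul_sum, Finset.mul_sum]
  refine Finset.sum_congr rfl fun θ hθ => ?_
  have hθ0 := ne_zero_of_mem_rootsJ hM hθ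
  rw [← Finset.mul_prod_erase _ _ hθ, Lagrange.basis, Polynomial.eval_prod, mul_assoc,
    ← Finset.prod_mul_distrib]
  have h3 : ∀ i ∈ J.erase θ, (a - y / i)⁻¹ * Polynomial.eval y (Lagrange.basisDivisor (θ * a) (i * a))
      = a⁻¹ * (i / (i - θ)) := by
    intro i hi
    have hi' := Finset.mem_of_mem_erase hi
    have hi0 := ne_zero_of_mem_rootsJ hM hi'
    have hiy := h1 i hi'
    have hne' : θ - i ≠ 0 := sub_ne_zero.2 (Finset.ne_of_mem_erase hi).symm
    have hne'' : i - θ ≠ 0 := sub_ne_zero.2 (Finset.ne_of_mem_erase hi)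
    rw [Lagrange.basisDivisor]
    simp only [Polynomial.eval_mul, Polynomial.eval_C, Polynomial.eval_sub, Polynomial.eval_X]
    rw [show a - y / i = (i * a - y) / i by field_simp, inv_div, ← sub_mul, mul_inv,
      show y - i * a = -(i * a - y) by ring, show θ - i = -(i - θ) by ring, inv_neg]
    field_simp
  rw [Finset.prod_congr rfl h3, Finset.prod_mul_distrib, Finset.prod_const,
    Finset.card_erase_of_mem hθ, card_rootsJ hM, rootCoeff]
  have := h1 θ hθ
  rw [show a - y / θ = (θ * a - y) / θ by field_simp, inv_div, inv_pow]
  field_simp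

/-- Every factor i/(i - θ) is homogeneous of degree 0 in the roots, so passing from J to -J changes
nothing. -/
lemma rootCoeff_rootsK_neg {M : ℕ} (hM : 1 ≤ M) (θ : ℂ) :
    rootCoeff (rootsK (2 * M)) (-θ) = rootCoeff (rootsJ (2 * M)) θ := by
  rw [rootCoeff, rootCoeff, rootsK_eq_image_neg hM, ← Finset.image_erase neg_injective,
    Finset.prod_image (by simp)]
  refine Finset.prod_congr rfl fun i _ => ?_
  rw [show -i - -θ = -(i - θ) by ring, neg_div_neg_eq]

lemma rootCoeff_conj {M : ℕ} (hM : 1 ≤ M) (θ : ℂ) :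
    rootCoeff (rootsJ (2 * M)) ((starRingEnd ℂ) θ) =
      (starRingEnd ℂ) (rootCoeff (rootsJ (2 * M)) θ) := by
  rw [rootCoeff, rootCoeff, map_prod]
  refine Finset.prod_nbij' (fun θ => (starRingEnd ℂ) θ) (fun θ => (starRingEnd ℂ) θ) ?_ ?_
    (by simp) (by simp) (by simp)
  · intro i hi
    rw [Finset.mem_erase] at *
    exact ⟨fun h => hi.1 (by rw [← h]; simp), conj_mem_rootsJ hM hi.2⟩
  · intro i hi
    rw [Finset.mem_erase] at *
    exact ⟨fun h => hi.1 ((starRingEnd ℂ).injective h), conj_mem_rootsJ hM hi.2⟩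

end PseudoProcess

namespace PseudoProcess

/-! ### Rotation of rays -/

/-- Change of variables `ρ = e^u` in an integral along a ray. -/
lemma integral_ray_eq_integral_exp (f : ℂ → ℂ) (α : ℝ) :
    cexp (I * α) * ∫ ρ in Set.Ioi (0 : ℝ), f (ρ * cexp (I * α)) =
      ∫ u : ℝ, cexp (u + α * I) * f (cexp (u + α * I)) := by
  have h := integral_image_eq_integral_abs_deriv_smul (s := Set.univ) MeasurableSet.univ
    (fun x _ => (Real.hasDerivAt_exp x).hasDerivWithinAt) Real.exp_injective.injOn
    (fun ρ : ℝ => f (ρ * cexp (I * α)))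
  rw [Set.image_univ, Real.range_exp] at h
  rw [h, setIntegral_univ, ← integral_const_mul]
  congr 1
  ext u
  rw [abs_of_pos (Real.exp_pos u), real_smul, Complex.exp_add, mul_comm (α : ℂ) I]
  push_cast
  ring

lemma integrable_exp_of_integrableOn_ray {f : ℂ → ℂ} {α : ℝ}
    (h : IntegrableOn (fun ρ : ℝ => f (ρ * cexp (I * α))) (Set.Ioi 0)) :
    Integrable fun u : ℝ => cexp (u + α * I) * f (cexp (u + α * I)) := by
  have h1 := integrableOn_image_iff_integrableOn_abs_deriv_smul (s := Set.univ) MeasurableSet.univ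
    (fun x _ => (Real.hasDerivAt_exp x).hasDerivWithinAt) Real.exp_injective.injOn
    (fun ρ : ℝ => f (ρ * cexp (I * α)))
  rw [Set.image_univ, Real.range_exp] at h1
  have h2 := (integrableOn_univ.1 (h1.1 h)).const_mul (cexp (I * α))
  refine h2.congr (ae_of_all _ fun u => ?_)
  simp only
  rw [abs_of_pos (Real.exp_pos u), real_smul, Complex.exp_add, mul_comm (α : ℂ) I]
  push_cast
  ring

/-- Integrals along rays inside a sector of holomorphy agree, provided the function is bounded near
the vertex and `O(ρ⁻²)` at infinity. -/
theorem ray_integral_eq {f : ℂ → ℂ} {α β : ℝ} (hαβ : α ≤ β) {C R : ℝ} (hR : 1 ≤ R)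
    (hf : ∀ ρ : ℝ, 0 < ρ → ∀ ψ ∈ Set.Icc α β, DifferentiableAt ℂ f (ρ * cexp (I * ψ)))
    (h0 : ∀ ρ : ℝ, 0 < ρ → ρ ≤ R⁻¹ → ∀ ψ ∈ Set.Icc α β, ‖f (ρ * cexp (I * ψ))‖ ≤ C)
    (h1 : ∀ ρ : ℝ, R ≤ ρ → ∀ ψ ∈ Set.Icc α β, ‖f (ρ * cexp (I * ψ))‖ ≤ C / ρ ^ 2)
    (hα : IntegrableOn (fun ρ : ℝ => f (ρ * cexp (I * α))) (Set.Ioi 0))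
    (hβ : IntegrableOn (fun ρ : ℝ => f (ρ * cexp (I * β))) (Set.Ioi 0)) :
    cexp (I * α) * ∫ ρ in Set.Ioi (0 : ℝ), f (ρ * cexp (I * α)) =
      cexp (I * β) * ∫ ρ in Set.Ioi (0 : ℝ), f (ρ * cexp (I * β)) := by
  rw [integral_ray_eq_integral_exp, integral_ray_eq_integral_exp]
  -- In the coordinate w = log z the sector is the strip α ≤ Im w ≤ β and the rays are its edges.
  -- Cauchy's theorem is applied to the rectangles |Re w| ≤ T.
  set F : ℂ → ℂ := fun w => cexp w * f (cexp w) with hF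
  have hexp : ∀ u ψ : ℝ, cexp (u + ψ * I) = (Real.exp u : ℝ) * cexp (I * ψ) := fun u ψ => by
    rw [Complex.exp_add, mul_comm (ψ : ℂ) I]; push_cast; rfl
  have hdiff : ∀ w : ℂ, w.im ∈ Set.Icc α β → DifferentiableAt ℂ F w := by
    intro w hw
    have h2 : cexp w = (Real.exp w.re : ℝ) * cexp (I * w.im) := by
      rw [← hexp, re_add_im]
    have h3 := hf _ (Real.exp_pos w.re) _ hw
    rw [← h2] at h3
    exact Complex.differentiable_exp.differentiableAt.mul
      (h3.comp w Complex.differentiable_exp.differentiableAt)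
  have hC : 0 ≤ C := (norm_nonneg _).trans
    (h0 R⁻¹ (by positivity) le_rfl α ⟨le_rfl, hαβ⟩)
  have hcauchy : ∀ T : ℝ, (∫ u in (-T)..T, F (u + α * I)) - (∫ u in (-T)..T, F (u + β * I)) =
      -(I * ∫ y in α..β, F (T + y * I)) + I * ∫ y in α..β, F ((-T : ℝ) + y * I) := by
    intro T
    have h := integral_boundary_rect_eq_zero_of_differentiableOn F ((-T : ℝ) + α * I) (T + β * I) ?_
    · simp only [add_re, ofReal_re, mul_re, I_re, mul_zero, ofReal_im, I_im, mul_one, sub_self,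
        add_zero, add_im, mul_im, zero_add, smul_eq_mul] at h
      linear_combination h
    · intro w hw
      refine (hdiff w ?_).differentiableWithinAt
      have := hw.2
      simp only [add_im, ofReal_im, mul_im, ofReal_re, I_im, mul_one, I_re, mul_zero, add_zero,
        zero_add, Set.uIcc_of_le hαβ] at this
      simpa using this
  -- Both vertical sides are O(e^{-T}): on the right the decay ρ⁻² beats the Jacobian e^T, and on
  -- the left boundedness of f is multiplied by the Jacobian e^{-T}.
  have hright : Tendsto (fun T : ℝ => ∫ y in α..β, F (T + y * I)) atTop (𝓝 0) := by
    refine squeeze_zero_norm' (a := fun T => C * Real.exp (-T) * |β - α|) ?_ ?_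
    · filter_upwards [eventually_ge_atTop (Real.log R)] with T hT
      refine intervalIntegral.norm_integral_le_of_norm_le_const fun y hy => ?_
      rw [Set.uIoc_of_le hαβ] at hy
      have hRT : R ≤ Real.exp T := by
        rwa [Real.log_le_iff_le_exp (by linarith)] at hT
      have h2 := h1 (Real.exp T) hRT y ⟨hy.1.le, hy.2⟩
      simp only [hF, norm_mul]
      rw [hexp T y]
      calc _ ≤ Real.exp T * (C / Real.exp T ^ 2) := by
            gcongr
            rw [norm_mul, norm_real, mul_comm I, norm_exp_ofReal_mul_I]
            simp
        _ = _ := by rw [Real.exp_neg]; field_simp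
    · have : Tendsto (fun T : ℝ => C * Real.exp (-T) * |β - α|) atTop (𝓝 (C * 0 * |β - α|)) :=
        (Real.tendsto_exp_neg_atTop_nhds_zero.const_mul C).mul_const _
      simpa using this
  have hleft : Tendsto (fun T : ℝ => ∫ y in α..β, F ((-T : ℝ) + y * I)) atTop (𝓝 0) := by
    refine squeeze_zero_norm' (a := fun T => C * Real.exp (-T) * |β - α|) ?_ ?_
    · filter_upwards [eventually_ge_atTop (Real.log R)] with T hT
      refine intervalIntegral.norm_integral_le_of_norm_le_const fun y hy => ?_
      rw [Set.uIoc_of_le hαβ] at hy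
      have hRT : Real.exp (-T) ≤ R⁻¹ := by
        rw [Real.exp_neg]
        rw [Real.log_le_iff_le_exp (by linarith)] at hT
        gcongr
      have h2 := h0 (Real.exp (-T)) (Real.exp_pos _) hRT y ⟨hy.1.le, hy.2⟩
      simp only [hF, norm_mul]
      rw [hexp (-T) y]
      calc _ ≤ Real.exp (-T) * C := by
            gcongr
            rw [norm_mul, norm_real, mul_comm I, norm_exp_ofReal_mul_I]
            simp
        _ = _ := by ring
    · have : Tendsto (fun T : ℝ => C * Real.exp (-T) * |β - α|) atTop (𝓝 (C * 0 * |β - α|)) :=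
        (Real.tendsto_exp_neg_atTop_nhds_zero.const_mul C).mul_const _
      simpa using this
  have hA := intervalIntegral_tendsto_integral (integrable_exp_of_integrableOn_ray hα)
    tendsto_neg_atTop_atBot tendsto_id
  have hB := intervalIntegral_tendsto_integral (integrable_exp_of_integrableOn_ray hβ)
    tendsto_neg_atTop_atBot tendsto_id
  have h2 := hA.sub hB
  have h3 := ((hright.const_mul I).neg.add (hleft.const_mul I))
  have h4 := tendsto_nhds_unique (h2.congr hcauchy) h3
  simp only [mul_zero, neg_zero, add_zero] at h4
  exact sub_eq_zero.1 h4

end PseudoProcess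

namespace PseudoProcess

/-! ### The kernel `I_{j,#J-1}` as a difference of ray integrals -/

/-- The integral of `f` along the ray of angle `ψ`. -/
noncomputable def rayIntegral (f : ℂ → ℂ) (ψ : ℝ) : ℂ :=
  cexp (I * ψ) * ∫ ρ in Set.Ioi (0 : ℝ), f (ρ * cexp (I * ψ))

/-- The integrand `z^M e^{τ z^{2M} - θ x z}`. -/
noncomputable def kernelFun (M : ℕ) (θ : ℂ) (τ x : ℝ) (z : ℂ) : ℂ :=
  z ^ M * cexp (τ * z ^ (2 * M) - θ * x * z)

/-- The angle of the rays used to represent the kernel. -/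
noncomputable def rayAngle (M : ℕ) : ℝ := 3 * Real.pi / (8 * M)

/-- A lower bound for `Re (θ e^{iψ})`, `|ψ| ≤ rayAngle M`. -/
noncomputable def rayDecay (M : ℕ) : ℝ := Real.sin (Real.pi / (8 * M))

/-- The function dominating the kernel. -/
noncomputable def majorant (M : ℕ) (τ x : ℝ) : ℝ :=
  ∫ ρ in Set.Ioi (0 : ℝ), ρ ^ M * Real.exp (-(τ / 2 * ρ ^ (2 * M)) - rayDecay M * x * ρ)

lemma rayDecay_pos {M : ℕ} (hM : 1 ≤ M) : 0 < rayDecay M := by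
  have hM' : (1 : ℝ) ≤ M := by exact_mod_cast hM
  apply Real.sin_pos_of_pos_of_lt_pi
  · positivity
  · rw [div_lt_iff₀ (by positivity)]
    nlinarith [Real.pi_pos]

lemma rayAngle_pos {M : ℕ} (hM : 1 ≤ M) : 0 < rayAngle M := by
  have hM' : (1 : ℝ) ≤ M := by exact_mod_cast hM
  unfold rayAngle; positivity

lemma rayAngle_lt {M : ℕ} (hM : 1 ≤ M) : rayAngle M < Real.pi / (2 * M) := by
  have hM' : (1 : ℝ) ≤ M := by exact_mod_cast hM
  unfold rayAngle
  rw [div_lt_div_iff₀ (by positivity) (by positivity)]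
  nlinarith [Real.pi_pos, mul_pos Real.pi_pos (by linarith : (0 : ℝ) < M)]

/-- Roots in J have |arg θ| ≤ π/2 - π/(2M). The angle 3π/(8M) is three quarters of π/(2M), so
θe^{iψ} stays at angle π/(8M) from the imaginary axis. On the original rays ±π/N this margin is lost
for the extreme roots, and with it the decay in x. -/
lemma rayDecay_le {M : ℕ} (hM : 1 ≤ M) {θ : ℂ} (h : θ ∈ rootsJ (2 * M)) {ψ : ℝ}
    (hψ : |ψ| ≤ rayAngle M) : rayDecay M ≤ (θ * cexp (I * ψ)).re := by
  have hM' : (1 : ℝ) ≤ M := by exact_mod_cast hM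
  rw [re_mul_exp_of_mem_rootsJ hM h, rayDecay, ← Real.cos_pi_div_two_sub, ← Real.cos_abs (arg θ + ψ)]
  have h1 := abs_arg_le_of_mem_rootsJ hM h
  have h2 := abs_add_le (arg θ) ψ
  have e : Real.pi / 2 - Real.pi / (2 * M) + rayAngle M = Real.pi / 2 - Real.pi / (8 * M) := by
    unfold rayAngle; field_simp; ring
  have h3 : 0 < Real.pi / (8 * M) := by positivity
  apply Real.cos_le_cos_of_nonneg_of_le_pi (abs_nonneg _)
  · linarith [Real.pi_pos]
  · linarith

/-- Here 2M|ψ| runs over [3π/4, π], beyond 2π/3. The cruder value -1/2 is enough. -/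
lemma cos_two_mul_mul_le {M : ℕ} (hM : 1 ≤ M) {ψ : ℝ} (h1 : rayAngle M ≤ |ψ|)
    (h2 : |ψ| ≤ Real.pi / (2 * M)) : Real.cos (2 * M * ψ) ≤ -(1 / 2) := by
  have hM' : (1 : ℝ) ≤ M := by exact_mod_cast hM
  have hpi := Real.pi_pos
  rw [← Real.cos_abs, abs_mul, abs_of_pos (by positivity : (0 : ℝ) < 2 * M)]
  have e : Real.cos (Real.pi - Real.pi / 3) = -(1 / 2) := by
    rw [Real.cos_pi_sub, Real.cos_pi_div_three]
  rw [← e]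
  rw [rayAngle, div_le_iff₀ (by positivity)] at h1
  rw [le_div_iff₀ (by positivity)] at h2
  apply Real.cos_le_cos_of_nonneg_of_le_pi <;> linarith

lemma norm_kernelFun (M : ℕ) (θ : ℂ) (τ x : ℝ) {ρ : ℝ} (hρ : 0 ≤ ρ) (ψ : ℝ) :
    ‖kernelFun M θ τ x (ρ * cexp (I * ψ))‖ =
      ρ ^ M * Real.exp (τ * (ρ ^ (2 * M) * Real.cos (2 * M * ψ)) -
        x * ρ * (θ * cexp (I * ψ)).re) := by
  have e : ((τ : ℂ) * (ρ * cexp (I * ψ)) ^ (2 * M)) =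
      ((τ * ρ ^ (2 * M) : ℝ) : ℂ) * cexp ((2 * M * ψ : ℝ) * I) := by
    rw [mul_pow, ← Complex.exp_nat_mul]; push_cast
    rw [show (2 * (M : ℂ) * (I * ψ)) = 2 * M * ψ * I by ring]; ring
  have e2 : θ * x * (ρ * cexp (I * ψ)) = ((x * ρ : ℝ) : ℂ) * (θ * cexp (I * ψ)) := by
    push_cast; ring
  rw [kernelFun, norm_mul, norm_pow, norm_mul, norm_real, mul_comm I, norm_exp_ofReal_mul_I, mul_one,
    Real.norm_of_nonneg hρ, Complex.norm_exp, mul_comm (ψ : ℂ) I, sub_re, e, e2, re_ofReal_mul,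
    re_ofReal_mul, Complex.exp_ofReal_mul_I_re, mul_assoc]

lemma norm_kernelFun_le {M : ℕ} {θ : ℂ} {τ x ρ ψ : ℝ} (hτ : 0 ≤ τ) (hx : 0 ≤ x) (hρ : 0 ≤ ρ)
    {d : ℝ} (hψ : Real.cos (2 * M * ψ) ≤ -(1 / 2)) (hd : d ≤ (θ * cexp (I * ψ)).re) :
    ‖kernelFun M θ τ x (ρ * cexp (I * ψ))‖ ≤
      ρ ^ M * Real.exp (-(τ / 2 * ρ ^ (2 * M)) - d * x * ρ) := by
  rw [norm_kernelFun _ _ _ _ hρ]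
  have h1 : x * ρ * d ≤ x * ρ * (θ * cexp (I * ψ)).re := by gcongr
  have h2 : τ * (ρ ^ (2 * M) * Real.cos (2 * M * ψ)) ≤ τ * (ρ ^ (2 * M) * -(1 / 2)) := by gcongr
  refine mul_le_mul_of_nonneg_left (Real.exp_le_exp.2 ?_) (by positivity)
  linarith

lemma continuous_kernelFun_ray (M : ℕ) (θ : ℂ) (τ x ψ : ℝ) :
    Continuous fun ρ : ℝ => kernelFun M θ τ x (ρ * cexp (I * ψ)) := by
  unfold kernelFun; fun_prop

lemma integrableOn_pow_mul_exp_neg_mul_pow {M : ℕ} (hM : 1 ≤ M) {b : ℝ} (hb : 0 < b) (k : ℕ) :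
    IntegrableOn (fun ρ : ℝ => ρ ^ k * Real.exp (-(b * ρ ^ (2 * M)))) (Set.Ioi 0) := by
  have h := integrableOn_rpow_mul_exp_neg_mul_rpow (p := (2 * M : ℕ)) (s := k) (b := b)
    (by have : (0 : ℝ) ≤ k := by positivity
        linarith) (by norm_cast; omega) hb
  simpa only [Real.rpow_natCast, neg_mul] using h

lemma integrableOn_majorant {M : ℕ} (hM : 1 ≤ M) {τ x : ℝ} (hτ : 0 < τ) (hx : 0 ≤ x) :
    IntegrableOn (fun ρ : ℝ => ρ ^ M * Real.exp (-(τ / 2 * ρ ^ (2 * M)) - rayDecay M * x * ρ))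
      (Set.Ioi 0) := by
  refine (integrableOn_pow_mul_exp_neg_mul_pow hM (half_pos hτ) M).mono'
    (by fun_prop) ?_
  refine (ae_restrict_mem measurableSet_Ioi).mono fun ρ hρ => ?_
  have hρ' : (0 : ℝ) < ρ := hρ
  have hd := rayDecay_pos hM
  rw [Real.norm_of_nonneg (by positivity)]
  gcongr
  have : 0 ≤ rayDecay M * x * ρ := by positivity
  linarith

lemma integrableOn_kernelFun {M : ℕ} (hM : 1 ≤ M) {θ : ℂ} {τ x ψ : ℝ} (hτ : 0 < τ) (hx : 0 ≤ x)
    (hψ : Real.cos (2 * M * ψ) ≤ -(1 / 2)) (hd : 0 ≤ (θ * cexp (I * ψ)).re) :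
    IntegrableOn (fun ρ : ℝ => kernelFun M θ τ x (ρ * cexp (I * ψ))) (Set.Ioi 0) := by
  refine (integrableOn_pow_mul_exp_neg_mul_pow hM (half_pos hτ) M).mono'
    (continuous_kernelFun_ray _ _ _ _ _).aestronglyMeasurable ?_
  refine (ae_restrict_mem measurableSet_Ioi).mono fun ρ hρ => ?_
  have hρ' : (0 : ℝ) < ρ := hρ
  simpa using norm_kernelFun_le hτ.le hx hρ'.le hψ hd

lemma rayIntegral_kernelFun_eq {M : ℕ} (hM : 1 ≤ M) {θ : ℂ} {τ x α β : ℝ} (hτ : 0 < τ) (hx : 0 ≤ x)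
    (hαβ : α ≤ β) (hψ : ∀ ψ ∈ Set.Icc α β, Real.cos (2 * M * ψ) ≤ -(1 / 2))
    (hd : ∀ ψ ∈ Set.Icc α β, 0 ≤ (θ * cexp (I * ψ)).re) :
    rayIntegral (kernelFun M θ τ x) α = rayIntegral (kernelFun M θ τ x) β := by
  -- The 1 serves near the vertex. The 8/τ² comes from e^y ≥ y²/2 at y = τρ^{2M}/2, combined with
  -- ρ^{M+2} ≤ ρ^{4M} for ρ ≥ 1.
  refine ray_integral_eq (C := max 1 (8 / τ ^ 2)) hαβ le_rfl (fun ρ _ ψ _ => ?_) ?_ ?_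
    (integrableOn_kernelFun hM hτ hx (hψ α ⟨le_rfl, hαβ⟩) (hd α ⟨le_rfl, hαβ⟩))
    (integrableOn_kernelFun hM hτ hx (hψ β ⟨hαβ, le_rfl⟩) (hd β ⟨hαβ, le_rfl⟩))
  · unfold kernelFun; fun_prop
  · intro ρ hρ hρ1 ψ h
    refine (norm_kernelFun_le hτ.le hx hρ.le (hψ ψ h) (hd ψ h)).trans (le_max_of_le_left ?_)
    have h1 : ρ ^ M ≤ 1 := pow_le_one₀ hρ.le (by simpa using hρ1)
    have h2 : Real.exp (-(τ / 2 * ρ ^ (2 * M)) - 0 * x * ρ) ≤ 1 := by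
      rw [Real.exp_le_one_iff]
      have : 0 ≤ τ / 2 * ρ ^ (2 * M) := by positivity
      linarith
    calc _ ≤ (1 : ℝ) * 1 := by gcongr
      _ = 1 := one_mul 1
  · intro ρ hρ ψ h
    have hρ0 : 0 < ρ := by linarith
    refine (norm_kernelFun_le hτ.le hx hρ0.le (hψ ψ h) (hd ψ h)).trans ?_
    rw [le_div_iff₀ (by positivity), zero_mul, zero_mul, sub_zero, Real.exp_neg]
    refine le_trans ?_ (le_max_right _ _)
    have h3 := Real.pow_div_factorial_le_exp (τ / 2 * ρ ^ (2 * M)) (by positivity) 2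
    have h4 : ρ ^ (M + 2) ≤ ρ ^ (2 * M * 2) := pow_le_pow_right₀ hρ (by omega)
    rw [show ρ ^ M * (Real.exp (τ / 2 * ρ ^ (2 * M)))⁻¹ * ρ ^ 2 =
      ρ ^ (M + 2) / Real.exp (τ / 2 * ρ ^ (2 * M)) by rw [pow_add]; ring,
      div_le_iff₀ (Real.exp_pos _)]
    refine h4.trans ?_
    rw [pow_mul]
    have h5 : (8 / τ ^ 2) * ((τ / 2 * ρ ^ (2 * M)) ^ 2 / (Nat.factorial 2 : ℕ)) ≤
      8 / τ ^ 2 * Real.exp (τ / 2 * ρ ^ (2 * M)) := by gcongr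
    refine le_trans (le_of_eq ?_) h5
    simp only [Nat.factorial]
    field_simp
    push_cast
    ring

/-- On the rays ±π/N one has z^N = -ξ^N, so e^{τz^N - θxz} reproduces the two exponentials of I. The
direction factor times z^M has phase e^{±iπ(M+1)/N} = -e^{∓iπ(M-1)/N}; this sign is why the lower
ray comes first in the difference. -/
lemma kernelI_eq_rayIntegral_pi_div {M : ℕ} (hM : 1 ≤ M) (θ : ℂ) (τ x : ℝ) :
    kernelI (2 * M) (M - 1) θ τ x = M * I / Real.pi *
      (rayIntegral (kernelFun M θ τ x) (-(Real.pi / (2 * M))) -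
        rayIntegral (kernelFun M θ τ x) (Real.pi / (2 * M))) := by
  have hM' : (M : ℂ) ≠ 0 := by exact_mod_cast (by omega : M ≠ 0)
  have key : ∀ ε : ℝ, (ε = 1 ∨ ε = -1) → rayIntegral (kernelFun M θ τ x) (ε * (Real.pi / (2 * M))) =
      -(cexp (-(ε * I * ((M - 1 : ℕ) / (2 * M : ℕ) * Real.pi)))) *
        (∫ ξ in Set.Ioi (0 : ℝ), (ξ : ℂ) ^ M *
          cexp (-(τ * ξ ^ (2 * M)) - θ * cexp (ε * I * (Real.pi / (2 * M : ℕ))) * x * ξ)) := by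
    intro ε hε
    have hN : cexp (I * (ε * (Real.pi / (2 * M)) : ℝ)) ^ (2 * M) = -1 := by
      rw [← Complex.exp_nat_mul]
      rcases hε with rfl | rfl
      · rw [show (((2 * M : ℕ) : ℂ) * (I * (1 * (Real.pi / (2 * M)) : ℝ))) = Real.pi * I by
          push_cast; field_simp, exp_pi_mul_I]
      · rw [show (((2 * M : ℕ) : ℂ) * (I * (-1 * (Real.pi / (2 * M)) : ℝ))) = -(Real.pi * I) by
          push_cast; field_simp, Complex.exp_neg, exp_pi_mul_I]; norm_num
    have hM1 : cexp (I * (ε * (Real.pi / (2 * M)) : ℝ)) * cexp (I * (ε * (Real.pi / (2 * M)) : ℝ)) ^ M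
        = -(cexp (-(ε * I * ((M - 1 : ℕ) / (2 * M : ℕ) * Real.pi)))) := by
      rw [← pow_succ', ← Complex.exp_nat_mul, ← neg_one_mul]
      have h1 : (-1 : ℂ) = cexp (ε * (Real.pi * I)) := by
        rcases hε with rfl | rfl
        · simp
        · rw [show (((-1 : ℝ) : ℂ) * (Real.pi * I)) = -(Real.pi * I) by push_cast; ring,
            Complex.exp_neg, exp_pi_mul_I]; norm_num
      rw [h1, ← Complex.exp_add, Nat.cast_sub hM]
      congr 1
      push_cast
      field_simp
      ring
    rw [← hM1, rayIntegral, mul_assoc]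
    congr 1
    rw [← integral_const_mul]
    refine setIntegral_congr_fun measurableSet_Ioi fun ξ _ => ?_
    simp only [kernelFun]
    rw [mul_pow, mul_pow, hN]
    have e : (I * (ε * (Real.pi / (2 * M)) : ℝ)) = ε * I * (Real.pi / (2 * M : ℕ)) := by
      push_cast; ring
    rw [e]
    rw [show (τ : ℂ) * (ξ ^ (2 * M) * -1) - θ * x * (ξ * cexp (ε * I * (Real.pi / (2 * M : ℕ)))) =
      -(τ * ξ ^ (2 * M)) - θ * cexp (ε * I * (Real.pi / (2 * M : ℕ))) * x * ξ by ring]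
    ring
  have k1 := key 1 (Or.inl rfl)
  have k2 := key (-1) (Or.inr rfl)
  rw [one_mul] at k1
  rw [neg_one_mul] at k2
  rw [k1, k2, kernelI, show 2 * M - (M - 1) - 1 = M by omega]
  simp only [ofReal_one, ofReal_neg, one_mul, neg_mul, neg_neg]
  push_cast
  ring

/-- The kernel as a difference of two rapidly convergent ray integrals. -/
lemma kernelI_eq_rayIntegral {M : ℕ} (hM : 1 ≤ M) {θ : ℂ} (h : θ ∈ rootsJ (2 * M)) {τ x : ℝ}
    (hτ : 0 < τ) (hx : 0 ≤ x) :
    kernelI (2 * M) (M - 1) θ τ x = M * I / Real.pi *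
      (rayIntegral (kernelFun M θ τ x) (-rayAngle M) -
        rayIntegral (kernelFun M θ τ x) (rayAngle M)) := by
  have h0 := rayAngle_pos hM
  have h1 := rayAngle_lt hM
  rw [kernelI_eq_rayIntegral_pi_div hM]
  congr 2
  · refine rayIntegral_kernelFun_eq hM hτ hx (by linarith) (fun ψ hψ => ?_) (fun ψ hψ => ?_)
    · apply cos_two_mul_mul_le hM <;> rw [abs_of_nonpos (by linarith [hψ.2])] <;>
        linarith [hψ.1, hψ.2]
    · apply re_mul_exp_nonneg_of_mem_rootsJ hM h
      rw [abs_of_nonpos (by linarith [hψ.2])]; linarith [hψ.1]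
  · refine (rayIntegral_kernelFun_eq hM hτ hx (by linarith) (fun ψ hψ => ?_) (fun ψ hψ => ?_)).symm
    · apply cos_two_mul_mul_le hM <;> rw [abs_of_nonneg (by linarith [hψ.1])] <;>
        linarith [hψ.1, hψ.2]
    · apply re_mul_exp_nonneg_of_mem_rootsJ hM h
      rw [abs_of_nonneg (by linarith [hψ.1])]; linarith [hψ.2]

lemma cos_rayAngle {M : ℕ} (hM : 1 ≤ M) {ψ : ℝ} (hψ : |ψ| = rayAngle M) :
    Real.cos (2 * M * ψ) ≤ -(1 / 2) :=
  cos_two_mul_mul_le hM hψ.ge (hψ.le.trans (rayAngle_lt hM).le)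

lemma norm_rayIntegral_kernelFun_le {M : ℕ} (hM : 1 ≤ M) {θ : ℂ} (h : θ ∈ rootsJ (2 * M)) {τ x ψ : ℝ}
    (hτ : 0 < τ) (hx : 0 ≤ x) (hψ : |ψ| = rayAngle M) :
    ‖rayIntegral (kernelFun M θ τ x) ψ‖ ≤ majorant M τ x := by
  rw [rayIntegral, norm_mul, mul_comm I, norm_exp_ofReal_mul_I, one_mul]
  refine norm_integral_le_of_norm_le (integrableOn_majorant hM hτ hx) ?_
  refine (ae_restrict_mem measurableSet_Ioi).mono fun ρ hρ => ?_
  have hρ' : (0 : ℝ) < ρ := hρ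
  rw [mul_comm _ I]
  exact norm_kernelFun_le hτ.le hx hρ'.le (cos_rayAngle hM hψ) (rayDecay_le hM h hψ.le)

lemma norm_kernelI_le {M : ℕ} (hM : 1 ≤ M) {θ : ℂ} (h : θ ∈ rootsJ (2 * M)) {τ x : ℝ}
    (hτ : 0 < τ) (hx : 0 ≤ x) :
    ‖kernelI (2 * M) (M - 1) θ τ x‖ ≤ M * majorant M τ x := by
  rw [kernelI_eq_rayIntegral hM h hτ hx, norm_mul]
  have h1 := norm_rayIntegral_kernelFun_le hM h hτ hx (abs_of_pos (rayAngle_pos hM))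
  have h2 := norm_rayIntegral_kernelFun_le hM h hτ hx
    ((abs_neg _).trans (abs_of_pos (rayAngle_pos hM)))
  have h3 := (norm_sub_le _ _).trans (add_le_add h2 h1)
  have h0 : 0 ≤ majorant M τ x := (norm_nonneg _).trans h1
  have h4 : ‖(M : ℂ) * I / Real.pi‖ ≤ M * (1 / 2) := by
    rw [norm_div, norm_mul, norm_I, mul_one, Complex.norm_natCast, norm_real,
      Real.norm_of_nonneg Real.pi_pos.le, div_eq_mul_one_div]
    gcongr
    linarith [Real.pi_gt_three]
  calc _ ≤ M * (1 / 2) * (majorant M τ x + majorant M τ x) := by gcongr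
    _ = _ := by ring

end PseudoProcess

namespace PseudoProcess

/-! ### The Laplace transform of the kernel -/

lemma pow_le_one_add_pow {ρ : ℝ} (hρ : 0 ≤ ρ) {k n : ℕ} (h : k ≤ n) : ρ ^ k ≤ 1 + ρ ^ n := by
  rcases le_total ρ 1 with h1 | h1
  · have := pow_le_one₀ hρ h1 (n := k)
    have := pow_nonneg hρ n
    linarith
  · have := pow_le_pow_right₀ h1 h
    linarith

lemma integrableOn_pow_div_add_pow {M k : ℕ} (h : k + 2 ≤ 2 * M) {lam : ℝ} (hlam : 0 < lam) :
    IntegrableOn (fun ρ : ℝ => ρ ^ k / (lam + ρ ^ (2 * M) / 2)) (Set.Ioi 0) := by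
  have h1 : IntegrableOn (fun ρ : ℝ => 2 * max lam⁻¹ 2 * (1 + ρ ^ 2)⁻¹) (Set.Ioi 0) :=
    (integrable_inv_one_add_sq.const_mul _).integrableOn
  refine h1.mono' ?_ ?_
  · refine (ContinuousOn.div₀ (by fun_prop) (by fun_prop) fun ρ hρ => ?_).aestronglyMeasurable
      measurableSet_Ioi
    have hρ' : (0 : ℝ) < ρ := hρ
    positivity
  · refine (ae_restrict_mem measurableSet_Ioi).mono fun ρ hρ => ?_
    have hρ' : (0 : ℝ) < ρ := hρ
    rw [Real.norm_of_nonneg (by positivity), ← div_eq_mul_inv, div_le_div_iff₀ (by positivity)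
      (by positivity)]
    have h2 := pow_le_one_add_pow hρ'.le (show k ≤ 2 * M by omega)
    have h3 := pow_le_one_add_pow hρ'.le h
    have h4 : (1 : ℝ) ≤ max lam⁻¹ 2 * lam := by
      calc (1 : ℝ) = lam⁻¹ * lam := by field_simp
        _ ≤ _ := by gcongr; exact le_max_left _ _
    have h5 : (2 : ℝ) ≤ max lam⁻¹ 2 := le_max_right _ _
    have h6 : 0 ≤ ρ ^ (2 * M) := by positivity
    have h7 : 2 * ρ ^ (2 * M) ≤ max lam⁻¹ 2 * ρ ^ (2 * M) := by gcongr
    calc ρ ^ k * (1 + ρ ^ 2) = ρ ^ k + ρ ^ (k + 2) := by ring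
      _ ≤ 2 * (1 + ρ ^ (2 * M)) := by linarith
      _ ≤ _ := by nlinarith

/-- The Laplace transform in `τ` of `kernelFun`. -/
noncomputable def resolventFun (M : ℕ) (θ : ℂ) (lam x : ℝ) (z : ℂ) : ℂ :=
  z ^ M * cexp (-(θ * x * z)) / (lam - z ^ (2 * M))

/-- At infinity the algebraic part is of order ρ^{-M}, which is integrable only for M ≥ 2; otherwise
the exponential with x > 0 is needed. This is the origin of the restriction x > 0 when N = 2. -/
lemma integrableOn_resolvent_majorant {M : ℕ} (hM : 1 ≤ M) {lam x : ℝ} (hlam : 0 < lam)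
    (hx : 0 ≤ x) (h : 2 ≤ M ∨ 0 < x) :
    IntegrableOn (fun ρ : ℝ => ρ ^ M * Real.exp (-(rayDecay M * x * ρ)) / (lam + ρ ^ (2 * M) / 2))
      (Set.Ioi 0) := by
  have hd := rayDecay_pos hM
  have hmeas : AEStronglyMeasurable (fun ρ : ℝ => ρ ^ M * Real.exp (-(rayDecay M * x * ρ)) /
      (lam + ρ ^ (2 * M) / 2)) (volume.restrict (Set.Ioi 0)) := by
    refine (ContinuousOn.div₀ (by fun_prop) (by fun_prop) fun ρ hρ => ?_).aestronglyMeasurable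
      measurableSet_Ioi
    have hρ' : (0 : ℝ) < ρ := hρ
    positivity
  rcases h with h | h
  · refine (integrableOn_pow_div_add_pow (k := M) (M := M) (by omega) hlam).mono' hmeas ?_
    refine (ae_restrict_mem measurableSet_Ioi).mono fun ρ hρ => ?_
    have hρ' : (0 : ℝ) < ρ := hρ
    rw [Real.norm_of_nonneg (by positivity)]
    have : Real.exp (-(rayDecay M * x * ρ)) ≤ 1 := by
      rw [Real.exp_le_one_iff]
      have : 0 ≤ rayDecay M * x * ρ := by positivity
      linarith
    calc _ ≤ ρ ^ M * 1 / (lam + ρ ^ (2 * M) / 2) := by gcongr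
      _ = _ := by rw [mul_one]
  · have h1 := integrableOn_rpow_mul_exp_neg_mul_rpow (p := 1) (s := M) (b := rayDecay M * x)
      (by have : (0 : ℝ) ≤ M := by positivity
          linarith) one_pos (by positivity)
    simp only [Real.rpow_natCast, Real.rpow_one] at h1
    refine (h1.div_const lam).mono' hmeas ?_
    refine (ae_restrict_mem measurableSet_Ioi).mono fun ρ hρ => ?_
    have hρ' : (0 : ℝ) < ρ := hρ
    rw [Real.norm_of_nonneg (by positivity), neg_mul]
    have : (0 : ℝ) ≤ ρ ^ (2 * M) / 2 := by positivity
    gcongr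
    linarith

lemma integral_exp_neg_mul_Ioi {b : ℝ} (hb : 0 < b) :
    ∫ τ in Set.Ioi (0 : ℝ), Real.exp (-(b * τ)) = b⁻¹ := by
  have h := integral_exp_mul_Ioi (neg_neg_of_pos hb) 0
  simp only [neg_mul, mul_zero, Real.exp_zero] at h
  rw [h]; simp [neg_div_neg_eq]

lemma integrableOn_exp_neg_mul {b : ℝ} (hb : 0 < b) :
    IntegrableOn (fun τ : ℝ => Real.exp (-(b * τ))) (Set.Ioi 0) := by
  simpa only [neg_mul] using integrableOn_exp_mul_Ioi (neg_neg_of_pos hb) 0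

lemma integrable_prod_majorant {M : ℕ} (hM : 1 ≤ M) {lam x : ℝ} (hlam : 0 < lam)
    (hx : 0 ≤ x) (h : 2 ≤ M ∨ 0 < x) :
    Integrable (fun p : ℝ × ℝ => Real.exp (-(lam * p.1)) *
      (p.2 ^ M * Real.exp (-(p.1 / 2 * p.2 ^ (2 * M)) - rayDecay M * x * p.2)))
      ((volume.restrict (Set.Ioi 0)).prod (volume.restrict (Set.Ioi 0))) := by
  have e : ∀ τ ρ : ℝ, Real.exp (-(lam * τ)) *
      (ρ ^ M * Real.exp (-(τ / 2 * ρ ^ (2 * M)) - rayDecay M * x * ρ)) =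
      ρ ^ M * Real.exp (-(rayDecay M * x * ρ)) * Real.exp (-((lam + ρ ^ (2 * M) / 2) * τ)) := by
    intro τ ρ
    have : Real.exp (-(lam * τ)) * Real.exp (-(τ / 2 * ρ ^ (2 * M)) - rayDecay M * x * ρ) =
      Real.exp (-(rayDecay M * x * ρ)) * Real.exp (-((lam + ρ ^ (2 * M) / 2) * τ)) := by
      rw [← Real.exp_add, ← Real.exp_add]; ring_nf
    linear_combination ρ ^ M * this
  rw [integrable_prod_iff' (by fun_prop)]
  constructor
  · refine (ae_restrict_mem measurableSet_Ioi).mono fun ρ hρ => ?_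
    have hρ' : (0 : ℝ) < ρ := hρ
    simp only [e]
    exact (integrableOn_exp_neg_mul (by positivity)).const_mul _
  · refine (integrableOn_resolvent_majorant hM hlam hx h).congr ?_
    refine (ae_restrict_mem measurableSet_Ioi).mono fun ρ hρ => ?_
    have hρ' : (0 : ℝ) < ρ := hρ
    simp only [e, norm_mul, Real.norm_of_nonneg (Real.exp_pos _).le]
    rw [integral_const_mul, integral_exp_neg_mul_Ioi (by positivity),
      Real.norm_of_nonneg (by positivity)]
    rfl

lemma integrable_prod_kernelFun {M : ℕ} (hM : 1 ≤ M) {θ : ℂ} (hθ : θ ∈ rootsJ (2 * M)) {lam x ψ : ℝ}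
    (hlam : 0 < lam) (hx : 0 ≤ x) (h : 2 ≤ M ∨ 0 < x) (hψ : |ψ| = rayAngle M) :
    Integrable (fun p : ℝ × ℝ => cexp (-(lam * p.1)) * kernelFun M θ p.1 x (p.2 * cexp (I * ψ)))
      ((volume.restrict (Set.Ioi 0)).prod (volume.restrict (Set.Ioi 0))) := by
  refine (integrable_prod_majorant hM hlam hx h).mono' ?_ ?_
  · have : Continuous fun p : ℝ × ℝ => cexp (-(lam * p.1)) *
        kernelFun M θ p.1 x (p.2 * cexp (I * ψ)) := by unfold kernelFun; fun_prop
    exact this.aestronglyMeasurable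
  · rw [Measure.prod_restrict]
    refine (ae_restrict_mem (measurableSet_Ioi.prod measurableSet_Ioi)).mono fun p hp => ?_
    have h1 : (0 : ℝ) < p.1 := hp.1
    have h2 : (0 : ℝ) < p.2 := hp.2
    rw [norm_mul, Complex.norm_exp]
    simp only [neg_re, re_ofReal_mul, ofReal_re]
    gcongr
    exact norm_kernelFun_le h1.le hx h2.le (cos_rayAngle hM hψ) (rayDecay_le hM hθ hψ.le)

lemma re_pow_ray (M : ℕ) (ρ ψ : ℝ) :
    (((ρ : ℂ) * cexp (I * ψ)) ^ (2 * M)).re = ρ ^ (2 * M) * Real.cos (2 * M * ψ) := by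
  rw [mul_pow, ← Complex.exp_nat_mul,
    show (((2 * M : ℕ) : ℂ) * (I * ψ)) = ((2 * M * ψ : ℝ) : ℂ) * I by push_cast; ring, ← ofReal_pow,
    re_ofReal_mul, Complex.exp_ofReal_mul_I_re]

/-- Fubini, and ∫ e^{(z^N - λ)τ} dτ = 1/(λ - z^N). The inner integral converges because Re z^N ≤
-ρ^N/2 on the ray. -/
lemma laplace_rayIntegral_kernelFun {M : ℕ} (hM : 1 ≤ M) {θ : ℂ} (hθ : θ ∈ rootsJ (2 * M))
    {lam x ψ : ℝ} (hlam : 0 < lam) (hx : 0 ≤ x) (h : 2 ≤ M ∨ 0 < x) (hψ : |ψ| = rayAngle M) :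
    IntegrableOn (fun τ : ℝ => cexp (-(lam * τ)) * rayIntegral (kernelFun M θ τ x) ψ) (Set.Ioi 0) ∧
    ∫ τ in Set.Ioi (0 : ℝ), cexp (-(lam * τ)) * rayIntegral (kernelFun M θ τ x) ψ =
      rayIntegral (resolventFun M θ lam x) ψ := by
  have hint := integrable_prod_kernelFun hM hθ hlam hx h hψ
  have e : ∀ τ : ℝ, cexp (-(lam * τ)) * rayIntegral (kernelFun M θ τ x) ψ =
      cexp (I * ψ) * ∫ ρ in Set.Ioi (0 : ℝ), cexp (-(lam * τ)) *
        kernelFun M θ τ x (ρ * cexp (I * ψ)) := by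
    intro τ
    rw [integral_const_mul, rayIntegral]; ring
  simp only [e]
  refine ⟨hint.integral_prod_left.const_mul _, ?_⟩
  rw [integral_const_mul, rayIntegral, integral_integral_swap hint]
  congr 1
  refine setIntegral_congr_fun measurableSet_Ioi fun ρ hρ => ?_
  have hρ' : (0 : ℝ) < ρ := hρ
  set z := (ρ : ℂ) * cexp (I * ψ) with hz
  have hre : (z ^ (2 * M) - lam).re < 0 := by
    rw [sub_re, hz, re_pow_ray, ofReal_re]
    have h1 : ρ ^ (2 * M) * Real.cos (2 * M * ψ) ≤ ρ ^ (2 * M) * (-(1 / 2)) := by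
      gcongr; exact cos_rayAngle hM hψ
    have h2 : 0 < ρ ^ (2 * M) := by positivity
    linarith
  have h3 := integral_exp_mul_complex_Ioi hre 0
  have h4 : ∀ τ : ℝ, cexp (-(lam * τ)) * kernelFun M θ τ x z =
      z ^ M * cexp (-(θ * x * z)) * cexp ((z ^ (2 * M) - lam) * τ) := by
    intro τ
    have : cexp (-(lam * τ)) * cexp (τ * z ^ (2 * M) - θ * x * z) =
      cexp (-(θ * x * z)) * cexp ((z ^ (2 * M) - lam) * τ) := by
      rw [← Complex.exp_add, ← Complex.exp_add]; ring_nf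
    rw [kernelFun]
    linear_combination z ^ M * this
  simp only [h4]
  rw [integral_const_mul, h3, resolventFun]
  simp only [ofReal_zero, mul_zero, Complex.exp_zero]
  have h5 : z ^ (2 * M) - lam ≠ 0 := fun h => by rw [h] at hre; simp at hre
  have h6 : (lam : ℂ) - z ^ (2 * M) ≠ 0 := fun h => h5 (by linear_combination -h)
  rw [show z ^ (2 * M) - lam = -(lam - z ^ (2 * M)) by ring, neg_div_neg_eq, mul_one_div]

/-- The function `z^{M-1} / (a^{2M} - z^{2M})`, with a simple pole at `a` only in the sector. -/
noncomputable def poleFun (M : ℕ) (a : ℝ) (z : ℂ) : ℂ := z ^ (M - 1) / (a ^ (2 * M) - z ^ (2 * M))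

lemma le_norm_sub_pow_ray {M : ℕ} {lam ρ ψ : ℝ} (hρ : 0 ≤ ρ)
    (hψ : Real.cos (2 * M * ψ) ≤ -(1 / 2)) :
    lam + ρ ^ (2 * M) / 2 ≤ ‖(lam : ℂ) - (ρ * cexp (I * ψ)) ^ (2 * M)‖ := by
  refine le_trans ?_ (Complex.re_le_norm _)
  rw [sub_re, re_pow_ray, ofReal_re]
  have h1 : ρ ^ (2 * M) * Real.cos (2 * M * ψ) ≤ ρ ^ (2 * M) * (-(1 / 2)) := by gcongr
  linarith

lemma norm_ray {ρ : ℝ} (hρ : 0 ≤ ρ) (ψ : ℝ) : ‖(ρ : ℂ) * cexp (I * ψ)‖ = ρ := by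
  rw [norm_mul, norm_real, mul_comm I, norm_exp_ofReal_mul_I, mul_one, Real.norm_of_nonneg hρ]

lemma norm_poleFun_le {M : ℕ} {a ρ ψ : ℝ} (ha : 0 < a) (hρ : 0 ≤ ρ)
    (hψ : Real.cos (2 * M * ψ) ≤ -(1 / 2)) :
    ‖poleFun M a (ρ * cexp (I * ψ))‖ ≤ ρ ^ (M - 1) / (a ^ (2 * M) + ρ ^ (2 * M) / 2) := by
  rw [poleFun, norm_div, norm_pow, norm_ray hρ]
  have h := le_norm_sub_pow_ray (M := M) (lam := a ^ (2 * M)) hρ hψ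
  push_cast at h
  gcongr

lemma sub_pow_ray_ne_zero {M : ℕ} {lam ρ ψ : ℝ} (hlam : 0 < lam) (hρ : 0 ≤ ρ)
    (hψ : Real.cos (2 * M * ψ) ≤ -(1 / 2)) : (lam : ℂ) - (ρ * cexp (I * ψ)) ^ (2 * M) ≠ 0 := by
  have h := le_norm_sub_pow_ray (M := M) (lam := lam) hρ hψ
  have : 0 < lam + ρ ^ (2 * M) / 2 := by positivity
  exact norm_pos_iff.1 (this.trans_le h)

lemma integrableOn_poleFun {M : ℕ} (hM : 1 ≤ M) {a ψ : ℝ} (ha : 0 < a)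
    (hψ : Real.cos (2 * M * ψ) ≤ -(1 / 2)) :
    IntegrableOn (fun ρ : ℝ => poleFun M a (ρ * cexp (I * ψ))) (Set.Ioi 0) := by
  refine (integrableOn_pow_div_add_pow (k := M - 1) (M := M) (by omega)
    (pow_pos ha (2 * M))).mono' ?_ ?_
  · refine ContinuousOn.aestronglyMeasurable ?_ measurableSet_Ioi
    refine ContinuousOn.div₀ (by fun_prop) (by fun_prop) fun ρ hρ => ?_
    have := sub_pow_ray_ne_zero (M := M) (pow_pos ha (2 * M)) (le_of_lt hρ) hψ
    push_cast at this
    exact this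
  · exact (ae_restrict_mem measurableSet_Ioi).mono fun ρ hρ => norm_poleFun_le ha (le_of_lt hρ) hψ

lemma rayIntegral_poleFun_eq {M : ℕ} (hM : 1 ≤ M) {a α β : ℝ} (ha : 0 < a) (hαβ : α ≤ β)
    (hψ : ∀ ψ ∈ Set.Icc α β, Real.cos (2 * M * ψ) ≤ -(1 / 2)) :
    rayIntegral (poleFun M a) α = rayIntegral (poleFun M a) β := by
  refine ray_integral_eq (C := max (a ^ (2 * M))⁻¹ 2) (R := 1) hαβ le_rfl (fun ρ hρ ψ h => ?_) ?_ ?_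
    (integrableOn_poleFun hM ha (hψ α ⟨le_rfl, hαβ⟩)) (integrableOn_poleFun hM ha (hψ β ⟨hαβ, le_rfl⟩))
  · have := sub_pow_ray_ne_zero (M := M) (pow_pos ha (2 * M)) hρ.le (hψ ψ h)
    push_cast at this
    exact DifferentiableAt.div (by fun_prop) (by fun_prop) this
  · intro ρ hρ hρ1 ψ h
    refine (norm_poleFun_le ha hρ.le (hψ ψ h)).trans ((le_trans ?_ (le_max_left _ _)))
    have h1 : ρ ^ (M - 1) ≤ 1 := pow_le_one₀ hρ.le (by simpa using hρ1)
    rw [← one_div]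
    have : 0 ≤ ρ ^ (2 * M) / 2 := by positivity
    gcongr
    linarith
  · intro ρ hρ ψ h
    have hρ0 : 0 < ρ := by linarith
    refine (norm_poleFun_le ha hρ0.le (hψ ψ h)).trans ?_
    rw [div_le_div_iff₀ (by positivity) (by positivity), ← pow_add]
    have h1 : ρ ^ (M - 1 + 2) ≤ ρ ^ (2 * M) := pow_le_pow_right₀ hρ (by omega)
    have h2 : (2 : ℝ) ≤ max (a ^ (2 * M))⁻¹ 2 := le_max_right _ _
    have h3 : 0 < a ^ (2 * M) := by positivity
    have h4 : 0 < ρ ^ (2 * M) := by positivity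
    nlinarith

/-- arctan(ρ^M/a^M)/(M a^M) is a primitive. -/
lemma integral_pow_div_add_pow {M : ℕ} (hM : 1 ≤ M) {a : ℝ} (ha : 0 < a) :
    ∫ ρ in Set.Ioi (0 : ℝ), ρ ^ (M - 1) / (a ^ (2 * M) + ρ ^ (2 * M)) = Real.pi / (2 * M * a ^ M) := by
  have hM0 : (M : ℝ) ≠ 0 := by exact_mod_cast (by omega : M ≠ 0)
  have hderiv : ∀ ρ ∈ Set.Ici (0 : ℝ), HasDerivAt
      (fun ρ : ℝ => Real.arctan (ρ ^ M / a ^ M) / (M * a ^ M))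
      (ρ ^ (M - 1) / (a ^ (2 * M) + ρ ^ (2 * M))) ρ := by
    intro ρ hρ
    have hρ0 : (0 : ℝ) ≤ ρ := hρ
    have h1 := (((hasDerivAt_pow M ρ).div_const (a ^ M)).arctan).div_const (M * a ^ M)
    refine h1.congr_deriv ?_
    have h3 : 0 < a ^ M := by positivity
    rw [mul_comm 2 M, pow_mul, pow_mul]
    generalize a ^ M = A at *
    generalize ρ ^ M = P at *
    have h4 : 0 < A ^ 2 + P ^ 2 := by positivity
    field_simp
  have hlim : Tendsto (fun ρ : ℝ => Real.arctan (ρ ^ M / a ^ M) / (M * a ^ M)) atTop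
      (𝓝 (Real.pi / 2 / (M * a ^ M))) := by
    refine Tendsto.div_const ?_ _
    refine (Real.tendsto_arctan_atTop.mono_right nhdsWithin_le_nhds).comp ?_
    exact (tendsto_pow_atTop (by omega)).atTop_div_const (by positivity)
  have h := integral_Ioi_of_hasDerivAt_of_nonneg' hderiv (fun ρ hρ => by
    have hρ0 : (0 : ℝ) < ρ := hρ
    positivity) hlim
  rw [h, zero_pow (by omega)]
  simp
  field_simp

/-- The rays are turned outwards to ±π/(2M), away from the pole on the positive axis. There z^M =
±iρ^M and z^N = -ρ^N, so the integral becomes elementary. The difference of the two values is the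
contribution of the pole, obtained without a residue theorem. -/
lemma rayIntegral_poleFun {M : ℕ} (hM : 1 ≤ M) {a : ℝ} (ha : 0 < a) :
    rayIntegral (poleFun M a) (rayAngle M) = I * (Real.pi / (2 * M * a ^ M)) ∧
    rayIntegral (poleFun M a) (-rayAngle M) = -(I * (Real.pi / (2 * M * a ^ M))) := by
  have hM' : (M : ℂ) ≠ 0 := by exact_mod_cast (by omega : M ≠ 0)
  have key : ∀ ε : ℝ, (ε = 1 ∨ ε = -1) → rayIntegral (poleFun M a) (ε * (Real.pi / (2 * M))) =
      ε * I * (Real.pi / (2 * M * a ^ M)) := by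
    intro ε hε
    have hN : cexp (I * (ε * (Real.pi / (2 * M)) : ℝ)) ^ M = ε * I := by
      rw [← Complex.exp_nat_mul]
      rcases hε with rfl | rfl
      · rw [show ((M : ℂ) * (I * (1 * (Real.pi / (2 * M)) : ℝ))) = Real.pi / 2 * I by
          push_cast; field_simp, exp_pi_div_two_mul_I]; simp
      · rw [show ((M : ℂ) * (I * (-1 * (Real.pi / (2 * M)) : ℝ))) = -Real.pi / 2 * I by
          push_cast; field_simp, exp_neg_pi_div_two_mul_I]; simp
    have hε2 : (ε : ℂ) ^ 2 = 1 := by rcases hε with rfl | rfl <;> simp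
    have h2 : ∀ ρ : ℝ, cexp (I * (ε * (Real.pi / (2 * M)) : ℝ)) *
        poleFun M a (ρ * cexp (I * (ε * (Real.pi / (2 * M)) : ℝ))) =
        ε * I * ((ρ ^ (M - 1) / (a ^ (2 * M) + ρ ^ (2 * M)) : ℝ) : ℂ) := by
      intro ρ
      rw [poleFun, mul_pow, mul_pow, mul_comm 2 M, pow_mul (cexp _), hN, mul_pow, hε2, I_sq, ← hN]
      have : cexp (I * (ε * (Real.pi / (2 * M)) : ℝ)) ^ M =
        cexp (I * (ε * (Real.pi / (2 * M)) : ℝ)) * cexp (I * (ε * (Real.pi / (2 * M)) : ℝ)) ^ (M - 1) := by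
        rw [← pow_succ']; congr 1; omega
      rw [this]
      push_cast
      rw [show (a : ℂ) ^ (M * 2) - ρ ^ (M * 2) * (1 * -1) = a ^ (M * 2) + ρ ^ (M * 2) by ring]
      ring
    rw [rayIntegral, ← integral_const_mul]
    simp only [h2]
    rw [integral_const_mul, integral_complex_ofReal, integral_pow_div_add_pow hM ha]
    push_cast
    ring
  have h0 := rayAngle_pos hM
  have h1 := rayAngle_lt hM
  have k1 := key 1 (Or.inl rfl)
  have k2 := key (-1) (Or.inr rfl)
  constructor
  · rw [rayIntegral_poleFun_eq hM ha h1.le (fun ψ hψ => ?_), ← one_mul (Real.pi / (2 * M)), k1]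
    · simp
    · apply cos_two_mul_mul_le hM <;> rw [abs_of_nonneg (by linarith [hψ.1])] <;>
        linarith [hψ.1, hψ.2]
  · rw [← rayIntegral_poleFun_eq hM ha (neg_le_neg h1.le) (fun ψ hψ => ?_),
      ← neg_one_mul (Real.pi / (2 * M)), k2]
    · push_cast; ring
    · apply cos_two_mul_mul_le hM <;> rw [abs_of_nonpos (by linarith [hψ.2])] <;>
        linarith [hψ.1, hψ.2]

end PseudoProcess

/-! ### The pole at λ^{1/N} and the Laplace transform of the kernel. -/

namespace PseudoProcess

/-- The resolvent integrand with its pole removed. -/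
noncomputable def regularizedFun (M : ℕ) (θ : ℂ) (a x : ℝ) (z : ℂ) : ℂ :=
  -(z ^ (M - 1) * (dslope (fun z : ℂ => z * cexp (-(θ * x * z))) (a : ℂ) z /
    dslope (fun z : ℂ => z ^ (2 * M)) (a : ℂ) z))

/-- The solutions of z^N = a^N have arguments in (π/M)ℤ, and the sector has half-angle below π/(2M),
so it contains only z = a. -/
lemma pow_ray_ne {M : ℕ} (hM : 1 ≤ M) {a ρ ψ : ℝ} (ha : 0 < a) (hρ : 0 < ρ)
    (hψ : |ψ| ≤ rayAngle M) (h : (ρ : ℂ) * cexp (I * ψ) ≠ a) :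
    ((ρ : ℂ) * cexp (I * ψ)) ^ (2 * M) ≠ (a : ℂ) ^ (2 * M) := by
  have hM' : (1 : ℝ) ≤ M := by exact_mod_cast hM
  intro he
  have h1 : ρ = a := by
    have := congrArg norm he
    rw [norm_pow, norm_pow, norm_ray hρ.le, norm_real, Real.norm_of_nonneg ha.le] at this
    exact (pow_left_inj₀ hρ.le ha.le (by omega)).1 this
  subst h1
  rw [mul_pow] at he
  have hρ' : (ρ : ℂ) ^ (2 * M) ≠ 0 := pow_ne_zero _ (by exact_mod_cast hρ.ne')
  have h2 : cexp (I * ψ) ^ (2 * M) = 1 := mul_left_cancel₀ hρ' (by rw [he, mul_one])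
  rw [← Complex.exp_nat_mul, Complex.exp_eq_one_iff] at h2
  obtain ⟨n, hn⟩ := h2
  have h3 : (M : ℝ) * ψ = n * Real.pi := by
    have : ((2 * (M * ψ) : ℝ) : ℂ) * I = ((2 * (n * Real.pi) : ℝ) : ℂ) * I := by
      push_cast at hn ⊢; linear_combination hn
    have := mul_right_cancel₀ I_ne_zero this
    have h4 : 2 * (M * ψ) = 2 * (n * Real.pi) := by exact_mod_cast this
    linarith
  have h4 : |(M : ℝ) * ψ| < Real.pi := by
    rw [abs_mul, abs_of_pos (by linarith : (0 : ℝ) < M)]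
    have := hψ.trans_lt (rayAngle_lt hM)
    rw [lt_div_iff₀ (by positivity)] at this
    nlinarith [Real.pi_pos]
  rw [h3, abs_mul, abs_of_pos Real.pi_pos] at h4
  have h5 : |(n : ℝ)| < 1 := by
    by_contra h6
    push Not at h6
    nlinarith [Real.pi_pos]
  have h6 : n = 0 := by
    have : |n| < 1 := by exact_mod_cast h5
    exact Int.abs_lt_one_iff.1 this
  rw [h6] at h3
  have h7 : ψ = 0 := by
    simp at h3
    rcases h3 with h3 | h3
    · omega
    · exact h3
  apply h
  simp [h7]

/-- The multiple of `poleFun` is the one that makes the numerator z e^{-θxz} - a e^{-θxa} vanish at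
a. The two divided differences share the denominator z - a, which cancels. -/
lemma regularizedFun_eq {M : ℕ} (hM : 1 ≤ M) (θ : ℂ) {a x : ℝ} {z : ℂ} (hz : z ≠ a) :
    regularizedFun M θ a x z =
      resolventFun M θ (a ^ (2 * M)) x z - a * cexp (-(θ * x * a)) * poleFun M a z := by
  have hz' : z - a ≠ 0 := sub_ne_zero.2 hz
  rw [regularizedFun, dslope_of_ne _ hz, dslope_of_ne _ hz, slope_def_field, slope_def_field,
    div_div_div_cancel_right₀ hz', resolventFun, poleFun]
  push_cast
  have e : z ^ M = z ^ (M - 1) * z := by rw [← pow_succ]; congr 1; omega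
  rw [e, ← neg_sub (z ^ (2 * M)) _, div_neg, div_neg]
  ring

lemma dslope_pow_ray_ne_zero {M : ℕ} (hM : 1 ≤ M) {a ρ ψ : ℝ} (ha : 0 < a) (hρ : 0 < ρ)
    (hψ : |ψ| ≤ rayAngle M) :
    dslope (fun z : ℂ => z ^ (2 * M)) a (ρ * cexp (I * ψ)) ≠ 0 := by
  have ha' : (a : ℂ) ≠ 0 := by exact_mod_cast ha.ne'
  have hM' : (M : ℂ) ≠ 0 := by exact_mod_cast (by omega : M ≠ 0)
  by_cases h : (ρ : ℂ) * cexp (I * ψ) = a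
  · rw [h, dslope_same]
    simp [ha', hM']
  · rw [dslope_of_ne _ h, slope_def_field]
    exact div_ne_zero (sub_ne_zero.2 (pow_ray_ne hM ha hρ hψ h)) (sub_ne_zero.2 h)

/-- Divided differences of entire functions are entire, so a is no longer singular, and the
denominator has no zero in the sector. -/
lemma differentiableAt_regularizedFun {M : ℕ} (hM : 1 ≤ M) (θ : ℂ) {a x ρ ψ : ℝ} (ha : 0 < a)
    (hρ : 0 < ρ) (hψ : |ψ| ≤ rayAngle M) :
    DifferentiableAt ℂ (regularizedFun M θ a x) (ρ * cexp (I * ψ)) := by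
  have h1 : ∀ f : ℂ → ℂ, Differentiable ℂ f → Differentiable ℂ (dslope f (a : ℂ)) := fun f hf => by
    rw [← differentiableOn_univ]
    exact (Complex.differentiableOn_dslope univ_mem).2 hf.differentiableOn
  have h2 := h1 (fun z => z * cexp (-(θ * x * z))) (by fun_prop)
  have h3 := h1 (fun z => z ^ (2 * M)) (by fun_prop)
  unfold regularizedFun
  exact ((by fun_prop : DifferentiableAt ℂ (fun z : ℂ => z ^ (M - 1)) _).mul
    ((h2 _).div (h3 _) (dslope_pow_ray_ne_zero hM ha hρ hψ))).neg

lemma integrableOn_resolventFun {M : ℕ} (hM : 1 ≤ M) {θ : ℂ} (hθ : θ ∈ rootsJ (2 * M))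
    {lam x ψ : ℝ} (hlam : 0 < lam) (hx : 0 ≤ x) (h : 2 ≤ M ∨ 0 < x) (hψ : |ψ| = rayAngle M) :
    IntegrableOn (fun ρ : ℝ => resolventFun M θ lam x (ρ * cexp (I * ψ))) (Set.Ioi 0) := by
  have hcos := cos_rayAngle hM hψ
  refine (integrableOn_resolvent_majorant hM hlam hx h).mono' ?_ ?_
  · refine ContinuousOn.aestronglyMeasurable ?_ measurableSet_Ioi
    exact ContinuousOn.div₀ (by fun_prop) (by fun_prop) fun ρ hρ =>
      sub_pow_ray_ne_zero hlam (le_of_lt hρ) hcos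
  · refine (ae_restrict_mem measurableSet_Ioi).mono fun ρ hρ => ?_
    have hρ' : (0 : ℝ) < ρ := hρ
    have h1 := le_norm_sub_pow_ray (M := M) (lam := lam) hρ'.le hcos
    rw [resolventFun, norm_div, norm_mul, norm_pow, norm_ray hρ'.le, Complex.norm_exp,
      show θ * x * (ρ * cexp (I * ψ)) = ((x * ρ : ℝ) : ℂ) * (θ * cexp (I * ψ)) by push_cast; ring,
      neg_re, re_ofReal_mul]
    have h2 : x * ρ * rayDecay M ≤ x * ρ * (θ * cexp (I * ψ)).re := by
      have := rayDecay_le hM hθ hψ.le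
      gcongr
    have h3 : Real.exp (-(x * ρ * (θ * cexp (I * ψ)).re)) ≤ Real.exp (-(rayDecay M * x * ρ)) :=
      Real.exp_le_exp.2 (by linarith)
    gcongr

/-- The residue computation behind the Laplace transform of the kernel. -/
lemma rayIntegral_resolventFun_sub {M : ℕ} (hM : 1 ≤ M) {θ : ℂ} (hθ : θ ∈ rootsJ (2 * M))
    {a x : ℝ} (ha : 0 < a) (hx : 0 ≤ x) (h : 2 ≤ M ∨ 0 < x) :
    rayIntegral (resolventFun M θ (a ^ (2 * M)) x) (-rayAngle M) -
      rayIntegral (resolventFun M θ (a ^ (2 * M)) x) (rayAngle M) =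
      -(I * Real.pi / M) * ((a : ℂ) ^ (M - 1))⁻¹ * cexp (-(θ * x * a)) := by
  have h0 := rayAngle_pos hM
  have hdec := rayDecay_pos hM
  have haN : 0 < a ^ (2 * M) := by positivity
  have habs1 : |rayAngle M| = rayAngle M := abs_of_pos h0
  have habs2 : |-rayAngle M| = rayAngle M := by rw [abs_neg, habs1]
  have hneq : ∀ ψ : ℝ, |ψ| = rayAngle M → ∀ ρ : ℝ, 0 < ρ → (ρ : ℂ) * cexp (I * ψ) ≠ a := by
    intro ψ hψ ρ hρ he
    have h1 := sub_pow_ray_ne_zero haN hρ.le (cos_rayAngle hM hψ)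
    rw [he] at h1
    apply h1; push_cast; ring
  have hray : ∀ ψ : ℝ, |ψ| = rayAngle M →
      IntegrableOn (fun ρ : ℝ => regularizedFun M θ a x (ρ * cexp (I * ψ))) (Set.Ioi 0) ∧
      rayIntegral (regularizedFun M θ a x) ψ = rayIntegral (resolventFun M θ (a ^ (2 * M)) x) ψ -
        a * cexp (-(θ * x * a)) * rayIntegral (poleFun M a) ψ := by
    intro ψ hψ
    have i1 := integrableOn_resolventFun hM hθ haN hx h hψ
    have i2 := (integrableOn_poleFun hM ha (cos_rayAngle hM hψ)).const_mul
      (a * cexp (-(θ * x * a)))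
    have e : Set.EqOn (fun ρ : ℝ => regularizedFun M θ a x (ρ * cexp (I * ψ)))
      (fun ρ : ℝ => resolventFun M θ (a ^ (2 * M)) x (ρ * cexp (I * ψ)) -
        a * cexp (-(θ * x * a)) * poleFun M a (ρ * cexp (I * ψ))) (Set.Ioi 0) := fun ρ hρ =>
      regularizedFun_eq hM θ (hneq ψ hψ ρ hρ)
    refine ⟨(i1.sub i2).congr_fun e.symm measurableSet_Ioi, ?_⟩
    rw [rayIntegral, setIntegral_congr_fun measurableSet_Ioi e, integral_sub i1 i2,
      integral_const_mul, rayIntegral, rayIntegral]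
    ring
  obtain ⟨i1, e1⟩ := hray _ habs1
  obtain ⟨i2, e2⟩ := hray _ habs2
  -- growth of `z e^{-θ x z}`
  have hgrow : ∃ K : ℝ, 0 ≤ K ∧ ∀ ρ : ℝ, 1 ≤ ρ → ∀ ψ : ℝ, |ψ| ≤ rayAngle M →
      ρ ^ (M + 1) * ‖((ρ : ℂ) * cexp (I * ψ)) * cexp (-(θ * x * (ρ * cexp (I * ψ))))‖ ≤
        K * ρ ^ (2 * M) := by
    have hn : ∀ ρ : ℝ, 0 < ρ → ∀ ψ : ℝ, |ψ| ≤ rayAngle M →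
        ‖((ρ : ℂ) * cexp (I * ψ)) * cexp (-(θ * x * (ρ * cexp (I * ψ))))‖ ≤
          ρ * Real.exp (-(x * ρ * rayDecay M)) := by
      intro ρ hρ ψ hψ
      rw [norm_mul, norm_ray hρ.le, Complex.norm_exp,
        show θ * x * (ρ * cexp (I * ψ)) = ((x * ρ : ℝ) : ℂ) * (θ * cexp (I * ψ)) by
          push_cast; ring, neg_re, re_ofReal_mul]
      have := rayDecay_le hM hθ hψ
      gcongr
    -- For M ≥ 2 the power count alone suffices. For x > 0 one extra power of ρ is absorbed by the
    -- exponential through y ≤ e^y at y = xρ · `rayDecay M`.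
    rcases h with h | h
    · refine ⟨1, zero_le_one, fun ρ hρ ψ hψ => ?_⟩
      have hρ0 : 0 < ρ := by linarith
      have h1 := hn ρ hρ0 ψ hψ
      have h2 : Real.exp (-(x * ρ * rayDecay M)) ≤ 1 := by
        rw [Real.exp_le_one_iff]
        have : 0 ≤ x * ρ * rayDecay M := by positivity
        linarith
      calc _ ≤ ρ ^ (M + 1) * (ρ * 1) := by
            gcongr
            exact h1.trans (by gcongr)
        _ = ρ ^ (M + 2) := by ring
        _ ≤ ρ ^ (2 * M) := pow_le_pow_right₀ hρ (by omega)
        _ = _ := (one_mul _).symm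
    · refine ⟨(x * rayDecay M)⁻¹, by positivity, fun ρ hρ ψ hψ => ?_⟩
      have hρ0 : 0 < ρ := by linarith
      have h1 := hn ρ hρ0 ψ hψ
      have h2 : ρ * Real.exp (-(x * ρ * rayDecay M)) ≤ (x * rayDecay M)⁻¹ := by
        have h3 := Real.add_one_le_exp (x * ρ * rayDecay M)
        rw [Real.exp_neg, ← div_eq_mul_inv, div_le_iff₀ (Real.exp_pos _),
          inv_mul_eq_div, le_div_iff₀ (by positivity)]
        linarith
      have h3 : ρ ^ (M + 1) ≤ ρ ^ (2 * M) := pow_le_pow_right₀ hρ (by omega)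
      calc _ ≤ ρ ^ (2 * M) * (x * rayDecay M)⁻¹ := by
            gcongr
            exact h1.trans h2
        _ = _ := mul_comm _ _
  obtain ⟨K, hK, hgrow⟩ := hgrow
  have hre : ∀ ψ : ℝ, |ψ| ≤ rayAngle M → 0 ≤ (θ * cexp (I * ψ)).re := fun ψ hψ =>
    hdec.le.trans (rayDecay_le hM hθ hψ)
  have hexpa : ‖(a : ℂ) * cexp (-(θ * x * a))‖ ≤ a := by
    rw [norm_mul, norm_real, Real.norm_of_nonneg ha.le, Complex.norm_exp]
    have h1 : 0 ≤ (θ * x * a).re := by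
      have h2 := hre 0 (by simpa using h0.le)
      simp only [ofReal_zero, mul_zero, Complex.exp_zero, mul_one] at h2
      rw [show θ * x * a = ((x * a : ℝ) : ℂ) * θ by push_cast; ring, re_ofReal_mul]
      positivity
    calc a * Real.exp _ ≤ a * 1 := by
          gcongr
          rw [Real.exp_le_one_iff, neg_re]; linarith
      _ = a := mul_one a
  have hform : ∀ z : ℂ, z ≠ a → ‖regularizedFun M θ a x z‖ ≤
      ‖z‖ ^ (M - 1) * (‖z * cexp (-(θ * x * z))‖ + a) / ‖(a : ℂ) ^ (2 * M) - z ^ (2 * M)‖ := by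
    intro z hz
    have e : regularizedFun M θ a x z = z ^ (M - 1) * (z * cexp (-(θ * x * z)) -
        a * cexp (-(θ * x * a))) / ((a : ℂ) ^ (2 * M) - z ^ (2 * M)) := by
      rw [regularizedFun_eq hM θ hz, resolventFun, poleFun]
      have e : z ^ M = z ^ (M - 1) * z := by rw [← pow_succ]; congr 1; omega
      rw [e]; push_cast; ring
    rw [e, norm_div, norm_mul, norm_pow]
    have := (norm_sub_le (z * cexp (-(θ * x * z))) (a * cexp (-(θ * x * a)))).trans
      (add_le_add le_rfl hexpa)
    gcongr
  -- This R forces |z| ≤ a/2 near the vertex and |z| ≥ 2a far out, so that |a^N - z^N| is at least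
  -- half of the larger of the two powers.
  set R : ℝ := max 1 (max (2 * a) (2 / a)) with hR
  have hR1 : 1 ≤ R := le_max_left _ _
  have hR2 : 2 * a ≤ R := (le_max_left _ _).trans (le_max_right _ _)
  have hR3 : R⁻¹ ≤ a / 2 := by
    have h1 : 2 / a ≤ R := (le_max_right _ _).trans (le_max_right _ _)
    have := inv_anti₀ (by positivity) h1
    rwa [inv_div] at this
  have hpow : ∀ u v : ℝ, 0 ≤ u → u ≤ v / 2 → u ^ (2 * M) ≤ v ^ (2 * M) / 2 := by
    intro u v hu huv
    have hv : 0 ≤ v := by linarith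
    calc u ^ (2 * M) ≤ (v / 2) ^ (2 * M) := by gcongr
      _ = v ^ (2 * M) / 2 ^ (2 * M) := div_pow _ _ _
      _ ≤ v ^ (2 * M) / 2 := by
        gcongr
        calc (2 : ℝ) = 2 ^ 1 := (pow_one 2).symm
          _ ≤ 2 ^ (2 * M) := pow_le_pow_right₀ (by norm_num) (by omega)
  have key : rayIntegral (regularizedFun M θ a x) (-rayAngle M) =
      rayIntegral (regularizedFun M θ a x) (rayAngle M) := by
    refine ray_integral_eq (C := max ((1 + a) / (a ^ (2 * M) / 2)) (2 * (K + a))) (R := R)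
      (by linarith) hR1 ?_ ?_ ?_ i2 i1
    · intro ρ hρ ψ hψ
      exact differentiableAt_regularizedFun hM θ ha hρ (abs_le.2 hψ)
    · intro ρ hρ hρR ψ hψ
      have hψ' := abs_le.2 hψ
      have hρa : ρ ≤ a / 2 := hρR.trans hR3
      have hρ1 : ρ ≤ 1 := hρR.trans (inv_le_one_of_one_le₀ hR1)
      have hza : (ρ : ℂ) * cexp (I * ψ) ≠ a := by
        intro he
        have := congrArg norm he
        rw [norm_ray hρ.le, norm_real, Real.norm_of_nonneg ha.le] at this
        linarith
      refine (hform _ hza).trans (le_trans ?_ (le_max_left _ _))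
      have h1 : a ^ (2 * M) / 2 ≤ ‖(a : ℂ) ^ (2 * M) - (ρ * cexp (I * ψ)) ^ (2 * M)‖ := by
        have h2 := norm_sub_norm_le ((a : ℂ) ^ (2 * M)) ((ρ * cexp (I * ψ)) ^ (2 * M))
        rw [norm_pow, norm_pow, norm_ray hρ.le, norm_real, Real.norm_of_nonneg ha.le] at h2
        linarith [hpow ρ a hρ.le hρa]
      have h3 : ‖((ρ : ℂ) * cexp (I * ψ)) * cexp (-(θ * x * (ρ * cexp (I * ψ))))‖ ≤ 1 := by
        rw [norm_mul, norm_ray hρ.le, Complex.norm_exp,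
          show θ * x * (ρ * cexp (I * ψ)) = ((x * ρ : ℝ) : ℂ) * (θ * cexp (I * ψ)) by
            push_cast; ring, neg_re, re_ofReal_mul]
        have h4 := hre ψ hψ'
        have h5 : Real.exp (-(x * ρ * (θ * cexp (I * ψ)).re)) ≤ 1 := by
          rw [Real.exp_le_one_iff]
          have : 0 ≤ x * ρ * (θ * cexp (I * ψ)).re := by positivity
          linarith
        calc _ ≤ (1 : ℝ) * 1 := by gcongr
          _ = 1 := one_mul 1
      rw [norm_ray hρ.le]
      have h6 : ρ ^ (M - 1) ≤ 1 := pow_le_one₀ hρ.le hρ1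
      calc _ ≤ 1 * (1 + a) / (a ^ (2 * M) / 2) := by gcongr
        _ = _ := by rw [one_mul]
    · intro ρ hρR ψ hψ
      have hψ' := abs_le.2 hψ
      have hρ1 : 1 ≤ ρ := hR1.trans hρR
      have hρ : 0 < ρ := by linarith
      have hρa : a ≤ ρ / 2 := by linarith
      have hza : (ρ : ℂ) * cexp (I * ψ) ≠ a := by
        intro he
        have := congrArg norm he
        rw [norm_ray hρ.le, norm_real, Real.norm_of_nonneg ha.le] at this
        linarith
      refine (hform _ hza).trans ?_
      have h1 : ρ ^ (2 * M) / 2 ≤ ‖(a : ℂ) ^ (2 * M) - (ρ * cexp (I * ψ)) ^ (2 * M)‖ := by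
        have h2 := norm_sub_norm_le ((ρ * cexp (I * ψ)) ^ (2 * M)) ((a : ℂ) ^ (2 * M))
        rw [norm_pow, norm_pow, norm_ray hρ.le, norm_real, Real.norm_of_nonneg ha.le,
          norm_sub_rev] at h2
        linarith [hpow a ρ ha.le hρa]
      rw [norm_ray hρ.le]
      refine (div_le_div_of_nonneg_left (by positivity) (by positivity) h1).trans ?_
      rw [div_le_div_iff₀ (by positivity) (by positivity)]
      have h3 := hgrow ρ hρ1 ψ hψ'
      have h4 : ρ ^ (M + 1) ≤ ρ ^ (2 * M) := pow_le_pow_right₀ hρ1 (by omega)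
      have e : ρ ^ (M - 1) * ρ ^ 2 = ρ ^ (M + 1) := by rw [← pow_add]; congr 1; omega
      calc _ = ρ ^ (M + 1) * ‖((ρ : ℂ) * cexp (I * ψ)) * cexp (-(θ * x * (ρ * cexp (I * ψ))))‖ +
            a * ρ ^ (M + 1) := by rw [← e]; ring
        _ ≤ K * ρ ^ (2 * M) + a * ρ ^ (2 * M) := by gcongr
        _ = 2 * (K + a) * (ρ ^ (2 * M) / 2) := by ring
        _ ≤ _ := by
          gcongr
          exact le_max_right _ _
  -- The regularized integrals agree on the two rays, hence the resolvent integrals differ by a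
  -- e^{-θxa} times the known difference for `poleFun`.
  rw [e1, e2] at key
  obtain ⟨r1, r2⟩ := rayIntegral_poleFun hM ha
  rw [r1, r2] at key
  have ha' : (a : ℂ) ≠ 0 := by exact_mod_cast ha.ne'
  have hM' : (M : ℂ) ≠ 0 := by exact_mod_cast (by omega : M ≠ 0)
  have e3 : (a : ℂ) ^ M = a ^ (M - 1) * a := by rw [← pow_succ]; congr 1; omega
  rw [e3] at key
  have ha1 : (a : ℂ) ^ (M - 1) ≠ 0 := pow_ne_zero _ ha'
  rw [sub_eq_sub_iff_add_eq_add] at key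
  have e4 : (a : ℂ) * cexp (-(θ * x * a)) * (I * (Real.pi / (2 * M * (a ^ (M - 1) * a)))) =
    1 / 2 * (I * Real.pi / M * ((a : ℂ) ^ (M - 1))⁻¹ * cexp (-(θ * x * a))) := by
    field_simp
  linear_combination key - 2 * e4

/-- The Laplace variable is parametrized as a^{2M}, which keeps fractional powers out of the
computations until the final statement. -/
theorem laplace_kernelI {M : ℕ} (hM : 1 ≤ M) {θ : ℂ} (hθ : θ ∈ rootsJ (2 * M))
    {a x : ℝ} (ha : 0 < a) (hx : 0 ≤ x) (h : 2 ≤ M ∨ 0 < x) :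
    IntegrableOn (fun τ : ℝ => cexp (-((a ^ (2 * M) : ℝ) * τ)) * kernelI (2 * M) (M - 1) θ τ x)
      (Set.Ioi 0) ∧
    ∫ τ in Set.Ioi (0 : ℝ), cexp (-((a ^ (2 * M) : ℝ) * τ)) * kernelI (2 * M) (M - 1) θ τ x =
      ((a : ℂ) ^ (M - 1))⁻¹ * cexp (-(θ * a * x)) := by
  have h0 := rayAngle_pos hM
  have haN : 0 < a ^ (2 * M) := by positivity
  obtain ⟨i1, e1⟩ := laplace_rayIntegral_kernelFun hM hθ haN hx h (abs_of_pos h0)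
  obtain ⟨i2, e2⟩ := laplace_rayIntegral_kernelFun hM hθ haN hx h
    ((abs_neg _).trans (abs_of_pos h0))
  have e : Set.EqOn (fun τ : ℝ => cexp (-((a ^ (2 * M) : ℝ) * τ)) * kernelI (2 * M) (M - 1) θ τ x)
      (fun τ : ℝ => M * I / Real.pi *
        (cexp (-((a ^ (2 * M) : ℝ) * τ)) * rayIntegral (kernelFun M θ τ x) (-rayAngle M) -
        cexp (-((a ^ (2 * M) : ℝ) * τ)) * rayIntegral (kernelFun M θ τ x) (rayAngle M)))
      (Set.Ioi 0) := by
    intro τ hτ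
    simp only
    rw [kernelI_eq_rayIntegral hM hθ hτ hx]; ring
  refine ⟨IntegrableOn.congr_fun (Integrable.const_mul (i2.sub i1) _) e.symm measurableSet_Ioi, ?_⟩
  rw [setIntegral_congr_fun measurableSet_Ioi e, integral_const_mul, integral_sub i2 i1, e1, e2,
    rayIntegral_resolventFun_sub hM hθ ha hx h]
  have hM' : (M : ℂ) ≠ 0 := by exact_mod_cast (by omega : M ≠ 0)
  have hpi : (Real.pi : ℂ) ≠ 0 := by exact_mod_cast Real.pi_ne_zero
  rw [show θ * x * a = θ * a * x by ring]
  field_simp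
  rw [I_sq]; ring

end PseudoProcess

namespace PseudoProcess

/-! ### Estimates and regularity of the kernel -/

lemma majorant_nonneg (M : ℕ) (τ x : ℝ) : 0 ≤ majorant M τ x :=
  setIntegral_nonneg measurableSet_Ioi fun ρ hρ => by
    have : (0 : ℝ) < ρ := hρ
    positivity

lemma majorant_anti {M : ℕ} (hM : 1 ≤ M) {τ τ' x x' : ℝ} (hτ : 0 < τ') (hττ : τ' ≤ τ)
    (hx : 0 ≤ x') (hxx : x' ≤ x) : majorant M τ x ≤ majorant M τ' x' := by
  have hd := rayDecay_pos hM
  refine setIntegral_mono_on (integrableOn_majorant hM (hτ.trans_le hττ) (hx.trans hxx))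
    (integrableOn_majorant hM hτ hx) measurableSet_Ioi fun ρ hρ => ?_
  have hρ' : (0 : ℝ) < ρ := hρ
  gcongr

lemma integral_pow_mul_exp_neg_mul_pow {M : ℕ} (hM : 1 ≤ M) {b : ℝ} (hb : 0 < b) (k : ℕ) :
    ∫ ρ in Set.Ioi (0 : ℝ), ρ ^ k * Real.exp (-(b * ρ ^ (2 * M))) =
      b ^ (-((k : ℝ) + 1) / (2 * M)) * (1 / (2 * M)) * Real.Gamma (((k : ℝ) + 1) / (2 * M)) := by
  have h := _root_.integral_rpow_mul_exp_neg_mul_rpow (p := (2 * M : ℕ)) (q := k) (b := b)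
    (by norm_cast; omega) (by have : (0 : ℝ) ≤ k := by positivity
                              linarith) hb
  simp only [Real.rpow_natCast, neg_mul] at h
  rw [h]
  push_cast
  rfl

/-- Take x = 0 and scale. The exponent -(M+1)/(2M) exceeds -1 exactly when M ≥ 2. -/
lemma exists_majorant_le_rpow {M : ℕ} (hM : 1 ≤ M) : ∃ C : ℝ, 0 ≤ C ∧ ∀ τ x : ℝ, 0 < τ → 0 ≤ x →
    majorant M τ x ≤ C * τ ^ (-((M : ℝ) + 1) / (2 * M)) := by
  refine ⟨(1 / 2) ^ (-((M : ℝ) + 1) / (2 * M)) * (1 / (2 * M)) * Real.Gamma (((M : ℝ) + 1) / (2 * M)),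
    ?_, fun τ x hτ hx => ?_⟩
  · have : 0 ≤ Real.Gamma (((M : ℝ) + 1) / (2 * M)) := Real.Gamma_nonneg_of_nonneg (by positivity)
    positivity
  · refine (majorant_anti hM hτ le_rfl le_rfl hx).trans (le_of_eq ?_)
    have h := integral_pow_mul_exp_neg_mul_pow hM (half_pos hτ) M
    rw [majorant]
    simp only [mul_zero, zero_mul, sub_zero]
    rw [h, div_eq_mul_one_div τ 2, Real.mul_rpow hτ.le (by norm_num)]
    ring

/-- For x > 0 the factor e^{-`rayDecay M`·xρ} alone gives convergence, uniformly in τ. This covers M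
= 1, where the power bound is not integrable at 0. -/
lemma exists_majorant_le {M : ℕ} (hM : 1 ≤ M) {x : ℝ} (hx : 0 < x) : ∃ C : ℝ, 0 ≤ C ∧
    ∀ τ : ℝ, 0 < τ → majorant M τ x ≤ C := by
  have hd := rayDecay_pos hM
  have h1 := integrableOn_rpow_mul_exp_neg_mul_rpow (p := 1) (s := M) (b := rayDecay M * x)
    (by have : (0 : ℝ) ≤ M := by positivity
        linarith) one_pos (by positivity)
  simp only [Real.rpow_natCast, Real.rpow_one] at h1
  refine ⟨∫ ρ in Set.Ioi (0 : ℝ), ρ ^ M * Real.exp (-(rayDecay M * x) * ρ),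
    setIntegral_nonneg measurableSet_Ioi fun ρ hρ => ?_, fun τ hτ =>
    setIntegral_mono_on (integrableOn_majorant hM hτ hx.le) h1 measurableSet_Ioi fun ρ hρ => ?_⟩
  · have : (0 : ℝ) < ρ := hρ
    positivity
  · have hρ' : (0 : ℝ) < ρ := hρ
    have : 0 ≤ τ / 2 * ρ ^ (2 * M) := by positivity
    refine mul_le_mul_of_nonneg_left (Real.exp_le_exp.2 ?_) (by positivity)
    linarith

lemma measurable_majorant (M : ℕ) : Measurable fun p : ℝ × ℝ => majorant M p.1 p.2 := by
  have h : Continuous fun p : (ℝ × ℝ) × ℝ => p.2 ^ M *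
      Real.exp (-(p.1.1 / 2 * p.2 ^ (2 * M)) - rayDecay M * p.1.2 * p.2) := by fun_prop
  exact (h.stronglyMeasurable.integral_prod_right
    (ν := volume.restrict (Set.Ioi (0 : ℝ)))).measurable

/-- Integrating in x first costs one power of ρ, and ∫ ρ^{M-1} e^{-τρ^N/2} dρ scales like τ^{-1/2}
for every M. This singularity is integrable at τ = 0, so after integration in space no case
distinction on M remains. -/
lemma integral_majorant {M : ℕ} (hM : 1 ≤ M) : ∃ C : ℝ, ∀ τ : ℝ, 0 < τ →
    IntegrableOn (fun x => majorant M τ x) (Set.Ioi 0) ∧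
      ∫ x in Set.Ioi (0 : ℝ), majorant M τ x = C * τ ^ (-(1 / 2) : ℝ) := by
  have hd := rayDecay_pos hM
  have hM' : (M : ℝ) ≠ 0 := by exact_mod_cast (by omega : M ≠ 0)
  refine ⟨(rayDecay M)⁻¹ * ((1 / 2) ^ (-(1 / 2) : ℝ) * (1 / (2 * M)) * Real.Gamma (1 / 2)),
    fun τ hτ => ?_⟩
  have e : ∀ x ρ : ℝ, ρ ^ M * Real.exp (-(τ / 2 * ρ ^ (2 * M)) - rayDecay M * x * ρ) =
      ρ ^ M * Real.exp (-(τ / 2 * ρ ^ (2 * M))) * Real.exp (-((rayDecay M * ρ) * x)) := by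
    intro x ρ
    rw [mul_assoc (ρ ^ M), ← Real.exp_add]; ring_nf
  have hinner : ∀ ρ ∈ Set.Ioi (0 : ℝ), ∫ x in Set.Ioi (0 : ℝ), ρ ^ M *
      Real.exp (-(τ / 2 * ρ ^ (2 * M)) - rayDecay M * x * ρ) =
      (rayDecay M)⁻¹ * (ρ ^ (M - 1) * Real.exp (-(τ / 2 * ρ ^ (2 * M)))) := by
    intro ρ hρ
    have hρ' : (0 : ℝ) < ρ := hρ
    simp only [e]
    rw [integral_const_mul, integral_exp_neg_mul_Ioi (by positivity)]
    have : ρ ^ M = ρ ^ (M - 1) * ρ := by rw [← pow_succ]; congr 1; omega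
    rw [this]; field_simp
  have hint : Integrable (fun p : ℝ × ℝ => p.2 ^ M *
      Real.exp (-(τ / 2 * p.2 ^ (2 * M)) - rayDecay M * p.1 * p.2))
      ((volume.restrict (Set.Ioi 0)).prod (volume.restrict (Set.Ioi 0))) := by
    rw [integrable_prod_iff' (by fun_prop)]
    constructor
    · refine (ae_restrict_mem measurableSet_Ioi).mono fun ρ hρ => ?_
      have hρ' : (0 : ℝ) < ρ := hρ
      simp only [e]
      exact (integrableOn_exp_neg_mul (by positivity)).const_mul _
    · refine ((integrableOn_pow_mul_exp_neg_mul_pow hM (half_pos hτ) (M - 1)).const_mul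
        (rayDecay M)⁻¹).congr ?_
      refine (ae_restrict_mem measurableSet_Ioi).mono fun ρ hρ => ?_
      have hρ' : (0 : ℝ) < ρ := hρ
      simp only
      rw [← hinner ρ hρ]
      refine integral_congr_ae (ae_of_all _ fun x => ?_)
      simp only
      rw [Real.norm_of_nonneg (by positivity)]
  refine ⟨hint.integral_prod_left, ?_⟩
  unfold majorant
  rw [integral_integral_swap hint, setIntegral_congr_fun measurableSet_Ioi hinner,
    integral_const_mul, integral_pow_mul_exp_neg_mul_pow hM (half_pos hτ), Nat.cast_sub hM]
  have e1 : ((M : ℝ) - (1 : ℕ) + 1) / (2 * M) = 1 / 2 := by push_cast; field_simp; ring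
  rw [neg_div, e1, div_eq_mul_one_div τ 2, Real.mul_rpow hτ.le (by norm_num)]
  ring

lemma integrableOn_exp_neg_mul_rpow {b r : ℝ} (hb : 0 < b) (hr : -1 < r) :
    IntegrableOn (fun τ : ℝ => Real.exp (-(b * τ)) * τ ^ r) (Set.Ioi 0) := by
  have h := integrableOn_rpow_mul_exp_neg_mul_rpow hr one_pos hb
  simp only [Real.rpow_one, neg_mul] at h
  exact h.congr_fun (fun τ _ => mul_comm _ _) measurableSet_Ioi

lemma integrable_exp_mul_majorant {M : ℕ} (hM : 1 ≤ M) {α : ℝ} (hα : 0 < α) :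
    Integrable (fun p : ℝ × ℝ => Real.exp (-(α * p.1)) * majorant M p.1 p.2)
      ((volume.restrict (Set.Ioi 0)).prod (volume.restrict (Set.Ioi 0))) := by
  obtain ⟨C, hC⟩ := integral_majorant hM
  have hm := measurable_majorant M
  rw [integrable_prod_iff (by fun_prop)]
  constructor
  · refine (ae_restrict_mem measurableSet_Ioi).mono fun s hs => ?_
    exact Integrable.const_mul (hC s hs).1 (Real.exp (-(α * s)))
  · refine ((integrableOn_exp_neg_mul_rpow hα (r := -(1 / 2)) (by norm_num)).const_mul C).congr ?_
    refine (ae_restrict_mem measurableSet_Ioi).mono fun s hs => ?_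
    simp only [norm_mul, Real.norm_of_nonneg (Real.exp_pos _).le,
      Real.norm_of_nonneg (majorant_nonneg _ _ _)]
    rw [integral_const_mul, (hC s hs).2]
    ring

lemma measurable_kernelI (N m : ℕ) (θ : ℂ) :
    Measurable fun p : ℝ × ℝ => kernelI N m θ p.1 p.2 := by
  have h : ∀ c : ℂ, Measurable fun p : ℝ × ℝ => ∫ ξ in Set.Ioi (0 : ℝ), (ξ : ℂ) ^ (N - m - 1) *
      cexp (-(p.1 * ξ ^ N) - θ * c * p.2 * ξ) := by
    intro c
    have h : Continuous fun p : (ℝ × ℝ) × ℝ => (p.2 : ℂ) ^ (N - m - 1) *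
        cexp (-(p.1.1 * p.2 ^ N) - θ * c * p.1.2 * p.2) := by fun_prop
    exact (h.stronglyMeasurable.integral_prod_right
      (ν := volume.restrict (Set.Ioi (0 : ℝ)))).measurable
  unfold kernelI
  exact (((h _).const_mul _).sub ((h _).const_mul _)).const_mul _

lemma continuousOn_rayIntegral_kernelFun {M : ℕ} (hM : 1 ≤ M) {θ : ℂ} (hθ : θ ∈ rootsJ (2 * M))
    {ψ : ℝ} (hψ : |ψ| = rayAngle M) :
    ContinuousOn (fun p : ℝ × ℝ => rayIntegral (kernelFun M θ p.1 p.2) ψ)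
      (Set.Ioi 0 ×ˢ Set.Ici 0) := by
  intro p hp
  have hp1 : 0 < p.1 := hp.1
  have hd := rayDecay_pos hM
  refine ContinuousWithinAt.mul continuousWithinAt_const ?_
  refine continuousWithinAt_of_dominated
    (bound := fun ρ => ρ ^ M * Real.exp (-(p.1 / 2 / 2 * ρ ^ (2 * M)))) ?_ ?_ ?_ ?_
  · exact Eventually.of_forall fun q => (continuous_kernelFun_ray _ _ _ _ _).aestronglyMeasurable
  · have h1 : ∀ᶠ q : ℝ × ℝ in 𝓝[Set.Ioi 0 ×ˢ Set.Ici 0] p, p.1 / 2 < q.1 :=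
      nhdsWithin_le_nhds (continuous_fst.continuousAt.eventually (lt_mem_nhds (half_lt_self hp1)))
    filter_upwards [h1, self_mem_nhdsWithin] with q hq1 hq2
    refine (ae_restrict_mem measurableSet_Ioi).mono fun ρ hρ => ?_
    have hρ' : (0 : ℝ) < ρ := hρ
    have hq3 : 0 ≤ q.2 := hq2.2
    refine (norm_kernelFun_le (le_of_lt hq2.1) hq3 hρ'.le (cos_rayAngle hM hψ)
      (rayDecay_le hM hθ hψ.le)).trans ?_
    refine mul_le_mul_of_nonneg_left (Real.exp_le_exp.2 ?_) (by positivity)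
    have h2 : p.1 / 2 / 2 * ρ ^ (2 * M) ≤ q.1 / 2 * ρ ^ (2 * M) := by gcongr
    have h3 : 0 ≤ rayDecay M * q.2 * ρ := by positivity
    linarith
  · exact integrableOn_pow_mul_exp_neg_mul_pow hM (by positivity) M
  · refine ae_of_all _ fun ρ => Continuous.continuousWithinAt ?_
    unfold kernelFun; fun_prop

lemma continuousOn_kernelI {M : ℕ} (hM : 1 ≤ M) {θ : ℂ} (hθ : θ ∈ rootsJ (2 * M)) :
    ContinuousOn (fun p : ℝ × ℝ => kernelI (2 * M) (M - 1) θ p.1 p.2)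
      (Set.Ioi 0 ×ˢ Set.Ici 0) := by
  have h1 := continuousOn_rayIntegral_kernelFun hM hθ (abs_of_pos (rayAngle_pos hM))
  have h2 := continuousOn_rayIntegral_kernelFun hM hθ
    ((abs_neg _).trans (abs_of_pos (rayAngle_pos hM)))
  refine ((continuousOn_const (c := (M * I / Real.pi : ℂ))).mul (h2.sub h1)).congr fun p hp => ?_
  exact kernelI_eq_rayIntegral hM hθ hp.1 hp.2

/-- Conjugation exchanges the two integrals and the two phases, and the purely imaginary prefactor
restores the sign. Sums over the conjugation-stable set J are therefore real. -/
lemma conj_kernelI (N m : ℕ) (θ : ℂ) (τ x : ℝ) :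
    (starRingEnd ℂ) (kernelI N m θ τ x) = kernelI N m ((starRingEnd ℂ) θ) τ x := by
  have e : ∀ c : ℂ, (starRingEnd ℂ) (∫ ξ in Set.Ioi (0 : ℝ), (ξ : ℂ) ^ (N - m - 1) *
      cexp (-(τ * ξ ^ N) - θ * cexp c * x * ξ)) = ∫ ξ in Set.Ioi (0 : ℝ), (ξ : ℂ) ^ (N - m - 1) *
      cexp (-(τ * ξ ^ N) - (starRingEnd ℂ) θ * cexp ((starRingEnd ℂ) c) * x * ξ) := by
    intro c
    rw [← integral_conj]
    simp [← Complex.exp_conj]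
  have h1 : (starRingEnd ℂ) (I * ((Real.pi : ℂ) / N)) = -(I * (Real.pi / N)) := by simp
  have h2 : (starRingEnd ℂ) (-(I * ((Real.pi : ℂ) / N))) = I * (Real.pi / N) := by simp
  have h3 : (starRingEnd ℂ) (cexp (-(I * ((m : ℂ) / N * Real.pi)))) =
      cexp (I * (m / N * Real.pi)) := by simp [← Complex.exp_conj]
  have h4 : (starRingEnd ℂ) (cexp (I * ((m : ℂ) / N * Real.pi))) =
      cexp (-(I * (m / N * Real.pi))) := by simp [← Complex.exp_conj]
  have h5 : (starRingEnd ℂ) ((N : ℂ) * I / (2 * Real.pi)) = -(N * I / (2 * Real.pi)) := by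
    simp only [map_div₀, map_mul, conj_I, conj_ofReal, map_natCast, map_ofNat]
    ring
  rw [kernelI, map_mul, map_sub, map_mul, map_mul, e, e, h1, h2, h3, h4, h5, kernelI]
  ring

end PseudoProcess

namespace PseudoProcess

/-! ### The joint density -/

/-- The function with Laplace transform `∑ A_j θ_j a^{-(M-1)} e^{-θ_j a y}`, `a = α^{1/(2M)}`. -/
noncomputable def halfKernel (M : ℕ) (s y : ℝ) : ℂ :=
  ∑ θ ∈ rootsJ (2 * M), rootCoeff (rootsJ (2 * M)) θ * θ * kernelI (2 * M) (M - 1) θ s y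

/-- The real density on the quadrant `s, y > 0` given by `halfKernel`. -/
noncomputable def halfDensity (M : ℕ) (s y : ℝ) : ℝ :=
  if 0 < s ∧ 0 < y then (halfKernel M s y).re else 0

/-- The joint density of the sojourn time and the pseudo-process. -/
noncomputable def jointDensity (M : ℕ) (t s x : ℝ) : ℝ :=
  ∫ y : ℝ, halfDensity M s y * halfDensity M (t - s) (y - x)

lemma conj_halfKernel {M : ℕ} (hM : 1 ≤ M) (s y : ℝ) :
    (starRingEnd ℂ) (halfKernel M s y) = halfKernel M s y := by
  rw [halfKernel, map_sum]
  refine Finset.sum_nbij' (fun θ => (starRingEnd ℂ) θ) (fun θ => (starRingEnd ℂ) θ)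
    (fun θ h => conj_mem_rootsJ hM h) (fun θ h => conj_mem_rootsJ hM h) (by simp) (by simp) ?_
  intro θ _
  rw [map_mul, map_mul, conj_kernelI, rootCoeff_conj hM]

lemma halfDensity_eq_zero {M : ℕ} {s y : ℝ} (h : ¬ (0 < s ∧ 0 < y)) : halfDensity M s y = 0 :=
  if_neg h

lemma ofReal_halfDensity {M : ℕ} (hM : 1 ≤ M) {s y : ℝ} (hs : 0 < s) (hy : 0 < y) :
    (halfDensity M s y : ℂ) = halfKernel M s y := by
  rw [halfDensity, if_pos ⟨hs, hy⟩]
  exact Complex.conj_eq_iff_re.1 (conj_halfKernel hM s y)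

lemma exists_norm_halfDensity_le {M : ℕ} (hM : 1 ≤ M) : ∃ C : ℝ, 0 ≤ C ∧
    ∀ s y : ℝ, 0 < s → 0 ≤ y → ‖halfDensity M s y‖ ≤ C * majorant M s y := by
  refine ⟨∑ θ ∈ rootsJ (2 * M), ‖rootCoeff (rootsJ (2 * M)) θ * θ‖ * M,
    Finset.sum_nonneg fun _ _ => by positivity, fun s y hs hy => ?_⟩
  have h0 := majorant_nonneg M s y
  by_cases hy0 : 0 < y
  · rw [← norm_real, ofReal_halfDensity hM hs hy0, halfKernel, Finset.sum_mul]
    refine (norm_sum_le _ _).trans (Finset.sum_le_sum fun θ hθ => ?_)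
    rw [norm_mul _ (kernelI _ _ _ _ _), mul_assoc]
    gcongr
    exact norm_kernelI_le hM hθ hs hy
  · rw [halfDensity_eq_zero fun h => hy0 h.2, norm_zero]
    have : (0 : ℝ) ≤ ∑ θ ∈ rootsJ (2 * M), ‖rootCoeff (rootsJ (2 * M)) θ * θ‖ * M :=
      Finset.sum_nonneg fun _ _ => by positivity
    positivity

lemma measurable_halfKernel (M : ℕ) : Measurable fun p : ℝ × ℝ => halfKernel M p.1 p.2 :=
  Finset.measurable_sum _ fun θ _ => (measurable_kernelI _ _ θ).const_mul _

lemma measurable_halfDensity (M : ℕ) : Measurable fun p : ℝ × ℝ => halfDensity M p.1 p.2 := by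
  refine Measurable.ite ?_ (measurable_halfKernel M).re measurable_const
  exact (measurableSet_lt measurable_const measurable_fst).inter
    (measurableSet_lt measurable_const measurable_snd)

/-- The cut-off at y = 0 may create a jump. Continuity off this line is enough, since
`continuousOn_jointDensity` needs it only for almost every y. -/
lemma continuousAt_halfDensity {M : ℕ} (hM : 1 ≤ M) {p : ℝ × ℝ} (h1 : 0 < p.1) (h2 : p.2 ≠ 0) :
    ContinuousAt (fun p : ℝ × ℝ => halfDensity M p.1 p.2) p := by
  rcases lt_or_gt_of_ne h2 with h | h
  · have : (fun p : ℝ × ℝ => halfDensity M p.1 p.2) =ᶠ[𝓝 p] fun _ => 0 := by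
      filter_upwards [continuous_snd.continuousAt.eventually (gt_mem_nhds h)] with q hq
      exact halfDensity_eq_zero fun h' => absurd h'.2 (not_lt.2 hq.le)
    exact continuousAt_const.congr this.symm
  · have hmem : Set.Ioi (0 : ℝ) ×ˢ Set.Ioi (0 : ℝ) ∈ 𝓝 p :=
      prod_mem_nhds (Ioi_mem_nhds h1) (Ioi_mem_nhds h)
    have hc : ContinuousOn (fun p : ℝ × ℝ => halfKernel M p.1 p.2)
        (Set.Ioi 0 ×ˢ Set.Ici 0) :=
      continuousOn_finsetSum _ fun θ hθ => continuousOn_const.mul (continuousOn_kernelI hM hθ)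
    have hc' := (hc.continuousAt (mem_of_superset hmem
      (Set.prod_mono le_rfl Set.Ioi_subset_Ici_self)))
    have hc2 : ContinuousAt (fun p : ℝ × ℝ => (halfKernel M p.1 p.2).re) p :=
      Complex.continuous_re.continuousAt.comp hc'
    refine hc2.congr ?_
    filter_upwards [hmem] with q hq
    rw [halfDensity, if_pos ⟨hq.1, hq.2⟩]

lemma integrable_halfDensity_transform {M : ℕ} (hM : 1 ≤ M) {α : ℝ} (hα : 0 < α) (μ : ℝ) :
    Integrable fun p : ℝ × ℝ => cexp (-(α * p.1) + I * μ * p.2) * halfDensity M p.1 p.2 := by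
  obtain ⟨C, hC0, hC⟩ := exists_norm_halfDensity_le hM
  have hm := measurable_halfDensity M
  have hsupp : Function.support (fun p : ℝ × ℝ => cexp (-(α * p.1) + I * μ * p.2) *
      (halfDensity M p.1 p.2 : ℂ)) ⊆ Set.Ioi 0 ×ˢ Set.Ioi 0 := by
    intro p hp
    by_contra h
    apply hp
    simp only
    rw [halfDensity_eq_zero (fun h' => h ⟨h'.1, h'.2⟩)]
    simp
  rw [← integrableOn_iff_integrable_of_support_subset hsupp]
  have h1 := (integrable_exp_mul_majorant hM hα).const_mul C
  rw [Measure.prod_restrict] at h1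
  refine Integrable.mono' h1 ?_ ?_
  · have : Measurable fun p : ℝ × ℝ => cexp (-(α * p.1) + I * μ * p.2) *
      (halfDensity M p.1 p.2 : ℂ) := by fun_prop
    exact this.aestronglyMeasurable
  · refine (ae_restrict_mem (measurableSet_Ioi.prod measurableSet_Ioi)).mono fun p hp => ?_
    have e : -((α : ℂ) * p.1) + I * μ * p.2 = ((-(α * p.1) : ℝ) : ℂ) + ((μ * p.2 : ℝ) : ℂ) * I := by
      push_cast; ring
    rw [norm_mul, e, Complex.exp_add, norm_mul, norm_exp_ofReal_mul_I, mul_one, norm_exp_ofReal,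
      norm_real]
    have := hC p.1 p.2 hp.1 (le_of_lt hp.2)
    calc _ ≤ Real.exp (-(α * p.1)) * (C * majorant M p.1 p.2) := by gcongr
      _ = _ := by ring

lemma laplace_halfDensity {M : ℕ} (hM : 1 ≤ M) {a y : ℝ} (ha : 0 < a) (hy : 0 < y) :
    IntegrableOn (fun s : ℝ => cexp (-((a ^ (2 * M) : ℝ) * s)) * (halfDensity M s y : ℂ))
      (Set.Ioi 0) ∧
    ∫ s in Set.Ioi (0 : ℝ), cexp (-((a ^ (2 * M) : ℝ) * s)) * (halfDensity M s y : ℂ) =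
      ((a : ℂ) ^ (M - 1))⁻¹ * ∑ θ ∈ rootsJ (2 * M),
        rootCoeff (rootsJ (2 * M)) θ * θ * cexp (-(θ * a * y)) := by
  have e : Set.EqOn
      (fun s : ℝ => cexp (-((a ^ (2 * M) : ℝ) * s)) * (halfDensity M s y : ℂ))
      (fun s : ℝ => ∑ θ ∈ rootsJ (2 * M), rootCoeff (rootsJ (2 * M)) θ * θ *
        (cexp (-((a ^ (2 * M) : ℝ) * s)) * kernelI (2 * M) (M - 1) θ s y)) (Set.Ioi 0) := by
    intro s hs
    simp only
    rw [ofReal_halfDensity hM hs hy, halfKernel, Finset.mul_sum]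
    exact Finset.sum_congr rfl fun θ _ => by ring
  have hi : ∀ θ ∈ rootsJ (2 * M), IntegrableOn (fun s : ℝ => rootCoeff (rootsJ (2 * M)) θ * θ *
        (cexp (-((a ^ (2 * M) : ℝ) * s)) * kernelI (2 * M) (M - 1) θ s y)) (Set.Ioi 0) :=
    fun θ hθ => Integrable.const_mul (laplace_kernelI hM hθ ha hy.le (Or.inr hy)).1 _
  refine ⟨IntegrableOn.congr_fun (integrable_finsetSum _ hi) e.symm measurableSet_Ioi, ?_⟩
  rw [setIntegral_congr_fun measurableSet_Ioi e, integral_finsetSum _ hi, Finset.mul_sum]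
  refine Finset.sum_congr rfl fun θ hθ => ?_
  rw [integral_const_mul, (laplace_kernelI hM hθ ha hy.le (Or.inr hy)).2]
  ring

lemma re_mul_ofReal_pos {M : ℕ} (hM : 1 ≤ M) {θ : ℂ} (hθ : θ ∈ rootsJ (2 * M)) {a : ℝ} (ha : 0 < a) :
    0 < (θ * a).re := by
  rw [mul_comm, re_ofReal_mul]
  exact mul_pos ha ((mem_rootsJ hM).1 hθ).2

/-- The Laplace transform in s gives a^{-(M-1)} ∑ A_θ θ e^{-θay}. The Fourier transform in y turns
this into the partial fraction expansion `prod_rootsJ_inv_sub`, that is, into the inverse of one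
Wiener–Hopf factor of a^N + μ^N. -/
lemma integral_halfDensity_transform {M : ℕ} (hM : 1 ≤ M) {a : ℝ} (ha : 0 < a) (μ : ℝ) :
    ∫ p : ℝ × ℝ, cexp (-((a ^ (2 * M) : ℝ) * p.1) + I * μ * p.2) * halfDensity M p.1 p.2 =
      ∏ θ ∈ rootsJ (2 * M), ((a : ℂ) - I * μ / θ)⁻¹ := by
  have hi := integrable_halfDensity_transform hM (pow_pos ha (2 * M)) μ
  rw [Measure.volume_eq_prod] at hi ⊢
  rw [integral_prod_symm _ hi]
  have h0 : ∀ y : ℝ, y ∉ Set.Ioi (0 : ℝ) → ∫ s : ℝ, cexp (-((a ^ (2 * M) : ℝ) * s) + I * μ * y) *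
      (halfDensity M s y : ℂ) = 0 := by
    intro y hy
    have : ∀ s, halfDensity M s y = 0 := fun s => halfDensity_eq_zero fun h => hy h.2
    simp [this]
  rw [← setIntegral_eq_integral_of_forall_compl_eq_zero h0]
  have h1 : Set.EqOn (fun y : ℝ => ∫ s : ℝ, cexp (-((a ^ (2 * M) : ℝ) * s) + I * μ * y) *
      (halfDensity M s y : ℂ)) (fun y : ℝ => ((a : ℂ) ^ (M - 1))⁻¹ * ∑ θ ∈ rootsJ (2 * M),
        rootCoeff (rootsJ (2 * M)) θ * θ * cexp ((-(θ * a - I * μ)) * y)) (Set.Ioi 0) := by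
    intro y hy
    have h2 : ∀ s : ℝ, s ∉ Set.Ioi (0 : ℝ) → cexp (-((a ^ (2 * M) : ℝ) * s) + I * μ * y) *
      (halfDensity M s y : ℂ) = 0 := by
      intro s hs
      rw [halfDensity_eq_zero fun h => hs h.1]; simp
    simp only
    rw [← setIntegral_eq_integral_of_forall_compl_eq_zero h2]
    have h3 : ∀ s : ℝ, cexp (-((a ^ (2 * M) : ℝ) * s) + I * μ * y) * (halfDensity M s y : ℂ) =
      cexp (I * μ * y) * (cexp (-((a ^ (2 * M) : ℝ) * s)) * (halfDensity M s y : ℂ)) := by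
      intro s; rw [Complex.exp_add]; ring
    simp only [h3]
    rw [integral_const_mul, (laplace_halfDensity hM ha hy).2, mul_left_comm, Finset.mul_sum]
    congr 1
    refine Finset.sum_congr rfl fun θ _ => ?_
    rw [mul_left_comm, ← Complex.exp_add]
    ring_nf
  have hre : ∀ θ ∈ rootsJ (2 * M), (-(θ * a - I * μ)).re < 0 := by
    intro θ hθ
    have := re_mul_ofReal_pos hM hθ ha
    rw [neg_re, sub_re]
    simp only [mul_re, I_re, I_im, ofReal_re, ofReal_im] at this ⊢
    linarith
  rw [setIntegral_congr_fun measurableSet_Ioi h1, integral_const_mul, integral_finsetSum,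
    prod_rootsJ_inv_sub hM a (I * μ) (by exact_mod_cast ha.ne')]
  · congr 1
    refine Finset.sum_congr rfl fun θ hθ => ?_
    rw [integral_const_mul, integral_exp_mul_complex_Ioi (hre θ hθ)]
    simp only [ofReal_zero, mul_zero, Complex.exp_zero]
    rw [neg_div_neg_eq, mul_one_div]
  · intro θ hθ h
    have := hre θ hθ
    rw [h] at this; simp at this
  · intro θ hθ
    exact Integrable.const_mul (integrableOn_exp_mul_complex_Ioi (hre θ hθ) 0) _

/-- Permutation of coordinates `((t, s, x), y) ↦ ((t, x), (s, y))`. -/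
def coordinatePerm : (ℝ × ℝ × ℝ) × ℝ ≃ᵐ (ℝ × ℝ) × (ℝ × ℝ) where
  toFun z := ((z.1.1, z.1.2.2), (z.1.2.1, z.2))
  invFun w := ((w.1.1, w.2.1, w.1.2), w.2.2)
  left_inv _ := rfl
  right_inv _ := rfl
  measurable_toFun := (by fun_prop :
    Measurable fun z : (ℝ × ℝ × ℝ) × ℝ => ((z.1.1, z.1.2.2), (z.1.2.1, z.2)))
  measurable_invFun := (by fun_prop :
    Measurable fun w : (ℝ × ℝ) × (ℝ × ℝ) => ((w.1.1, w.2.1, w.1.2), w.2.2))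

lemma measurePreserving_coordinatePerm : MeasurePreserving coordinatePerm volume volume := by
  have h1 : MeasurePreserving (fun z : (ℝ × ℝ × ℝ) × ℝ => (z.1.1, (z.1.2, z.2))) volume volume :=
    volume_preserving_prodAssoc
  have h2 : MeasurePreserving (fun z : ℝ × ((ℝ × ℝ) × ℝ) => (z.1, ((z.2.1.2, z.2.1.1), z.2.2)))
      volume volume :=
    (MeasurePreserving.id volume).prod
      ((Measure.measurePreserving_swap (μ := (volume : Measure ℝ)) (ν := volume)).prod
        (MeasurePreserving.id volume))
  have h3 : MeasurePreserving (fun z : ℝ × ((ℝ × ℝ) × ℝ) => (z.1, (z.2.1.1, (z.2.1.2, z.2.2))))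
      volume volume :=
    (MeasurePreserving.id volume).prod volume_preserving_prodAssoc
  have h4 : MeasurePreserving (fun z : ℝ × (ℝ × (ℝ × ℝ)) => ((z.1, z.2.1), z.2.2))
      volume volume :=
    (volume_preserving_prodAssoc (α₁ := ℝ) (β₁ := ℝ) (γ₁ := ℝ × ℝ)).symm
  exact h4.comp (h3.comp (h2.comp h1))

/-- Since e^{-λt-νs} = e^{-(λ+ν)s} e^{-λ(t-s)}, the integrand is that of a convolution on ℝ² of a
weighted `halfDensity` with a weighted spatial reflection of it, and transforms of convolutions
factor. The case ν = 0 is included because it gives the integrability of e^{-λt}q. -/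
lemma jointDensity_transform_aux {M : ℕ} (hM : 1 ≤ M) {lam ν : ℝ} (hlam : 0 < lam) (hν : 0 ≤ ν)
    (μ : ℝ) :
    Integrable (fun z : (ℝ × ℝ × ℝ) × ℝ => cexp (-(lam * z.1.1) + I * μ * z.1.2.2 - ν * z.1.2.1) *
      (halfDensity M z.1.2.1 z.2 * halfDensity M (z.1.1 - z.1.2.1) (z.2 - z.1.2.2) : ℝ)) ∧
    ∫ z : (ℝ × ℝ × ℝ) × ℝ, cexp (-(lam * z.1.1) + I * μ * z.1.2.2 - ν * z.1.2.1) *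
      (halfDensity M z.1.2.1 z.2 * halfDensity M (z.1.1 - z.1.2.1) (z.2 - z.1.2.2) : ℝ) =
    (∫ p : ℝ × ℝ, cexp (-((lam + ν : ℝ) * p.1) + I * μ * p.2) * halfDensity M p.1 p.2) *
      ∫ p : ℝ × ℝ, cexp (-(lam * p.1) + I * (-μ : ℝ) * p.2) * halfDensity M p.1 p.2 := by
  set f : ℝ × ℝ → ℂ := fun p => cexp (-((lam + ν : ℝ) * p.1) + I * μ * p.2) * halfDensity M p.1 p.2
    with hf
  set g : ℝ × ℝ → ℂ := fun p => cexp (-(lam * p.1) + I * μ * p.2) * halfDensity M p.1 (-p.2) with hg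
  have hmp : MeasurePreserving (fun p : ℝ × ℝ => (p.1, -p.2)) volume volume :=
    (MeasurePreserving.id volume).prod (Measure.measurePreserving_neg volume)
  have hemb : MeasurableEmbedding (fun p : ℝ × ℝ => (p.1, -p.2)) :=
    ((MeasurableEquiv.refl ℝ).prodCongr (MeasurableEquiv.neg ℝ)).measurableEmbedding
  have hfi : Integrable f := integrable_halfDensity_transform hM (by positivity) μ
  have hg' : ∀ p : ℝ × ℝ, g p = (fun p : ℝ × ℝ => cexp (-(lam * p.1) + I * (-μ : ℝ) * p.2) *
      (halfDensity M p.1 p.2 : ℂ)) (p.1, -p.2) := by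
    intro p
    simp only [hg]
    push_cast
    ring_nf
  have hgi : Integrable g := by
    have := (hmp.integrable_comp_emb hemb).2
      (integrable_halfDensity_transform hM hlam (-μ))
    exact this.congr (ae_of_all _ fun p => (hg' p).symm)
  have hgint : ∫ p, g p = ∫ p : ℝ × ℝ, cexp (-(lam * p.1) + I * (-μ : ℝ) * p.2) *
      halfDensity M p.1 p.2 := by
    simp only [hg']
    exact hmp.integral_comp hemb (fun p : ℝ × ℝ => cexp (-(lam * p.1) + I * (-μ : ℝ) * p.2) *
      (halfDensity M p.1 p.2 : ℂ))
  have hconv := hfi.convolution_integrand (ContinuousLinearMap.mul ℂ ℂ) hgi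
  have hint := integral_convolution (ContinuousLinearMap.mul ℂ ℂ) hfi hgi
  simp only [convolution_def, ContinuousLinearMap.mul_apply'] at hint hconv
  rw [← integral_prod _ hconv] at hint
  have e : ∀ z : (ℝ × ℝ × ℝ) × ℝ, cexp (-(lam * z.1.1) + I * μ * z.1.2.2 - ν * z.1.2.1) *
      (halfDensity M z.1.2.1 z.2 * halfDensity M (z.1.1 - z.1.2.1) (z.2 - z.1.2.2) : ℝ) =
      (fun p : (ℝ × ℝ) × ℝ × ℝ => f p.2 * g (p.1 - p.2)) (coordinatePerm z) := by
    rintro ⟨⟨t, s, x⟩, y⟩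
    simp only [coordinatePerm, MeasurableEquiv.coe_mk, Equiv.coe_fn_mk, hf, hg, Prod.fst_sub,
      Prod.snd_sub, neg_sub]
    have : cexp (-(lam * t) + I * μ * x - ν * s) = cexp (-((lam + ν : ℝ) * s) + I * μ * y) *
        cexp (-(lam * (t - s : ℝ)) + I * μ * (x - y : ℝ)) := by
      rw [← Complex.exp_add]; push_cast; ring_nf
    rw [this]
    push_cast
    ring
  simp only [e]
  constructor
  · exact (measurePreserving_coordinatePerm.integrable_comp_emb
      coordinatePerm.measurableEmbedding).2 hconv
  · rw [measurePreserving_coordinatePerm.integral_comp coordinatePerm.measurableEmbedding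
      (fun p : (ℝ × ℝ) × ℝ × ℝ => f p.2 * g (p.1 - p.2)), ← hgint]
    exact hint

lemma jointDensity_transform {M : ℕ} (hM : 1 ≤ M) {lam ν : ℝ} (hlam : 0 < lam) (hν : 0 ≤ ν)
    (μ : ℝ) :
    Integrable (fun z : ℝ × ℝ × ℝ => cexp (-(lam * z.1) + I * μ * z.2.2 - ν * z.2.1) *
      jointDensity M z.1 z.2.1 z.2.2) ∧
    ∫ z : ℝ × ℝ × ℝ, cexp (-(lam * z.1) + I * μ * z.2.2 - ν * z.2.1) *
      jointDensity M z.1 z.2.1 z.2.2 =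
    (∫ p : ℝ × ℝ, cexp (-((lam + ν : ℝ) * p.1) + I * μ * p.2) * halfDensity M p.1 p.2) *
      ∫ p : ℝ × ℝ, cexp (-(lam * p.1) + I * (-μ : ℝ) * p.2) * halfDensity M p.1 p.2 := by
  obtain ⟨h1, h2⟩ := jointDensity_transform_aux hM hlam hν μ
  have e : ∀ z : ℝ × ℝ × ℝ, cexp (-(lam * z.1) + I * μ * z.2.2 - ν * z.2.1) *
      jointDensity M z.1 z.2.1 z.2.2 = ∫ y : ℝ, cexp (-(lam * z.1) + I * μ * z.2.2 - ν * z.2.1) *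
      (halfDensity M z.2.1 y * halfDensity M (z.1 - z.2.1) (y - z.2.2) : ℝ) := by
    intro z
    rw [integral_const_mul, integral_complex_ofReal, jointDensity]
  simp only [e]
  rw [Measure.volume_eq_prod] at h1 h2
  refine ⟨h1.integral_prod_left, ?_⟩
  rw [← h2, integral_prod _ h1]

/-- Dominated convergence: near (t,s,x) both times stay above half their values, so the first factor
is controlled by the integrable function `majorant M (s / 2)` and the second by a constant. Only y =
0 and y = x are excluded. -/
lemma continuousOn_jointDensity {M : ℕ} (hM : 1 ≤ M) :
    ContinuousOn (fun z : ℝ × ℝ × ℝ => jointDensity M z.1 z.2.1 z.2.2)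
      {z | 0 < z.2.1 ∧ z.2.1 < z.1} := by
  obtain ⟨C, hC0, hC⟩ := exists_norm_halfDensity_le hM
  obtain ⟨D, hD⟩ := integral_majorant hM
  have hm := measurable_halfDensity M
  rintro ⟨t, s, x⟩ ⟨hs, hst⟩
  simp only at hs hst
  refine ContinuousAt.continuousWithinAt ?_
  have hs2 : 0 < s / 2 := by linarith
  have hr2 : 0 < (t - s) / 2 := by linarith
  refine continuousAt_of_dominated (bound := fun y => (C * (C * majorant M ((t - s) / 2) 0)) *
    (Set.Ioi (0 : ℝ)).indicator (fun y => majorant M (s / 2) y) y) ?_ ?_ ?_ ?_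
  · refine Eventually.of_forall fun z => ?_
    have : Measurable fun y => halfDensity M z.2.1 y * halfDensity M (z.1 - z.2.1) (y - z.2.2) :=
      (hm.comp (measurable_const.prodMk measurable_id)).mul
        (hm.comp (measurable_const.prodMk (measurable_id.sub_const _)))
    exact this.aestronglyMeasurable
  · have h1 : ∀ᶠ z : ℝ × ℝ × ℝ in 𝓝 (t, s, x), s / 2 < z.2.1 := by
      have : ContinuousAt (fun z : ℝ × ℝ × ℝ => z.2.1) (t, s, x) := by fun_prop
      exact this.eventually (lt_mem_nhds (by simp only; linarith))
    have h2 : ∀ᶠ z : ℝ × ℝ × ℝ in 𝓝 (t, s, x), (t - s) / 2 < z.1 - z.2.1 := by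
      have : ContinuousAt (fun z : ℝ × ℝ × ℝ => z.1 - z.2.1) (t, s, x) := by fun_prop
      exact this.eventually (lt_mem_nhds (by simp only; linarith))
    filter_upwards [h1, h2] with z hz1 hz2
    refine ae_of_all _ fun y => ?_
    have hmaj := majorant_nonneg M ((t - s) / 2) 0
    by_cases hy : 0 < y
    · rw [Set.indicator_of_mem (Set.mem_Ioi.2 hy), norm_mul]
      have k1 : ‖halfDensity M z.2.1 y‖ ≤ C * majorant M (s / 2) y :=
        (hC _ _ (hs2.trans hz1) hy.le).trans (by
          gcongr; exact majorant_anti hM hs2 hz1.le hy.le le_rfl)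
      have k2 : ‖halfDensity M (z.1 - z.2.1) (y - z.2.2)‖ ≤ C * majorant M ((t - s) / 2) 0 := by
        by_cases hyz : 0 ≤ y - z.2.2
        · exact (hC _ _ (hr2.trans hz2) hyz).trans (by
            gcongr; exact majorant_anti hM hr2 hz2.le le_rfl hyz)
        · rw [halfDensity_eq_zero fun h => hyz h.2.le, norm_zero]; positivity
      have k3 := (norm_nonneg _).trans k1
      calc _ ≤ C * majorant M (s / 2) y * (C * majorant M ((t - s) / 2) 0) := by gcongr
        _ = _ := by ring
    · rw [halfDensity_eq_zero fun h => hy h.2, Set.indicator_of_notMem (by simpa using hy)]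
      simp
  · exact ((hD _ hs2).1.integrable_indicator measurableSet_Ioi).const_mul _
  · have hne : ∀ᵐ y : ℝ, y ≠ 0 ∧ y ≠ x := by
      have h1 : ∀ᵐ y : ℝ, y ≠ 0 := by simp [ae_iff]
      have h2 : ∀ᵐ y : ℝ, y ≠ x := by simp [ae_iff]
      exact h1.and h2
    filter_upwards [hne] with y hy
    have c1 : ContinuousAt (fun p : ℝ × ℝ => halfDensity M p.1 p.2) (s, y) :=
      continuousAt_halfDensity hM hs hy.1
    have c2 : ContinuousAt (fun p : ℝ × ℝ => halfDensity M p.1 p.2) (t - s, y - x) :=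
      continuousAt_halfDensity hM (sub_pos.2 hst) (sub_ne_zero.2 hy.2)
    have d1 : ContinuousAt (fun z : ℝ × ℝ × ℝ => (z.2.1, y)) (t, s, x) := by fun_prop
    have d2 : ContinuousAt (fun z : ℝ × ℝ × ℝ => (z.1 - z.2.1, y - z.2.2)) (t, s, x) := by fun_prop
    exact (ContinuousAt.comp (f := fun z : ℝ × ℝ × ℝ => (z.2.1, y)) c1 d1).mul
      (ContinuousAt.comp (f := fun z : ℝ × ℝ × ℝ => (z.1 - z.2.1, y - z.2.2)) c2 d2)

lemma jointDensity_eq_zero {M : ℕ} {t s x : ℝ} (h : ¬ (0 < s ∧ s < t)) :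
    jointDensity M t s x = 0 := by
  have : ∀ y, halfDensity M s y * halfDensity M (t - s) (y - x) = 0 := by
    intro y
    rcases not_and_or.1 h with h | h
    · rw [halfDensity_eq_zero fun h' => h h'.1, zero_mul]
    · rw [halfDensity_eq_zero (s := t - s) fun h' => h (sub_pos.1 h'.1), mul_zero]
  simp [jointDensity, this]

lemma integrable_exp_mul_jointDensity {M : ℕ} (hM : 1 ≤ M) {lam : ℝ} (hlam : 0 < lam) :
    Integrable fun z : ℝ × ℝ × ℝ => Real.exp (-(lam * z.1)) * jointDensity M z.1 z.2.1 z.2.2 := by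
  have h := (jointDensity_transform hM hlam le_rfl 0).1.re
  refine h.congr (ae_of_all _ fun z => ?_)
  change (cexp _ * _).re = _
  rw [show -((lam : ℂ) * z.1) + I * (0 : ℝ) * z.2.2 - (0 : ℝ) * z.2.1 = ((-(lam * z.1) : ℝ) : ℂ) by
    push_cast; ring, ← ofReal_exp, ← ofReal_mul, ofReal_re]

end PseudoProcess

namespace PseudoProcess

open scoped BoundedContinuousFunction

/-! ### Uniqueness of transforms -/

/-- An integrable function orthogonal to a point-separating, multiplicative and conjugation-closed
family of bounded continuous functions vanishes almost everywhere. -/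
theorem ae_eq_zero_of_integral_mul_eq_zero {E : Type*} [TopologicalSpace E] [PolishSpace E]
    [MeasurableSpace E] [BorelSpace E] {μ : Measure E} {f : E → ℝ} (hf : Integrable f μ)
    (S : Set (E →ᵇ ℂ)) (hone : 1 ∈ S) (hmul : ∀ g ∈ S, ∀ g' ∈ S, g * g' ∈ S)
    (hstar : ∀ g ∈ S, star g ∈ S) (hsep : ∀ x y : E, x ≠ y → ∃ g ∈ S, g x ≠ g y)
    (h : ∀ g ∈ S, ∫ x, (f x : ℂ) * g x ∂μ = 0) : f =ᵐ[μ] 0 := by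
  have hm1 : AEMeasurable (fun x => ENNReal.ofReal (f x)) μ := hf.1.aemeasurable.ennreal_ofReal
  have hm2 : AEMeasurable (fun x => ENNReal.ofReal (-f x)) μ := hf.1.aemeasurable.neg.ennreal_ofReal
  -- The positive and negative parts of f become densities of two finite measures. The hypothesis
  -- says that S integrates equally against both.
  set P := μ.withDensity fun x => ENNReal.ofReal (f x) with hP
  set P' := μ.withDensity fun x => ENNReal.ofReal (-f x) with hP'
  have i1 : IsFiniteMeasure P := isFiniteMeasure_withDensity_ofReal hf.2
  have i2 : IsFiniteMeasure P' := isFiniteMeasure_withDensity_ofReal hf.neg.2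
  have hint : ∀ (g : E →ᵇ ℂ) (u : E → ℝ), Integrable u μ → Integrable (fun x => (u x : ℂ) * g x) μ :=
    fun g u hu => hu.ofReal.mul_bdd (c := ‖g‖) g.continuous.aestronglyMeasurable
      (ae_of_all _ fun x => g.norm_coe_le_norm x)
  have heq0 : ∀ g ∈ S, ∫ x, g x ∂P = ∫ x, g x ∂P' := by
    intro g hg
    rw [hP, hP', integral_withDensity_eq_integral_toReal_smul₀ hm1 (ae_of_all _ fun x => by simp),
      integral_withDensity_eq_integral_toReal_smul₀ hm2 (ae_of_all _ fun x => by simp),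
      ← sub_eq_zero]
    simp only [ENNReal.toReal_ofReal', real_smul]
    rw [← integral_sub (hint g _ hf.pos_part) (hint g _ hf.neg_part), ← h g hg]
    congr 1
    ext x
    rw [← sub_mul, ← ofReal_sub, max_zero_sub_max_neg_zero_eq_self]
  set A : StarSubalgebra ℂ (E →ᵇ ℂ) := StarAlgebra.adjoin ℂ S with hA
  have heq : ∀ g ∈ A, ∫ x, g x ∂P = ∫ x, g x ∂P' := by
    -- S is already a submonoid stable under the star operation, so the generated star algebra is
    -- its linear span, and equality of integrals extends by linearity.
    have hcl : (Submonoid.closure (S ∪ star S) : Set (E →ᵇ ℂ)) ⊆ S := by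
      have : S ∪ star S ⊆ S := Set.union_subset le_rfl fun g hg => by
        have := hstar _ hg
        rwa [star_star] at this
      exact (Submonoid.closure_le (S := ⟨⟨S, fun ha hb => hmul _ ha _ hb⟩, hone⟩)).2 this
    intro g hg
    have hg' : g ∈ Submodule.span ℂ (Submonoid.closure (S ∪ star S) : Set (E →ᵇ ℂ)) := by
      rw [← StarAlgebra.adjoin_eq_span]; exact hg
    have hint' : ∀ (g : E →ᵇ ℂ) (Q : Measure E) [IsFiniteMeasure Q], Integrable (fun x => g x) Q :=
      fun g Q _ => g.integrable Q
    clear hg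
    induction hg' using Submodule.span_induction with
    | mem g hg => exact heq0 g (hcl hg)
    | zero => simp
    | add g g' _ _ h1 h2 =>
      simp only [BoundedContinuousFunction.coe_add, Pi.add_apply]
      rw [integral_add (hint' g P) (hint' g' P), integral_add (hint' g P') (hint' g' P'), h1,
        h2]
    | smul c g _ h1 =>
      simp only [BoundedContinuousFunction.coe_smul]
      rw [integral_smul, integral_smul, h1]
  -- On a Polish space a point-separating star subalgebra of bounded continuous functions determines
  -- a finite measure.
  have hPP : P = P' := by
    refine ext_of_forall_mem_subalgebra_integral_eq_of_polish (𝕜 := ℂ) (A := A) ?_ heq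
    intro x y hxy
    obtain ⟨g, hg, hgxy⟩ := hsep x y hxy
    exact ⟨_, ⟨g.toContinuousMap, ⟨g, StarAlgebra.subset_adjoin ℂ S hg, rfl⟩, rfl⟩, hgxy⟩
  have hae := (withDensity_eq_iff hm1 hm2 hf.lintegral_lt_top.ne).1 hPP
  filter_upwards [hae] with x hx
  have h1 := congrArg ENNReal.toReal hx
  rw [ENNReal.toReal_ofReal', ENNReal.toReal_ofReal'] at h1
  have h2 := max_zero_sub_max_neg_zero_eq_self (f x)
  rw [h1, sub_self] at h2
  exact h2.symm

/-- A bounded strictly decreasing continuous function on `ℝ` equal to `e^{-t}` for `t ≥ 0`. -/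
noncomputable def expDecay (t : ℝ) : ℝ := Real.exp (-max t 0) - Real.exp (min t 0) + 1

lemma expDecay_of_nonneg {t : ℝ} (ht : 0 ≤ t) : expDecay t = Real.exp (-t) := by
  simp [expDecay, ht]

lemma continuous_expDecay : Continuous expDecay := by unfold expDecay; fun_prop

/-- e^{-t} is continued to t < 0 boundedly and injectively, so that its powers separate the points
of the whole line although only t ≥ 0 carries mass. -/
lemma expDecay_injective : Function.Injective expDecay := by
  have h : StrictAnti expDecay := by
    intro a b hab
    unfold expDecay
    have h1 : Real.exp (-max b 0) ≤ Real.exp (-max a 0) :=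
      Real.exp_le_exp.2 (neg_le_neg (max_le_max_right 0 hab.le))
    have h2 : Real.exp (min a 0) ≤ Real.exp (min b 0) :=
      Real.exp_le_exp.2 (min_le_min_right 0 hab.le)
    rcases lt_or_ge a 0 with ha | ha
    · have h3 : Real.exp (min a 0) < Real.exp (min b 0) := by
        rw [Real.exp_lt_exp, min_eq_left ha.le]
        exact lt_min hab ha
      linarith
    · have h3 : Real.exp (-max b 0) < Real.exp (-max a 0) := by
        rw [Real.exp_lt_exp, max_eq_left ha, max_eq_left (ha.trans hab.le)]
        linarith
      linarith
  exact h.injective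

lemma abs_expDecay_le (t : ℝ) : |expDecay t| ≤ 2 := by
  unfold expDecay
  have h1 : Real.exp (-max t 0) ≤ 1 := Real.exp_le_one_iff.2 (by simp)
  have h2 : Real.exp (min t 0) ≤ 1 := Real.exp_le_one_iff.2 (by simp)
  have h3 := Real.exp_pos (-max t 0)
  have h4 := Real.exp_pos (min t 0)
  rw [abs_le]
  constructor <;> linarith

/-- Injectivity of the Fourier transform for integrable functions on the line. -/
theorem ae_eq_zero_of_fourier_eq_zero {f : ℝ → ℝ} (hf : Integrable f)
    (h : ∀ μ : ℝ, ∫ x : ℝ, (f x : ℂ) * cexp (I * μ * x) = 0) : f =ᵐ[volume] 0 := by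
  have hn : ∀ μ x : ℝ, ‖cexp (I * μ * x)‖ = 1 := fun μ x => by
    rw [show I * μ * x = ((μ * x : ℝ) : ℂ) * I by push_cast; ring, norm_exp_ofReal_mul_I]
  refine ae_eq_zero_of_integral_mul_eq_zero hf
    {g | ∃ μ : ℝ, ∀ x : ℝ, g x = cexp (I * μ * x)} ⟨0, by simp⟩ ?_ ?_ ?_ ?_
  · rintro g ⟨μ, hg⟩ g' ⟨μ', hg'⟩
    refine ⟨μ + μ', fun x => ?_⟩
    rw [BoundedContinuousFunction.mul_apply, hg, hg', ← Complex.exp_add]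
    push_cast; ring_nf
  · rintro g ⟨μ, hg⟩
    refine ⟨-μ, fun x => ?_⟩
    rw [BoundedContinuousFunction.star_apply, hg, RCLike.star_def, ← Complex.exp_conj]
    simp
  · intro x y hxy
    -- The frequency π/(y - x) makes the values at x and y opposite.
    refine ⟨BoundedContinuousFunction.ofNormedAddCommGroup (fun u : ℝ => cexp (I *
      ((Real.pi / (y - x) : ℝ) : ℂ) * u)) (by fun_prop) 1 fun u => (hn _ _).le, ⟨_, fun u => rfl⟩, ?_⟩
    simp only [BoundedContinuousFunction.coe_ofNormedAddCommGroup]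
    have hyx : (y : ℂ) - x ≠ 0 := by exact_mod_cast sub_ne_zero.2 hxy.symm
    have e : I * ((Real.pi / (y - x) : ℝ) : ℂ) * y = I * ((Real.pi / (y - x) : ℝ) : ℂ) * x +
        Real.pi * I := by
      push_cast; field_simp; ring
    rw [e, Complex.exp_add, exp_pi_mul_I]
    intro h
    have := Complex.exp_ne_zero (I * ((Real.pi / (y - x) : ℝ) : ℂ) * x)
    apply this
    linear_combination (1 / 2 : ℂ) * h
  · rintro g ⟨μ, hg⟩
    simp only [hg]
    exact h μ

/-- Uniqueness of the Laplace transform on a half-line. -/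
theorem ae_eq_zero_of_laplace_eq_zero {f : ℝ → ℂ} {α₀ : ℝ}
    (hf : ∀ α : ℝ, α₀ < α → IntegrableOn (fun s : ℝ => cexp (-(α * s)) * f s) (Set.Ioi 0))
    (h : ∀ α : ℝ, α₀ < α → ∫ s in Set.Ioi (0 : ℝ), cexp (-(α * s)) * f s = 0) :
    f =ᵐ[volume.restrict (Set.Ioi 0)] 0 := by
  have key : ∀ u : ℝ → ℝ,
      (∀ α : ℝ, α₀ < α → IntegrableOn (fun s : ℝ => Real.exp (-(α * s)) * u s) (Set.Ioi 0)) →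
      (∀ α : ℝ, α₀ < α → ∫ s in Set.Ioi (0 : ℝ), Real.exp (-(α * s)) * u s = 0) →
      u =ᵐ[volume.restrict (Set.Ioi 0)] 0 := by
    intro u hu hu0
    -- The weight e^{-(α₀+1)s} makes u integrable. Powers of e^{-s} then correspond to α = α₀ + 1 +
    -- n, so integer-spaced values of α already determine u.
    have h1 := ae_eq_zero_of_integral_mul_eq_zero (hu (α₀ + 1) (by linarith))
      {g | ∃ n : ℕ, ∀ x : ℝ, g x = (expDecay x : ℂ) ^ n} ⟨0, by simp⟩ ?_ ?_ ?_ ?_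
    · filter_upwards [h1] with s hs
      exact (mul_eq_zero.1 hs).resolve_left (Real.exp_pos _).ne'
    · rintro g ⟨m, hg⟩ g' ⟨m', hg'⟩
      exact ⟨m + m', fun x => by rw [BoundedContinuousFunction.mul_apply, hg, hg', pow_add]⟩
    · rintro g ⟨m, hg⟩
      exact ⟨m, fun x => by
        rw [BoundedContinuousFunction.star_apply, hg, RCLike.star_def, map_pow, conj_ofReal]⟩
    · intro x y hxy
      refine ⟨BoundedContinuousFunction.ofNormedAddCommGroup (fun u : ℝ => (expDecay u : ℂ))
        (continuous_ofReal.comp continuous_expDecay) 2 fun u => by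
          rw [norm_real]; exact abs_expDecay_le u, ⟨1, fun u => by simp⟩, ?_⟩
      simp only [BoundedContinuousFunction.coe_ofNormedAddCommGroup]
      exact fun h => hxy (expDecay_injective (ofReal_injective h))
    · rintro g ⟨n, hg⟩
      have h2 := hu0 (α₀ + 1 + n) (by have : (0 : ℝ) ≤ n := by positivity
                                      linarith)
      have h3 : Set.EqOn (fun x : ℝ => ((Real.exp (-((α₀ + 1) * x)) * u x : ℝ) : ℂ) * g x)
          (fun x : ℝ => ((Real.exp (-((α₀ + 1 + n) * x)) * u x : ℝ) : ℂ)) (Set.Ioi 0) := by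
        intro x hx
        simp only
        rw [hg, expDecay_of_nonneg (le_of_lt hx), ← ofReal_pow, ← ofReal_mul, ← Real.exp_nat_mul,
          mul_right_comm, ← Real.exp_add]
        ring_nf
      rw [setIntegral_congr_fun measurableSet_Ioi h3, integral_complex_ofReal, h2, ofReal_zero]
  have e : ∀ α s : ℝ, cexp (-(α * s)) = ((Real.exp (-(α * s)) : ℝ) : ℂ) := by
    intro α s; push_cast; rfl
  have hre := key (fun s => (f s).re)
    (fun α hα => (hf α hα).re.congr (ae_of_all _ fun s => by simp [e, -ofReal_exp]))
    (fun α hα => by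
      have h1 := congrArg Complex.re (h α hα)
      have h2 := integral_re (hf α hα)
      simp only [RCLike.re_eq_complex_re] at h2
      rw [← h2] at h1
      simpa [e, -ofReal_exp] using h1)
  have him := key (fun s => (f s).im)
    (fun α hα => (hf α hα).im.congr (ae_of_all _ fun s => by simp [e, -ofReal_exp]))
    (fun α hα => by
      have h1 := congrArg Complex.im (h α hα)
      have h2 := integral_im (hf α hα)
      simp only [RCLike.im_eq_complex_im] at h2
      rw [← h2] at h1
      simpa [e, -ofReal_exp] using h1)
  filter_upwards [hre, him] with s h1 h2
  exact Complex.ext h1 h2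

/-- Uniqueness of the Laplace–Laplace–Fourier transform. -/
theorem ae_eq_zero_of_laplace_fourier_eq_zero {f : ℝ × ℝ × ℝ → ℝ}
    (hsupp : ∀ z, ¬ (0 ≤ z.1 ∧ 0 ≤ z.2.1) → f z = 0)
    (hf : ∀ lam : ℝ, 0 < lam → Integrable fun z => Real.exp (-(lam * z.1)) * f z)
    (h : ∀ lam μ ν : ℝ, 0 < lam → 0 < ν →
      ∫ z : ℝ × ℝ × ℝ, cexp (-(lam * z.1) + I * μ * z.2.2 - ν * z.2.1) * f z = 0) :
    f =ᵐ[volume] 0 := by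
  have hn : ∀ μ x : ℝ, ‖cexp (I * μ * x)‖ = 1 := fun μ x => by
    rw [show I * μ * x = ((μ * x : ℝ) : ℂ) * I by push_cast; ring, norm_exp_ofReal_mul_I]
  have hpow : ∀ (n : ℕ) (t : ℝ), ‖(expDecay t : ℂ) ^ n‖ ≤ 2 ^ n := fun n t => by
    rw [norm_pow, norm_real]
    have := abs_expDecay_le t
    gcongr
    exact this
  have hc := continuous_expDecay
  have hint : Integrable fun z : ℝ × ℝ × ℝ => Real.exp (-z.1 - z.2.1) * f z := by
    have h1 := hf 1 one_pos
    have h2 : Integrable fun z : ℝ × ℝ × ℝ => (Real.exp (-(1 * z.1)) * f z) *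
        Real.exp (-max z.2.1 0) := by
      refine h1.mul_bdd (c := 1) (by fun_prop : Continuous fun z : ℝ × ℝ × ℝ =>
        Real.exp (-max z.2.1 0)).aestronglyMeasurable (ae_of_all _ fun z => ?_)
      rw [Real.norm_of_nonneg (Real.exp_pos _).le, Real.exp_le_one_iff]
      simp
    refine h2.congr (ae_of_all _ fun z => ?_)
    simp only
    by_cases hz : 0 ≤ z.1 ∧ 0 ≤ z.2.1
    · rw [max_eq_left hz.2, mul_right_comm, ← Real.exp_add]; ring_nf
    · rw [hsupp z hz]; simp
  have h1 := ae_eq_zero_of_integral_mul_eq_zero hint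
    {g | ∃ (m n : ℕ) (μ : ℝ), ∀ z : ℝ × ℝ × ℝ, g z = (expDecay z.1 : ℂ) ^ m *
      (expDecay z.2.1 : ℂ) ^ n * cexp (I * μ * z.2.2)} ⟨0, 0, 0, by simp⟩ ?_ ?_ ?_ ?_
  · filter_upwards [h1] with s hs
    exact (mul_eq_zero.1 hs).resolve_left (Real.exp_pos _).ne'
  · rintro g ⟨m, n, μ, hg⟩ g' ⟨m', n', μ', hg'⟩
    refine ⟨m + m', n + n', μ + μ', fun x => ?_⟩
    rw [BoundedContinuousFunction.mul_apply, hg, hg', pow_add, pow_add]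
    push_cast
    rw [mul_add, add_mul, Complex.exp_add]
    ring
  · rintro g ⟨m, n, μ, hg⟩
    refine ⟨m, n, -μ, fun x => ?_⟩
    rw [BoundedContinuousFunction.star_apply, hg, RCLike.star_def, map_mul, map_mul, map_pow,
      map_pow, conj_ofReal, conj_ofReal, ← Complex.exp_conj]
    simp
  · have hmem : ∀ (m n : ℕ) (μ : ℝ), ∃ g : ℝ × ℝ × ℝ →ᵇ ℂ, ∀ z, g z = (expDecay z.1 : ℂ) ^ m *
        (expDecay z.2.1 : ℂ) ^ n * cexp (I * μ * z.2.2) := fun m n μ =>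
      ⟨BoundedContinuousFunction.ofNormedAddCommGroup (fun z : ℝ × ℝ × ℝ => (expDecay z.1 : ℂ) ^ m *
        (expDecay z.2.1 : ℂ) ^ n * cexp (I * μ * z.2.2)) (by fun_prop) (2 ^ m * 2 ^ n) fun z => by
          rw [norm_mul, norm_mul, hn, mul_one]
          have := hpow m z.1
          have := hpow n z.2.1
          gcongr, fun z => rfl⟩
    intro x y hxy
    by_cases h1 : x.1 = y.1
    · by_cases h2 : x.2.1 = y.2.1
      · have h3 : x.2.2 ≠ y.2.2 := fun h3 => hxy (Prod.ext h1 (Prod.ext h2 h3))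
        obtain ⟨g, hg⟩ := hmem 0 0 (Real.pi / (y.2.2 - x.2.2))
        refine ⟨g, ⟨_, _, _, hg⟩, ?_⟩
        rw [hg, hg]
        simp only [pow_zero, one_mul]
        have hyx : (y.2.2 : ℂ) - x.2.2 ≠ 0 := by exact_mod_cast sub_ne_zero.2 h3.symm
        have e : I * ((Real.pi / (y.2.2 - x.2.2) : ℝ) : ℂ) * y.2.2 =
            I * ((Real.pi / (y.2.2 - x.2.2) : ℝ) : ℂ) * x.2.2 + Real.pi * I := by
          push_cast; field_simp; ring
        rw [e, Complex.exp_add, exp_pi_mul_I]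
        intro h
        apply Complex.exp_ne_zero (I * ((Real.pi / (y.2.2 - x.2.2) : ℝ) : ℂ) * x.2.2)
        linear_combination (1 / 2 : ℂ) * h
      · obtain ⟨g, hg⟩ := hmem 0 1 0
        refine ⟨g, ⟨_, _, _, hg⟩, ?_⟩
        rw [hg, hg]
        simpa using fun h => h2 (expDecay_injective h)
    · obtain ⟨g, hg⟩ := hmem 1 0 0
      refine ⟨g, ⟨_, _, _, hg⟩, ?_⟩
      rw [hg, hg]
      simpa using fun h => h1 (expDecay_injective h)
  · rintro g ⟨m, n, μ, hg⟩
    rw [← h (1 + m) μ (1 + n) (by positivity) (by positivity)]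
    congr 1
    ext z
    by_cases hz : 0 ≤ z.1 ∧ 0 ≤ z.2.1
    · rw [hg, expDecay_of_nonneg hz.1, expDecay_of_nonneg hz.2]
      have : cexp (-((1 + m : ℝ) * z.1) + I * μ * z.2.2 - (1 + n : ℝ) * z.2.1) =
          (Real.exp (-z.1 - z.2.1) : ℝ) * ((Real.exp (-z.1) : ℝ) ^ m * (Real.exp (-z.2.1) : ℝ) ^ n *
            cexp (I * μ * z.2.2)) := by
        push_cast
        rw [← Complex.exp_nat_mul, ← Complex.exp_nat_mul, ← Complex.exp_add, ← Complex.exp_add,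
          ← Complex.exp_add]
        ring_nf
      rw [this]; push_cast; ring
    · rw [hsupp z hz]; simp

end PseudoProcess

namespace PseudoProcess

/-! ### Convolutions with endpoint singularities and the Mittag-Leffler function -/

lemma intervalIntegrable_rpow_mul_one_sub_rpow {p q : ℝ} (hp : -1 < p) (hp0 : p ≤ 0) (hq : -1 < q)
    (hq0 : q ≤ 0) : IntervalIntegrable (fun u : ℝ => u ^ p * (1 - u) ^ q) volume 0 1 := by
  have h1 : IntervalIntegrable (fun u : ℝ => u ^ p) volume 0 1 :=
    intervalIntegral.intervalIntegrable_rpow' hp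
  have h2 : IntervalIntegrable (fun u : ℝ => (1 - u) ^ q) volume 0 1 := by
    have := (intervalIntegral.intervalIntegrable_rpow' (a := 0) (b := 1) hq).comp_sub_left 1
    simpa using this.symm
  have h3 := (h1.const_mul ((1 / 2) ^ q)).add (h2.const_mul ((1 / 2) ^ p))
  refine h3.mono_fun' (by fun_prop) ?_
  rw [Set.uIoc_of_le zero_le_one, ← Measure.restrict_congr_set Ioo_ae_eq_Ioc]
  refine (ae_restrict_mem measurableSet_Ioo).mono fun u hu => ?_
  have hu0 : 0 < u := hu.1
  have hu1 : 0 < 1 - u := by linarith [hu.2]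
  simp only
  rw [Real.norm_of_nonneg (by positivity)]
  rcases le_total u (1 / 2) with h | h
  · have h4 : (1 - u) ^ q ≤ (1 / 2) ^ q :=
      Real.rpow_le_rpow_of_nonpos (by norm_num) (by linarith) hq0
    have h5 : 0 ≤ (1 / 2 : ℝ) ^ p * (1 - u) ^ q := by positivity
    calc _ ≤ u ^ p * (1 / 2) ^ q := by gcongr
      _ = (1 / 2) ^ q * u ^ p := mul_comm _ _
      _ ≤ _ := le_add_of_nonneg_right h5
  · have h4 : u ^ p ≤ (1 / 2) ^ p :=
      Real.rpow_le_rpow_of_nonpos (by norm_num) h hp0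
    have h5 : 0 ≤ (1 / 2 : ℝ) ^ q * u ^ p := by positivity
    calc _ ≤ (1 / 2) ^ p * (1 - u) ^ q := by gcongr
      _ ≤ _ := le_add_of_nonneg_left h5

/-- A convolution over `(0, s)` of two functions with integrable singularities at `0` is absolutely
convergent and depends continuously on `s > 0`. -/
theorem continuousOn_singular_convolution {A B : ℝ → ℂ} {p q : ℝ} (hp : -1 < p) (hp0 : p ≤ 0)
    (hq : -1 < q) (hq0 : q ≤ 0) (hA : ContinuousOn A (Set.Ioi 0)) (hB : ContinuousOn B (Set.Ioi 0))
    (bA : ∀ S : ℝ, 0 < S → ∃ C : ℝ, 0 ≤ C ∧ ∀ σ : ℝ, 0 < σ → σ ≤ S → ‖A σ‖ ≤ C * σ ^ p)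
    (bB : ∀ S : ℝ, 0 < S → ∃ C : ℝ, 0 ≤ C ∧ ∀ σ : ℝ, 0 < σ → σ ≤ S → ‖B σ‖ ≤ C * σ ^ q) :
    (∀ s : ℝ, 0 < s → IntervalIntegrable (fun σ => A σ * B (s - σ)) volume 0 s) ∧
    ContinuousOn (fun s : ℝ => ∫ σ in (0 : ℝ)..s, A σ * B (s - σ)) (Set.Ioi 0) := by
  have hbase := intervalIntegrable_rpow_mul_one_sub_rpow hp hp0 hq hq0
  have hmeas : ∀ s : ℝ, 0 < s → AEStronglyMeasurable (fun u : ℝ => A (s * u) * B (s - s * u))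
      (volume.restrict (Set.uIoc 0 1)) := by
    intro s hs
    rw [Set.uIoc_of_le zero_le_one, ← Measure.restrict_congr_set Ioo_ae_eq_Ioc]
    refine ContinuousOn.aestronglyMeasurable ?_ measurableSet_Ioo
    refine ContinuousOn.mul (hA.comp (by fun_prop) fun u hu => ?_)
      (hB.comp (by fun_prop) fun u hu => ?_)
    · exact mul_pos hs hu.1
    · have : s * u < s * 1 := mul_lt_mul_of_pos_left hu.2 hs
      simp only [Set.mem_Ioi]
      linarith
  -- After rescaling σ = su the interval is fixed and the integrand is dominated by a multiple of
  -- the Beta integrand u^p(1-u)^q. The multiple is uniform for s in [s₀/2, 2s₀] because p, q ≤ 0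
  -- makes s^p and s^q decreasing.
  have hbound : ∀ s₀ : ℝ, 0 < s₀ → ∃ K : ℝ, ∀ s : ℝ, s₀ / 2 ≤ s → s ≤ 2 * s₀ → ∀ᵐ u : ℝ,
      u ∈ Set.uIoc (0 : ℝ) 1 → ‖A (s * u) * B (s - s * u)‖ ≤ K * (u ^ p * (1 - u) ^ q) := by
    intro s₀ hs₀
    obtain ⟨CA, hCA0, hCA⟩ := bA (2 * s₀) (by positivity)
    obtain ⟨CB, hCB0, hCB⟩ := bB (2 * s₀) (by positivity)
    refine ⟨CA * (s₀ / 2) ^ p * (CB * (s₀ / 2) ^ q), fun s h1 h2 => ?_⟩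
    have hs : 0 < s := by linarith
    have hne : ∀ᵐ u : ℝ, u ≠ 1 := by simp [ae_iff]
    filter_upwards [hne] with u hu1 hu
    rw [Set.uIoc_of_le zero_le_one] at hu
    have hu0 := hu.1
    have hu2 : 0 < 1 - u := by
      have := lt_of_le_of_ne hu.2 hu1
      linarith
    have hle : s * u ≤ 2 * s₀ := by nlinarith [hu.2]
    have e : s - s * u = s * (1 - u) := by ring
    have hle2 : s * (1 - u) ≤ 2 * s₀ := by nlinarith
    have k1 := hCA (s * u) (by positivity) hle
    have k2 := hCB (s * (1 - u)) (by positivity) hle2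
    have k3 : s ^ p ≤ (s₀ / 2) ^ p := Real.rpow_le_rpow_of_nonpos (by positivity) h1 hp0
    have k4 : s ^ q ≤ (s₀ / 2) ^ q := Real.rpow_le_rpow_of_nonpos (by positivity) h1 hq0
    rw [e, norm_mul]
    rw [Real.mul_rpow hs.le hu0.le] at k1
    rw [Real.mul_rpow hs.le hu2.le] at k2
    calc _ ≤ (CA * (s ^ p * u ^ p)) * (CB * (s ^ q * (1 - u) ^ q)) := by gcongr
      _ ≤ (CA * ((s₀ / 2) ^ p * u ^ p)) * (CB * ((s₀ / 2) ^ q * (1 - u) ^ q)) := by gcongr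
      _ = _ := by ring
  constructor
  · intro s hs
    obtain ⟨K, hK⟩ := hbound s hs
    have h1 : IntervalIntegrable (fun u : ℝ => A (s * u) * B (s - s * u)) volume 0 1 := by
      refine (hbase.const_mul K).mono_fun' (hmeas s hs) ?_
      rw [Filter.EventuallyLE, ae_restrict_iff' measurableSet_uIoc]
      exact hK s (by linarith) (by linarith)
    have h2 := (IntervalIntegrable.comp_mul_left_iff (f := fun σ => A σ * B (s - σ)) (a := 0) (b := s)
      hs.ne').1
    rw [zero_div, div_self hs.ne'] at h2
    exact h2 h1
  · have e : Set.EqOn (fun s : ℝ => ∫ σ in (0 : ℝ)..s, A σ * B (s - σ))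
        (fun s : ℝ => s • ∫ u in (0 : ℝ)..1, A (s * u) * B (s - s * u)) (Set.Ioi 0) := by
      intro s _
      simp only
      rw [intervalIntegral.smul_integral_comp_mul_left (fun σ => A σ * B (s - σ))]
      simp
    refine ContinuousOn.congr ?_ e
    intro s₀ hs₀
    have hs₀' : (0 : ℝ) < s₀ := hs₀
    obtain ⟨K, hK⟩ := hbound s₀ hs₀
    refine ContinuousAt.continuousWithinAt (continuousAt_id.smul ?_)
    have hnear : ∀ᶠ s in 𝓝 s₀, s₀ / 2 < s ∧ s < 2 * s₀ :=
      (lt_mem_nhds (by linarith)).and (gt_mem_nhds (by linarith))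
    refine intervalIntegral.continuousAt_of_dominated_interval
      (bound := fun u => K * (u ^ p * (1 - u) ^ q)) ?_ ?_ (hbase.const_mul K) ?_
    · filter_upwards [hnear] with s hs
      exact hmeas s (by linarith [hs.1])
    · filter_upwards [hnear] with s hs
      exact hK s hs.1.le hs.2.le
    · have hne : ∀ᵐ u : ℝ, u ≠ 1 := by simp [ae_iff]
      filter_upwards [hne] with u hu1 hu
      rw [Set.uIoc_of_le zero_le_one] at hu
      have hu2 : 0 < 1 - u := by
        have := lt_of_le_of_ne hu.2 hu1
        linarith
      have c1 : ContinuousAt A (s₀ * u) := hA.continuousAt (Ioi_mem_nhds (mul_pos hs₀ hu.1))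
      have c2 : ContinuousAt B (s₀ - s₀ * u) := hB.continuousAt (Ioi_mem_nhds (by nlinarith))
      exact (ContinuousAt.comp (f := fun s : ℝ => s * u) c1 (by fun_prop)).mul
        (ContinuousAt.comp (f := fun s : ℝ => s - s * u) c2 (by fun_prop))

/-! ### The Mittag-Leffler function: growth and Laplace transform. -/

lemma Gamma_arg_pos {N : ℕ} (hN : 1 ≤ N) (r : ℕ) : 0 < Real.Gamma (1 / N * r + 1 / N) := by
  have : (0 : ℝ) < N := by exact_mod_cast hN
  apply Real.Gamma_pos_of_pos
  positivity

/-- 2^{-p}Γ(p) = ∫ t^{p-1}e^{-2t} dt is at least its part over (σ, σ+1]. The rate 2 supplies the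
factor 2^{-p}, and σ is free: together they show that Γ outgrows any geometric sequence. -/
lemma rpow_sub_one_le_Gamma {p σ : ℝ} (hp : 1 ≤ p) (hσ : 0 < σ) :
    σ ^ (p - 1) * Real.exp (-(2 * (σ + 1))) ≤ (1 / 2) ^ p * Real.Gamma p := by
  have h := Real.integral_rpow_mul_exp_neg_mul_Ioi (a := p) (r := 2) (by linarith) (by norm_num)
  rw [← h]
  have hint : IntegrableOn (fun t : ℝ => t ^ (p - 1) * Real.exp (-(2 * t))) (Set.Ioi 0) := by
    have := integrableOn_rpow_mul_exp_neg_mul_rpow (p := 1) (s := p - 1) (b := 2) (by linarith)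
      one_pos (by norm_num)
    simpa only [Real.rpow_one, neg_mul] using this
  have h1 : ∫ t in Set.Ioc σ (σ + 1), σ ^ (p - 1) * Real.exp (-(2 * (σ + 1))) ≤
      ∫ t in Set.Ioc σ (σ + 1), t ^ (p - 1) * Real.exp (-(2 * t)) := by
    refine setIntegral_mono_on (continuous_const.integrableOn_Ioc) (hint.mono_set fun t ht => hσ.trans ht.1)
      measurableSet_Ioc fun t ht => ?_
    have h2 : σ ^ (p - 1) ≤ t ^ (p - 1) := Real.rpow_le_rpow hσ.le ht.1.le (by linarith)
    have h3 : Real.exp (-(2 * (σ + 1))) ≤ Real.exp (-(2 * t)) :=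
      Real.exp_le_exp.2 (by linarith [ht.2])
    have h5 : 0 < t := hσ.trans ht.1
    gcongr
  have h4 : ∫ t in Set.Ioc σ (σ + 1), t ^ (p - 1) * Real.exp (-(2 * t)) ≤
      ∫ t in Set.Ioi (0 : ℝ), t ^ (p - 1) * Real.exp (-(2 * t)) := by
    refine setIntegral_mono_set hint ?_ (Eventually.of_forall fun t ht => hσ.trans ht.1)
    refine (ae_restrict_mem measurableSet_Ioi).mono fun t ht => ?_
    have : (0 : ℝ) < t := ht
    simp only [Pi.zero_apply]
    positivity
  refine le_trans (le_of_eq ?_) (h1.trans h4)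
  simp

lemma summable_mittagLeffler {N : ℕ} (hN : 1 ≤ N) {y : ℝ} (hy : 0 ≤ y) :
    Summable fun r : ℕ => y ^ r / Real.Gamma (1 / N * r + 1 / N) := by
  have hN0 : (0 : ℝ) < N := by exact_mod_cast hN
  set z := max y 1 with hz
  have hz1 : 1 ≤ z := le_max_right _ _
  -- With this σ one has σ^{r/N} = z^r, so the lower bound for Γ absorbs y^r and leaves a geometric
  -- series of ratio w = 2^{-1/N}. The bound needs r/N + 1/N ≥ 1, whence r ≥ N below.
  set σ := z ^ N with hσ
  have hσ1 : 1 ≤ σ := one_le_pow₀ hz1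
  set w : ℝ := (1 / 2) ^ (1 / N : ℝ) with hw
  have hw0 : 0 ≤ w := by positivity
  have hw1 : w < 1 := Real.rpow_lt_one (by norm_num) (by norm_num) (by positivity)
  refine Summable.of_norm_bounded_eventually_nat
    (g := fun r => σ * Real.exp (2 * (σ + 1)) * w * w ^ r)
    ((summable_geometric_of_lt_one hw0 hw1).mul_left _) ?_
  filter_upwards [eventually_ge_atTop N] with r hr
  have hG := Gamma_arg_pos hN r
  rw [Real.norm_of_nonneg (by positivity), div_le_iff₀ hG]
  have hp : (1 : ℝ) ≤ 1 / N * r + 1 / N := by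
    have : (N : ℝ) ≤ r := by exact_mod_cast hr
    rw [div_mul_eq_mul_div, one_mul, ← add_div, le_div_iff₀ hN0]
    linarith
  have h1 := rpow_sub_one_le_Gamma hp (lt_of_lt_of_le one_pos hσ1)
  have h2 : ((1 : ℝ) / 2) ^ (1 / N * r + 1 / N : ℝ) = w * w ^ r := by
    rw [Real.rpow_add (by norm_num), Real.rpow_mul (by norm_num), Real.rpow_natCast, mul_comm]
  have h3 : y ^ r ≤ σ * σ ^ (1 / N * r + 1 / N - 1 : ℝ) := by
    have e1 : σ ^ (1 / N * r : ℝ) = z ^ r := by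
      rw [Real.rpow_mul (by positivity), hσ, one_div,
        Real.pow_rpow_inv_natCast (by positivity) (by omega), Real.rpow_natCast]
    have e2 : σ * σ ^ (1 / N * r + 1 / N - 1 : ℝ) = σ ^ (1 / N * r + 1 / N : ℝ) := by
      rw [Real.rpow_sub_one (by positivity)]; field_simp
    rw [e2]
    calc y ^ r ≤ z ^ r := by gcongr; exact le_max_left _ _
      _ = σ ^ (1 / N * r : ℝ) := e1.symm
      _ ≤ _ := Real.rpow_le_rpow_of_exponent_le hσ1 (by
          have : (0 : ℝ) ≤ 1 / N := by positivity
          linarith)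
  rw [h2] at h1
  have h4 : σ ^ (1 / N * r + 1 / N - 1 : ℝ) ≤ w * w ^ r * Real.Gamma (1 / N * r + 1 / N) *
      Real.exp (2 * (σ + 1)) := by
    rwa [Real.exp_neg, ← div_eq_mul_inv, div_le_iff₀ (Real.exp_pos _)] at h1
  calc y ^ r ≤ σ * σ ^ (1 / N * r + 1 / N - 1 : ℝ) := h3
    _ ≤ σ * (w * w ^ r * Real.Gamma (1 / N * r + 1 / N) * Real.exp (2 * (σ + 1))) := by gcongr
    _ = _ := by ring

lemma continuous_mittagLeffler {N : ℕ} (hN : 1 ≤ N) : Continuous (mittagLeffler (1 / N) (1 / N)) := by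
  rw [continuous_iff_continuousAt]
  intro ξ
  have h : ContinuousOn (mittagLeffler (1 / N) (1 / N)) (Metric.closedBall 0 (‖ξ‖ + 1)) := by
    unfold mittagLeffler
    refine continuousOn_tsum (fun r => by fun_prop)
      (summable_mittagLeffler hN (y := ‖ξ‖ + 1) (by positivity)) fun r x hx => ?_
    have hG := Gamma_arg_pos hN r
    rw [norm_div, norm_pow, norm_real, Real.norm_of_nonneg hG.le]
    have : ‖x‖ ≤ ‖ξ‖ + 1 := by simpa using hx
    gcongr
  refine h.continuousAt (mem_of_superset (Metric.ball_mem_nhds ξ one_pos) fun x hx => ?_)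
  have h1 : ‖x - ξ‖ < 1 := by simpa [dist_eq_norm] using hx
  have h2 := norm_sub_norm_le x ξ
  simp only [mem_closedBall_zero_iff]
  linarith

/-- The first factor of the convolution. -/
noncomputable def mittagKernel (N : ℕ) (c : ℂ) (lam σ : ℝ) : ℂ :=
  ((σ ^ ((1 : ℝ) / N - 1) : ℝ) : ℂ) *
    mittagLeffler (1 / N) (1 / N) (c * (((lam * σ) ^ ((1 : ℝ) / N) : ℝ) : ℂ))

lemma continuousOn_mittagKernel {N : ℕ} (hN : 1 ≤ N) (c : ℂ) (lam : ℝ) :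
    ContinuousOn (mittagKernel N c lam) (Set.Ioi 0) := by
  have h1 : ContinuousOn (fun σ : ℝ => σ ^ ((1 : ℝ) / N - 1)) (Set.Ioi 0) := fun σ hσ =>
    (Real.continuousAt_rpow_const σ _ (Or.inl (ne_of_gt hσ))).continuousWithinAt
  have h2 : Continuous fun σ : ℝ => (lam * σ) ^ ((1 : ℝ) / N) :=
    (continuous_const.mul continuous_id).rpow_const fun _ => Or.inr (by positivity)
  exact (continuous_ofReal.comp_continuousOn h1).mul ((continuous_mittagLeffler hN).comp
    (continuous_const.mul (continuous_ofReal.comp h2))).continuousOn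

lemma mittagKernel_bound {N : ℕ} (hN : 1 ≤ N) (c : ℂ) (lam : ℝ) (S : ℝ) (_ : 0 < S) :
    ∃ C : ℝ, 0 ≤ C ∧ ∀ σ : ℝ, 0 < σ → σ ≤ S →
      ‖mittagKernel N c lam σ‖ ≤ C * σ ^ ((1 : ℝ) / N - 1) := by
  have h2 : Continuous fun σ : ℝ => mittagLeffler (1 / N) (1 / N)
      (c * (((lam * σ) ^ ((1 : ℝ) / N) : ℝ) : ℂ)) :=
    (continuous_mittagLeffler hN).comp (continuous_const.mul (continuous_ofReal.comp
      ((continuous_const.mul continuous_id).rpow_const fun _ => Or.inr (by positivity))))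
  obtain ⟨C, hC⟩ := (isCompact_Icc (a := (0 : ℝ)) (b := S)).exists_bound_of_continuousOn
    h2.continuousOn
  refine ⟨max C 0, le_max_right _ _, fun σ h0 h1 => ?_⟩
  rw [mittagKernel, norm_mul, norm_real, Real.norm_of_nonneg (by positivity), mul_comm]
  have := (hC σ ⟨h0.le, h1⟩).trans (le_max_left C 0)
  gcongr

/-- Integrating term by term, the Gamma factors cancel and the geometric series a⁻¹ ∑ (cb/a)^r
remains. It converges because |c| = 1 and b < a. Knowing the transform only for a > b is enough for
`ae_eq_zero_of_laplace_eq_zero`. -/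
theorem laplace_mittagKernel {N : ℕ} (hN : 1 ≤ N) {c : ℂ} (hc : ‖c‖ = 1) {a b : ℝ} (hb : 0 < b)
    (hab : b < a) :
    IntegrableOn (fun σ : ℝ => cexp (-((a ^ N : ℝ) * σ)) * mittagKernel N c (b ^ N) σ) (Set.Ioi 0) ∧
    ∫ σ in Set.Ioi (0 : ℝ), cexp (-((a ^ N : ℝ) * σ)) * mittagKernel N c (b ^ N) σ =
      (a - c * b)⁻¹ := by
  have hN0 : (0 : ℝ) < N := by exact_mod_cast hN
  have ha : 0 < a := hb.trans hab
  set F : ℕ → ℝ → ℂ := fun r σ => ((c * b) ^ r / (Real.Gamma (1 / N * r + 1 / N) : ℂ)) *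
    ((σ ^ ((1 / N * r + 1 / N : ℝ) - 1) * Real.exp (-(a ^ N * σ)) : ℝ) : ℂ) with hF
  have hp : ∀ r : ℕ, (0 : ℝ) < 1 / N * r + 1 / N := fun r => by positivity
  have hI : ∀ r : ℕ, ∫ σ in Set.Ioi (0 : ℝ), σ ^ ((1 / N * r + 1 / N : ℝ) - 1) *
      Real.exp (-(a ^ N * σ)) = (a⁻¹) ^ (r + 1) * Real.Gamma (1 / N * r + 1 / N) := by
    intro r
    rw [Real.integral_rpow_mul_exp_neg_mul_Ioi (hp r) (by positivity)]
    congr 1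
    rw [one_div, ← inv_pow, show (1 / N * r + 1 / N : ℝ) = (N : ℝ)⁻¹ * ((r + 1 : ℕ) : ℝ) by
      push_cast; field_simp, Real.rpow_mul (by positivity),
      Real.pow_rpow_inv_natCast (by positivity) (by omega), Real.rpow_natCast]
  have hIi : ∀ r : ℕ, IntegrableOn (fun σ : ℝ => σ ^ ((1 / N * r + 1 / N : ℝ) - 1) *
      Real.exp (-(a ^ N * σ))) (Set.Ioi 0) := by
    intro r
    have := integrableOn_rpow_mul_exp_neg_mul_rpow (p := 1) (s := (1 / N * r + 1 / N : ℝ) - 1)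
      (b := a ^ N) (by linarith [hp r]) one_pos (by positivity)
    simpa only [Real.rpow_one, neg_mul] using this
  have hFi : ∀ r, Integrable (F r) (volume.restrict (Set.Ioi 0)) := fun r =>
    ((hIi r).ofReal).const_mul _
  have hFint : ∀ r, ∫ σ in Set.Ioi (0 : ℝ), F r σ = (a : ℂ)⁻¹ * (c * b / a) ^ r := by
    intro r
    have hG : (Real.Gamma (1 / N * r + 1 / N) : ℂ) ≠ 0 := by
      exact_mod_cast (Gamma_arg_pos hN r).ne'
    simp only [hF]
    rw [integral_const_mul, integral_complex_ofReal, hI r]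
    push_cast
    generalize (Real.Gamma (1 / N * r + 1 / N) : ℂ) = G at hG
    have ha' : (a : ℂ) ≠ 0 := by exact_mod_cast ha.ne'
    rw [pow_succ, inv_pow, div_pow]
    field_simp
  have hFnorm : ∀ r, ∫ σ in Set.Ioi (0 : ℝ), ‖F r σ‖ = a⁻¹ * (b / a) ^ r := by
    intro r
    have hG := Gamma_arg_pos hN r
    have e : Set.EqOn (fun σ => ‖F r σ‖) (fun σ => b ^ r / Real.Gamma (1 / N * r + 1 / N) *
        (σ ^ ((1 / N * r + 1 / N : ℝ) - 1) * Real.exp (-(a ^ N * σ)))) (Set.Ioi 0) := by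
      intro σ hσ
      have hσ' : (0 : ℝ) < σ := hσ
      simp only [hF]
      rw [norm_mul, norm_div, norm_pow, norm_mul, hc, one_mul, norm_real, norm_real, norm_real,
        Real.norm_of_nonneg hb.le, Real.norm_of_nonneg hG.le, Real.norm_of_nonneg (by positivity)]
    rw [setIntegral_congr_fun measurableSet_Ioi e, integral_const_mul, hI r]
    generalize Real.Gamma (1 / N * r + 1 / N) = G at hG
    rw [pow_succ, inv_pow, div_pow]
    field_simp
  have hsum : Summable fun r => ∫ σ in Set.Ioi (0 : ℝ), ‖F r σ‖ := by
    simp only [hFnorm]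
    exact (summable_geometric_of_lt_one (by positivity) (by rwa [div_lt_one ha])).mul_left _
  have hHS := hasSum_integral_of_summable_integral_norm hFi hsum
  have e : Set.EqOn (fun σ : ℝ => cexp (-((a ^ N : ℝ) * σ)) * mittagKernel N c (b ^ N) σ)
      (fun σ => ∑' r, F r σ) (Set.Ioi 0) := by
    intro σ hσ
    have hσ' : (0 : ℝ) < σ := hσ
    simp only [hF, mittagKernel, mittagLeffler]
    rw [← tsum_mul_left, ← tsum_mul_left]
    congr 1
    ext r
    have e1 : ((b ^ N * σ) ^ ((1 : ℝ) / N) : ℝ) = b * σ ^ ((1 : ℝ) / N) := by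
      rw [Real.mul_rpow (by positivity) hσ'.le, one_div, Real.pow_rpow_inv_natCast hb.le (by omega)]
    have e2 : (σ ^ ((1 / N * r + 1 / N : ℝ) - 1) : ℝ) = σ ^ ((1 : ℝ) / N - 1) *
        (σ ^ ((1 : ℝ) / N)) ^ r := by
      rw [← Real.rpow_natCast, ← Real.rpow_mul hσ'.le, ← Real.rpow_add hσ']; ring_nf
    rw [e1, e2]
    push_cast
    ring
  constructor
  · refine IntegrableOn.congr_fun ?_ e.symm measurableSet_Ioi
    have hm : AEStronglyMeasurable (fun σ => ∑' r, F r σ) (volume.restrict (Set.Ioi 0)) := by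
      refine AEStronglyMeasurable.congr (f := fun σ : ℝ => cexp (-((a ^ N : ℝ) * σ)) *
        mittagKernel N c (b ^ N) σ) ?_ ((ae_restrict_mem measurableSet_Ioi).mono e)
      refine ContinuousOn.aestronglyMeasurable ?_ measurableSet_Ioi
      exact ContinuousOn.mul (by fun_prop) (continuousOn_mittagKernel hN c _)
    refine ⟨hm, ?_⟩
    have h1 : ∫⁻ σ in Set.Ioi (0 : ℝ), ‖∑' r, F r σ‖ₑ ≤ ∫⁻ σ in Set.Ioi (0 : ℝ), ∑' r, ‖F r σ‖ₑ :=
      lintegral_mono fun σ => enorm_tsum_le_tsum_enorm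
    refine lt_of_le_of_lt h1 ?_
    rw [lintegral_tsum fun r => (hFi r).1.enorm]
    have h2 : ∀ r, ∫⁻ σ in Set.Ioi (0 : ℝ), ‖F r σ‖ₑ =
        ENNReal.ofReal (∫ σ in Set.Ioi (0 : ℝ), ‖F r σ‖) := fun r =>
      (ofReal_integral_norm_eq_lintegral_enorm (hFi r)).symm
    simp only [h2]
    exact hsum.tsum_ofReal_lt_top
  · rw [setIntegral_congr_fun measurableSet_Ioi e]
    simp only [hFint] at hHS
    have ha' : (a : ℂ) ≠ 0 := by exact_mod_cast ha.ne'
    have hq : ‖c * b / a‖ < 1 := by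
      rw [norm_div, norm_mul, hc, one_mul, norm_real, norm_real, Real.norm_of_nonneg hb.le,
        Real.norm_of_nonneg ha.le, div_lt_one ha]
      exact hab
    have h3 := (hasSum_geometric_of_norm_lt_one hq).mul_left (a : ℂ)⁻¹
    rw [hHS.unique h3, ← mul_inv]
    congr 1
    field_simp

end PseudoProcess

namespace PseudoProcess

/-! ### The convolution formula -/

/-- `∫_0^∞ I_θ(s; x + y) e^{-θ' b y} dy`. -/
noncomputable def kernelTail (M : ℕ) (θ θ' : ℂ) (b x s : ℝ) : ℂ :=
  ∫ y in Set.Ioi (0 : ℝ), kernelI (2 * M) (M - 1) θ s (x + y) * cexp (-(θ' * b * y))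

lemma norm_exp_neg_mul_le_one {M : ℕ} (hM : 1 ≤ M) {θ : ℂ} (hθ : θ ∈ rootsJ (2 * M)) {b y : ℝ}
    (hb : 0 < b) (hy : 0 ≤ y) : ‖cexp (-(θ * b * y))‖ ≤ 1 := by
  rw [Complex.norm_exp, Real.exp_le_one_iff, neg_re, mul_comm, re_ofReal_mul]
  have := re_mul_ofReal_pos hM hθ hb
  nlinarith

lemma norm_kernelTail_integrand_le {M : ℕ} (hM : 1 ≤ M) {θ θ' : ℂ} (hθ : θ ∈ rootsJ (2 * M))
    (hθ' : θ' ∈ rootsJ (2 * M)) {b x s y : ℝ} (hb : 0 < b) (hx : 0 ≤ x) (hs : 0 < s) (hy : 0 < y) :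
    ‖kernelI (2 * M) (M - 1) θ s (x + y) * cexp (-(θ' * b * y))‖ ≤ M * majorant M s y := by
  have h1 := norm_kernelI_le hM hθ hs (show 0 ≤ x + y by positivity)
  have h2 := majorant_anti hM hs le_rfl hy.le (show y ≤ x + y by linarith)
  have h3 := norm_exp_neg_mul_le_one hM hθ' hb hy.le
  have h4 := majorant_nonneg M s y
  rw [norm_mul]
  calc _ ≤ M * majorant M s (x + y) * 1 := by gcongr; exact (norm_nonneg _).trans h1
    _ ≤ M * majorant M s y := by rw [mul_one]; gcongr

lemma measurable_kernelI_add (M : ℕ) (θ θ' : ℂ) (b x : ℝ) : Measurable fun p : ℝ × ℝ =>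
    kernelI (2 * M) (M - 1) θ p.1 (x + p.2) * cexp (-(θ' * b * p.2)) := by
  have h := (measurable_kernelI (2 * M) (M - 1) θ).comp
    (f := fun p : ℝ × ℝ => (p.1, x + p.2)) (by fun_prop)
  exact h.mul (by fun_prop)

lemma integrableOn_kernelTail_integrand {M : ℕ} (hM : 1 ≤ M) {θ θ' : ℂ} (hθ : θ ∈ rootsJ (2 * M))
    (hθ' : θ' ∈ rootsJ (2 * M)) {b x s : ℝ} (hb : 0 < b) (hx : 0 ≤ x) (hs : 0 < s) :
    IntegrableOn (fun y : ℝ => kernelI (2 * M) (M - 1) θ s (x + y) * cexp (-(θ' * b * y)))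
      (Set.Ioi 0) := by
  obtain ⟨C, hC⟩ := integral_majorant hM
  refine Integrable.mono' ((hC s hs).1.const_mul (M : ℝ)) ?_
    ((ae_restrict_mem measurableSet_Ioi).mono fun y hy =>
      norm_kernelTail_integrand_le hM hθ hθ' hb hx hs hy)
  exact ((measurable_kernelI_add M θ θ' b x).comp
    (measurable_const.prodMk measurable_id : Measurable fun y : ℝ => (s, y))).aestronglyMeasurable

lemma continuousOn_kernelTail {M : ℕ} (hM : 1 ≤ M) {θ θ' : ℂ} (hθ : θ ∈ rootsJ (2 * M))
    (hθ' : θ' ∈ rootsJ (2 * M)) {b x : ℝ} (hb : 0 < b) (hx : 0 ≤ x) :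
    ContinuousOn (kernelTail M θ θ' b x) (Set.Ioi 0) := by
  obtain ⟨C, hC⟩ := integral_majorant hM
  intro s₀ hs₀
  have hs₀' : (0 : ℝ) < s₀ := hs₀
  have hnear : ∀ᶠ s in 𝓝 s₀, s₀ / 2 < s := lt_mem_nhds (by linarith)
  refine ContinuousAt.continuousWithinAt (continuousAt_of_dominated
    (bound := fun y => M * majorant M (s₀ / 2) y) ?_ ?_
    ((hC (s₀ / 2) (by positivity)).1.const_mul (M : ℝ)) ?_)
  · filter_upwards [hnear] with s hs
    exact (integrableOn_kernelTail_integrand hM hθ hθ' hb hx (by linarith)).1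
  · filter_upwards [hnear] with s hs
    refine (ae_restrict_mem measurableSet_Ioi).mono fun y hy => ?_
    refine (norm_kernelTail_integrand_le hM hθ hθ' hb hx (by linarith) hy).trans ?_
    gcongr
    exact majorant_anti hM (by positivity) hs.le (le_of_lt hy) le_rfl
  · refine (ae_restrict_mem measurableSet_Ioi).mono fun y hy => ?_
    have hy' : (0 : ℝ) < y := hy
    refine ContinuousAt.mul ?_ continuousAt_const
    have h1 : ContinuousOn (fun s => kernelI (2 * M) (M - 1) θ s (x + y)) (Set.Ioi 0) :=
      (continuousOn_kernelI hM hθ).comp (f := fun s : ℝ => (s, x + y)) (by fun_prop)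
        fun s hs => ⟨hs, show 0 ≤ x + y by positivity⟩
    exact h1.continuousAt (Ioi_mem_nhds hs₀')

/-- By Fubini, the transform e^{-θa(x+y)} is integrated against e^{-θ'by}. As x + y > 0 inside the
integral, x = 0 is allowed even for M = 1. -/
lemma laplace_kernelTail {M : ℕ} (hM : 1 ≤ M) {θ θ' : ℂ} (hθ : θ ∈ rootsJ (2 * M))
    (hθ' : θ' ∈ rootsJ (2 * M)) {a b x : ℝ} (ha : 0 < a) (hb : 0 < b) (hx : 0 ≤ x) :
    IntegrableOn (fun s : ℝ => cexp (-((a ^ (2 * M) : ℝ) * s)) * kernelTail M θ θ' b x s)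
      (Set.Ioi 0) ∧
    ∫ s in Set.Ioi (0 : ℝ), cexp (-((a ^ (2 * M) : ℝ) * s)) * kernelTail M θ θ' b x s =
      ((a : ℂ) ^ (M - 1))⁻¹ * cexp (-(θ * a * x)) / (θ * a + θ' * b) := by
  set G : ℝ × ℝ → ℂ := fun p => cexp (-((a ^ (2 * M) : ℝ) * p.1)) *
    (kernelI (2 * M) (M - 1) θ p.1 (x + p.2) * cexp (-(θ' * b * p.2))) with hG
  have hGi : Integrable G ((volume.restrict (Set.Ioi 0)).prod (volume.restrict (Set.Ioi 0))) := by
    refine Integrable.mono' ((integrable_exp_mul_majorant hM (pow_pos ha (2 * M))).const_mul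
      (M : ℝ)) ?_ ?_
    · exact (Measurable.mul (by fun_prop) (measurable_kernelI_add M θ θ' b x)).aestronglyMeasurable
    · rw [Measure.prod_restrict]
      refine (ae_restrict_mem (measurableSet_Ioi.prod measurableSet_Ioi)).mono fun p hp => ?_
      have h1 := norm_kernelTail_integrand_le hM hθ hθ' hb hx hp.1 hp.2
      simp only [hG]
      rw [norm_mul, show -(((a ^ (2 * M) : ℝ) : ℂ) * p.1) = ((-(a ^ (2 * M) * p.1) : ℝ) : ℂ) by
        push_cast; ring, norm_exp_ofReal]
      calc _ ≤ Real.exp (-(a ^ (2 * M) * p.1)) * (M * majorant M p.1 p.2) := by gcongr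
        _ = _ := by ring
  have e : ∀ s : ℝ, cexp (-((a ^ (2 * M) : ℝ) * s)) * kernelTail M θ θ' b x s =
      ∫ y in Set.Ioi (0 : ℝ), G (s, y) := fun s => (integral_const_mul _ _).symm
  simp only [e]
  refine ⟨hGi.integral_prod_left, ?_⟩
  rw [integral_integral_swap hGi]
  have hre : (-(θ * a + θ' * b)).re < 0 := by
    have h1 := re_mul_ofReal_pos hM hθ ha
    have h2 := re_mul_ofReal_pos hM hθ' hb
    rw [neg_re, add_re]
    linarith
  have h1 : Set.EqOn (fun y : ℝ => ∫ s in Set.Ioi (0 : ℝ), G (s, y))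
      (fun y : ℝ => ((a : ℂ) ^ (M - 1))⁻¹ * cexp (-(θ * a * x)) * cexp (-(θ * a + θ' * b) * y))
      (Set.Ioi 0) := by
    intro y hy
    have hy' : (0 : ℝ) < y := hy
    have h2 : ∀ s : ℝ, G (s, y) = cexp (-(θ' * b * y)) * (cexp (-((a ^ (2 * M) : ℝ) * s)) *
        kernelI (2 * M) (M - 1) θ s (x + y)) := by
      intro s; simp only [hG]; ring
    simp only [h2]
    rw [integral_const_mul, (laplace_kernelI hM hθ ha (by positivity) (Or.inr (by positivity))).2,
      mul_left_comm, ← Complex.exp_add, mul_assoc ((a : ℂ) ^ (M - 1))⁻¹, ← Complex.exp_add]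
    push_cast
    ring_nf
  rw [setIntegral_congr_fun measurableSet_Ioi h1, integral_const_mul,
    integral_exp_mul_complex_Ioi hre]
  simp only [ofReal_zero, mul_zero, Complex.exp_zero]
  rw [neg_div_neg_eq, mul_one_div]

/-- The exponent is -(M+1)/(2M) when M ≥ 2, and 0 when x > 0. -/
lemma kernelI_bound {M : ℕ} (hM : 1 ≤ M) {θ : ℂ} (hθ : θ ∈ rootsJ (2 * M)) {x : ℝ} (hx : 0 ≤ x)
    (h : 2 ≤ M ∨ 0 < x) : ∃ q : ℝ, -1 < q ∧ q ≤ 0 ∧ ∃ C : ℝ, 0 ≤ C ∧ ∀ σ : ℝ, 0 < σ →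
      ‖kernelI (2 * M) (M - 1) θ σ x‖ ≤ C * σ ^ q := by
  rcases h with h | h
  · obtain ⟨C, hC0, hC⟩ := exists_majorant_le_rpow hM
    have hM2 : (2 : ℝ) ≤ M := by exact_mod_cast h
    refine ⟨-((M : ℝ) + 1) / (2 * M), ?_, ?_, M * C, by positivity, fun σ hσ => ?_⟩
    · rw [lt_div_iff₀ (by positivity)]; linarith
    · exact div_nonpos_of_nonpos_of_nonneg (by linarith) (by linarith)
    · calc _ ≤ M * majorant M σ x := norm_kernelI_le hM hθ hσ hx
        _ ≤ M * (C * σ ^ (-((M : ℝ) + 1) / (2 * M))) := by gcongr; exact hC σ x hσ hx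
        _ = _ := by ring
  · obtain ⟨C, hC0, hC⟩ := exists_majorant_le hM h
    refine ⟨0, by norm_num, le_rfl, M * C, by positivity, fun σ hσ => ?_⟩
    rw [Real.rpow_zero, mul_one]
    calc _ ≤ M * majorant M σ x := norm_kernelI_le hM hθ hσ hx
      _ ≤ M * C := by gcongr; exact hC σ hσ

lemma convolutionIntegrand_eq {M : ℕ} (hM : 1 ≤ M) (θ θ' : ℂ) (lam s x : ℝ) :
    convolutionIntegrand (2 * M) θ (-θ') lam s x = fun σ =>
      mittagKernel (2 * M) (-θ' / θ) lam σ * kernelI (2 * M) (M - 1) θ (s - σ) x := by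
  ext σ
  rw [convolutionIntegrand, mittagKernel, card_rootsJ hM]

/-- As functions of s, both sides have Laplace transform θ a^{-(M-1)} e^{-θax}/(θa + θ'b) for a > b:
the convolution because transforms multiply and the Mittag-Leffler factor with c = -θ'/θ gives (a +
θ'b/θ)⁻¹, the other side by `laplace_kernelTail`. They agree almost everywhere, and by continuity at
every s > 0. -/
theorem integral_convolutionIntegrand {M : ℕ} (hM : 1 ≤ M) {θ θ' : ℂ} (hθ : θ ∈ rootsJ (2 * M))
    (hθ' : θ' ∈ rootsJ (2 * M)) {b s x : ℝ} (hb : 0 < b) (hs : 0 < s) (hx : 0 ≤ x)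
    (h : 2 ≤ M ∨ 0 < x) :
    IntervalIntegrable (convolutionIntegrand (2 * M) θ (-θ') (b ^ (2 * M)) s x) volume 0 s ∧
    ∫ σ in (0 : ℝ)..s, convolutionIntegrand (2 * M) θ (-θ') (b ^ (2 * M)) s x σ =
      θ * kernelTail M θ θ' b x s := by
  have hN : 1 ≤ 2 * M := by omega
  have hM0 : (0 : ℝ) < M := by exact_mod_cast hM
  have hθ0 := ne_zero_of_mem_rootsJ hM hθ
  have hc : ‖-θ' / θ‖ = 1 := by
    rw [norm_div, norm_neg, norm_of_mem_rootsJ hM hθ, norm_of_mem_rootsJ hM hθ', div_one]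
  set A := mittagKernel (2 * M) (-θ' / θ) (b ^ (2 * M)) with hA
  set B : ℝ → ℂ := fun τ => kernelI (2 * M) (M - 1) θ τ x with hB
  obtain ⟨q, hq, hq0, C, hC0, hC⟩ := kernelI_bound hM hθ hx h
  have hBc : ContinuousOn B (Set.Ioi 0) :=
    (continuousOn_kernelI hM hθ).comp (f := fun s : ℝ => (s, x)) (by fun_prop)
      fun s hs => ⟨hs, hx⟩
  have hNr : (1 : ℝ) / ((2 * M : ℕ) : ℝ) ≤ 1 := by
    rw [div_le_one (by positivity)]; exact_mod_cast hN
  have hNr0 : (0 : ℝ) < 1 / ((2 * M : ℕ) : ℝ) := by push_cast; positivity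
  obtain ⟨k1, k2⟩ := continuousOn_singular_convolution (A := A) (B := B)
    (p := (1 : ℝ) / ((2 * M : ℕ) : ℝ) - 1) (q := q)
    (by linarith) (by linarith) hq hq0 (continuousOn_mittagKernel hN _ _) hBc
    (fun S hS => mittagKernel_bound hN _ _ S hS) (fun S _ => ⟨C, hC0, fun σ hσ _ => hC σ hσ⟩)
  simp only [convolutionIntegrand_eq hM]
  refine ⟨k1 s hs, ?_⟩
  set R : ℝ → ℂ := fun s => ∫ σ in (0 : ℝ)..s, A σ * B (s - σ) with hR
  have hLc : ContinuousOn (fun s => θ * kernelTail M θ θ' b x s) (Set.Ioi 0) :=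
    continuousOn_const.mul (continuousOn_kernelTail hM hθ hθ' hb hx)
  have hlap : ∀ a : ℝ, b < a →
      IntegrableOn (fun s : ℝ => cexp (-((a ^ (2 * M) : ℝ) * s)) * R s) (Set.Ioi 0) ∧
      ∫ s in Set.Ioi (0 : ℝ), cexp (-((a ^ (2 * M) : ℝ) * s)) * R s =
        (a - -θ' / θ * b)⁻¹ * (((a : ℂ) ^ (M - 1))⁻¹ * cexp (-(θ * a * x))) := by
    intro a hab
    obtain ⟨i1, j1⟩ := laplace_mittagKernel hN hc hb hab
    obtain ⟨i2, j2⟩ := laplace_kernelI hM hθ (hb.trans hab) hx h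
    have hi := integrable_posConvolution i1 i2 (ContinuousLinearMap.mul ℝ ℂ)
    have hj := integral_posConvolution i1 i2 (ContinuousLinearMap.mul ℝ ℂ)
    have e : ∀ s : ℝ, (∫ t in (0 : ℝ)..s, (ContinuousLinearMap.mul ℝ ℂ)
        (cexp (-((a ^ (2 * M) : ℝ) * t)) * mittagKernel (2 * M) (-θ' / θ) (b ^ (2 * M)) t)
        (cexp (-((a ^ (2 * M) : ℝ) * (s - t : ℝ))) * kernelI (2 * M) (M - 1) θ (s - t) x)) =
        cexp (-((a ^ (2 * M) : ℝ) * s)) * R s := by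
      intro s
      rw [hR, ← intervalIntegral.integral_const_mul]
      congr 1
      ext t
      rw [ContinuousLinearMap.mul_apply', show -(((a ^ (2 * M) : ℝ) : ℂ) * s) =
        -((a ^ (2 * M) : ℝ) * t) + -((a ^ (2 * M) : ℝ) * (s - t : ℝ)) by push_cast; ring,
        Complex.exp_add]
      ring
    constructor
    · rw [posConvolution, integrable_indicator_iff measurableSet_Ioi] at hi
      simpa only [e] using hi
    · simp only [e] at hj
      rw [hj, ContinuousLinearMap.mul_apply', j1, j2]
  have hae : (fun s => R s - θ * kernelTail M θ θ' b x s) =ᵐ[volume.restrict (Set.Ioi 0)] 0 := by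
    have hroot : ∀ α : ℝ, b ^ (2 * M) < α → ∃ a : ℝ, b < a ∧ a ^ (2 * M) = α := by
      intro α hα
      have hα0 : 0 ≤ α := le_trans (by positivity) hα.le
      have h2 : (α ^ (((2 * M : ℕ) : ℝ)⁻¹)) ^ (2 * M) = α :=
        Real.rpow_inv_natCast_pow hα0 (by omega)
      exact ⟨α ^ (((2 * M : ℕ) : ℝ)⁻¹), lt_of_pow_lt_pow_left₀ (2 * M) (by positivity)
        (by rwa [h2]), h2⟩
    have hi : ∀ a : ℝ, b < a → IntegrableOn (fun s : ℝ => cexp (-((a ^ (2 * M) : ℝ) * s)) *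
        (θ * kernelTail M θ θ' b x s)) (Set.Ioi 0) := fun a hab =>
      IntegrableOn.congr_fun ((laplace_kernelTail hM hθ hθ' (hb.trans hab) hb hx).1.const_mul θ)
        (fun s _ => by ring) measurableSet_Ioi
    refine ae_eq_zero_of_laplace_eq_zero (α₀ := b ^ (2 * M)) (fun α hα => ?_) fun α hα => ?_
    · obtain ⟨a, hab, rfl⟩ := hroot α hα
      refine IntegrableOn.congr_fun ((hlap a hab).1.sub (hi a hab)) (fun s _ => ?_)
        measurableSet_Ioi
      simp only [Pi.sub_apply]
      ring
    · obtain ⟨a, hab, rfl⟩ := hroot α hα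
      have h3 := laplace_kernelTail hM hθ hθ' (hb.trans hab) hb hx
      simp only [mul_sub]
      rw [integral_sub (hlap a hab).1 (hi a hab), (hlap a hab).2]
      simp only [mul_left_comm _ θ]
      rw [integral_const_mul, h3.2]
      have h4 : θ * a + θ' * b ≠ 0 := by
        intro h0
        have h1 := re_mul_ofReal_pos hM hθ (hb.trans hab)
        have h2 := re_mul_ofReal_pos hM hθ' hb
        have := congrArg Complex.re h0
        rw [add_re, zero_re] at this
        linarith
      rw [show (a : ℂ) - -θ' / θ * b = (θ * a + θ' * b) / θ by field_simp; ring, inv_div]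
      ring
  have heq := Measure.eqOn_of_ae_eq (μ := volume) (s := Set.Ioi (0 : ℝ)) (f := R)
    (g := fun s => θ * kernelTail M θ θ' b x s)
    (hae.mono fun s hs => sub_eq_zero.1 hs) k2 hLc (by
      rw [isOpen_Ioi.interior_eq]; exact subset_closure)
  exact heq hs

/-- The Laplace transform in `t` of the joint density. -/
theorem laplace_jointDensity {M : ℕ} (hM : 1 ≤ M) {b s x : ℝ} (hb : 0 < b) (hs : 0 < s)
    (hx : 0 ≤ x) :
    IntegrableOn (fun t : ℝ => Real.exp (-(b ^ (2 * M) * t)) * jointDensity M t s x) (Set.Ioi 0) ∧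
    ((∫ t in Set.Ioi (0 : ℝ), Real.exp (-(b ^ (2 * M) * t)) * jointDensity M t s x : ℝ) : ℂ) =
      (Real.exp (-(b ^ (2 * M) * s)) : ℝ) * ((b : ℂ) ^ (M - 1))⁻¹ *
        ∑ θ ∈ rootsJ (2 * M), ∑ θ' ∈ rootsJ (2 * M),
          rootCoeff (rootsJ (2 * M)) θ * rootCoeff (rootsJ (2 * M)) θ' * θ' *
            (θ * kernelTail M θ θ' b x s) := by
  obtain ⟨C, hC0, hC⟩ := exists_norm_halfDensity_le hM
  have hm := measurable_halfDensity M
  set G : ℝ × ℝ → ℝ := fun p => Real.exp (-(b ^ (2 * M) * p.1)) *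
    (halfDensity M s (x + p.2) * halfDensity M p.1 p.2) with hG
  have hm1 : Measurable fun p : ℝ × ℝ => halfDensity M s (x + p.2) :=
    hm.comp (f := fun p : ℝ × ℝ => (s, x + p.2)) (by fun_prop)
  have hGi : Integrable G (volume.prod volume) := by
    have h1 := (integrable_halfDensity_transform hM (pow_pos hb (2 * M)) 0).norm.const_mul
      (C * majorant M s 0)
    have h0 := majorant_nonneg M s 0
    refine h1.mono' ?_ (ae_of_all _ fun p => ?_)
    · exact (Measurable.mul (by fun_prop) (hm1.mul hm)).aestronglyMeasurable
    · have h2 : ‖halfDensity M s (x + p.2)‖ ≤ C * majorant M s 0 := by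
        by_cases hy : 0 ≤ x + p.2
        · exact (hC s _ hs hy).trans (by gcongr; exact majorant_anti hM hs le_rfl le_rfl hy)
        · rw [halfDensity_eq_zero fun h => hy h.2.le, norm_zero]; positivity
      rw [norm_mul (cexp _), norm_real, show -(((b ^ (2 * M) : ℝ) : ℂ) * p.1) + I * (0 : ℝ) * p.2 =
        ((-(b ^ (2 * M) * p.1) : ℝ) : ℂ) by push_cast; ring, norm_exp_ofReal, hG, norm_mul,
        norm_mul, Real.norm_of_nonneg (Real.exp_pos _).le]
      calc _ ≤ Real.exp (-(b ^ (2 * M) * p.1)) * (C * majorant M s 0 * ‖halfDensity M p.1 p.2‖) := by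
            gcongr
        _ = _ := by ring
  -- The translation y ↦ x + y frees the factor at time t - s from x. Because x ≥ 0, the other
  -- factor then equals `halfKernel` wherever the first is nonzero.
  have e : ∀ t : ℝ, Real.exp (-(b ^ (2 * M) * t)) * jointDensity M t s x =
      Real.exp (-(b ^ (2 * M) * s)) * ∫ y : ℝ, G (t - s, y) := by
    intro t
    simp only [hG]
    rw [jointDensity, integral_const_mul, ← mul_assoc, ← Real.exp_add,
      ← integral_add_left_eq_self _ x]
    simp only [add_sub_cancel_left]
    ring_nf
  have hGt : Integrable fun r : ℝ => ∫ y : ℝ, G (r, y) := hGi.integral_prod_left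
  have hall : Integrable fun t : ℝ => Real.exp (-(b ^ (2 * M) * t)) * jointDensity M t s x := by
    simp only [e]
    exact (hGt.comp_sub_right s).const_mul _
  refine ⟨hall.integrableOn, ?_⟩
  have hzero : ∀ t : ℝ, t ∉ Set.Ioi (0 : ℝ) →
      Real.exp (-(b ^ (2 * M) * t)) * jointDensity M t s x = 0 := by
    intro t ht
    rw [jointDensity_eq_zero fun h => ht (h.1.trans h.2), mul_zero]
  rw [setIntegral_eq_integral_of_forall_compl_eq_zero hzero]
  simp only [e]
  rw [integral_const_mul, integral_sub_right_eq_self (fun r => ∫ y : ℝ, G (r, y)) s,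
    integral_integral_swap hGi, ofReal_mul, mul_assoc]
  congr 1
  rw [← integral_complex_ofReal]
  have h0 : ∀ y : ℝ, y ∉ Set.Ioi (0 : ℝ) → ((∫ r : ℝ, G (r, y) : ℝ) : ℂ) = 0 := by
    intro y hy
    have : ∀ r, G (r, y) = 0 := fun r => by
      simp only [hG]
      rw [halfDensity_eq_zero (s := r) fun h => hy h.2, mul_zero, mul_zero]
    simp [this]
  rw [← setIntegral_eq_integral_of_forall_compl_eq_zero h0]
  have h1 : Set.EqOn (fun y : ℝ => ((∫ r : ℝ, G (r, y) : ℝ) : ℂ))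
      (fun y : ℝ => ∑ θ ∈ rootsJ (2 * M), ∑ θ' ∈ rootsJ (2 * M), ((b : ℂ) ^ (M - 1))⁻¹ *
        (rootCoeff (rootsJ (2 * M)) θ * rootCoeff (rootsJ (2 * M)) θ' * θ' * θ) *
          (kernelI (2 * M) (M - 1) θ s (x + y) * cexp (-(θ' * b * y)))) (Set.Ioi 0) := by
    intro y hy
    have hy' : (0 : ℝ) < y := hy
    have h2 : ∀ r : ℝ, r ∉ Set.Ioi (0 : ℝ) → ((G (r, y) : ℝ) : ℂ) = 0 := by
      intro r hr
      simp only [hG]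
      rw [halfDensity_eq_zero (s := r) fun h => hr h.1]; simp
    simp only
    rw [← integral_complex_ofReal, ← setIntegral_eq_integral_of_forall_compl_eq_zero h2]
    have h3 : ∀ r : ℝ, ((G (r, y) : ℝ) : ℂ) = (halfDensity M s (x + y) : ℂ) *
        (cexp (-((b ^ (2 * M) : ℝ) * r)) * (halfDensity M r y : ℂ)) := by
      intro r; simp only [hG]; push_cast; ring
    simp only [h3]
    rw [integral_const_mul, (laplace_halfDensity hM hb hy').2,
      ofReal_halfDensity hM hs (show 0 < x + y by positivity), halfKernel, mul_left_comm,
      Finset.sum_mul_sum, Finset.mul_sum]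
    refine Finset.sum_congr rfl fun θ _ => ?_
    rw [Finset.mul_sum]
    exact Finset.sum_congr rfl fun θ' _ => by ring
  have hint : ∀ θ ∈ rootsJ (2 * M), ∀ θ' ∈ rootsJ (2 * M), IntegrableOn (fun y : ℝ =>
      ((b : ℂ) ^ (M - 1))⁻¹ *
        (rootCoeff (rootsJ (2 * M)) θ * rootCoeff (rootsJ (2 * M)) θ' * θ' * θ) *
          (kernelI (2 * M) (M - 1) θ s (x + y) * cexp (-(θ' * b * y)))) (Set.Ioi 0) :=
    fun θ hθ θ' hθ' => (integrableOn_kernelTail_integrand hM hθ hθ' hb hx hs).const_mul _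
  rw [setIntegral_congr_fun measurableSet_Ioi h1,
    integral_finsetSum _ fun θ hθ => integrable_finsetSum _ fun θ' hθ' => hint θ hθ θ' hθ',
    Finset.mul_sum]
  refine Finset.sum_congr rfl fun θ hθ => ?_
  rw [integral_finsetSum _ fun θ' hθ' => hint θ hθ θ' hθ', Finset.mul_sum]
  refine Finset.sum_congr rfl fun θ' hθ' => ?_
  rw [integral_const_mul, kernelTail]
  ring

end PseudoProcess

namespace PseudoProcess

/-! ### Uniqueness of the joint density -/

lemma IsJointDensity.integrable_transform {N : ℕ} {q : ℝ → ℝ → ℝ → ℝ} (h : IsJointDensity N q)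
    {lam ν : ℝ} (μ : ℝ) (hlam : 0 < lam) (hν : 0 < ν) :
    Integrable fun z : ℝ × ℝ × ℝ =>
      cexp (-(lam * z.1) + I * μ * z.2.2 - ν * z.2.1) * q z.1 z.2.1 z.2.2 := by
  have h1 := h.integrable lam hlam
  have hm : AEStronglyMeasurable (fun z : ℝ × ℝ × ℝ => (q z.1 z.2.1 z.2.2 : ℂ)) volume := by
    have h2 : AEStronglyMeasurable (fun z : ℝ × ℝ × ℝ => Real.exp (lam * z.1) *
        (Real.exp (-(lam * z.1)) * q z.1 z.2.1 z.2.2)) volume :=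
      (by fun_prop : Continuous fun z : ℝ × ℝ × ℝ =>
        Real.exp (lam * z.1)).aestronglyMeasurable.mul h1.1
    have h3 : (fun z : ℝ × ℝ × ℝ => Real.exp (lam * z.1) *
        (Real.exp (-(lam * z.1)) * q z.1 z.2.1 z.2.2)) = fun z => q z.1 z.2.1 z.2.2 := by
      ext z; rw [← mul_assoc, ← Real.exp_add]; simp
    rw [h3] at h2
    exact continuous_ofReal.comp_aestronglyMeasurable h2
  refine h1.mono ((by fun_prop : Continuous fun z : ℝ × ℝ × ℝ =>
    cexp (-(lam * z.1) + I * μ * z.2.2 - ν * z.2.1)).aestronglyMeasurable.mul hm)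
    (ae_of_all _ fun z => ?_)
  by_cases hz : 0 < z.2.1 ∧ z.2.1 < z.1
  · rw [norm_mul, norm_mul, norm_real, Complex.norm_exp, Real.norm_of_nonneg (Real.exp_pos _).le]
    gcongr
    simp only [sub_re, add_re, neg_re, mul_re, ofReal_re, ofReal_im, I_re, I_im]
    have := mul_pos hν hz.1
    simp
    linarith
  · rw [h.eq_zero _ _ _ hz]; simp

/-- The two transforms are limits of the same sequence, hence equal; injectivity gives equality
almost everywhere. Continuity on the open set 0 < s < t and vanishing outside it upgrade this to
equality at every point. -/
theorem IsJointDensity.unique {N : ℕ} {q q' : ℝ → ℝ → ℝ → ℝ} (h : IsJointDensity N q)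
    (h' : IsJointDensity N q') : q = q' := by
  have hae : (fun z : ℝ × ℝ × ℝ => q z.1 z.2.1 z.2.2 - q' z.1 z.2.1 z.2.2) =ᵐ[volume] 0 := by
    refine ae_eq_zero_of_laplace_fourier_eq_zero (fun z hz => ?_) (fun lam hlam => ?_)
      fun lam μ ν hlam hν => ?_
    · have hz' : ¬ (0 < z.2.1 ∧ z.2.1 < z.1) := fun h => hz ⟨(h.1.trans h.2).le, h.1.le⟩
      rw [h.eq_zero _ _ _ hz', h'.eq_zero _ _ _ hz', sub_zero]
    · simp only [mul_sub]
      exact (h.integrable lam hlam).sub (h'.integrable lam hlam)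
    · have e := tendsto_nhds_unique (h.transform lam μ ν hlam hν).2.2
        (h'.transform lam μ ν hlam hν).2.2
      simp only [ofReal_sub, mul_sub]
      rw [integral_sub (h.integrable_transform μ hlam hν) (h'.integrable_transform μ hlam hν), e,
        sub_self]
  have hopen : IsOpen {z : ℝ × ℝ × ℝ | 0 < z.2.1 ∧ z.2.1 < z.1} :=
    (isOpen_lt continuous_const (continuous_fst.comp continuous_snd)).and
      (isOpen_lt (continuous_fst.comp continuous_snd) continuous_fst)
  have heq := Measure.eqOn_of_ae_eq (μ := volume) (s := {z : ℝ × ℝ × ℝ | 0 < z.2.1 ∧ z.2.1 < z.1})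
    (ae_restrict_of_ae (hae.mono fun s hs => sub_eq_zero.1 hs)) h.continuousOn h'.continuousOn (by
      rw [hopen.interior_eq]; exact subset_closure)
  ext t s x
  by_cases hz : 0 < s ∧ s < t
  · exact heq (x := (t, s, x)) hz
  · rw [h.eq_zero _ _ _ hz, h'.eq_zero _ _ _ hz]

end PseudoProcess

namespace PseudoProcess

/-! ### The heat kernel -/

open FourierTransform

/-- The substitution μ ↦ -μ shows that the inversion integral is its own conjugate, so the real part
in `heatKernel` discards nothing. -/
lemma ofReal_heatKernel (M : ℕ) (t x : ℝ) : (heatKernel (2 * M) t x : ℂ) =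
    (1 / (2 * Real.pi)) * ∫ μ : ℝ, cexp (-(I * μ * x)) * cexp (-(t * μ ^ (2 * M))) := by
  have e : ∀ μ : ℝ, kappa (2 * M) * t * (-(I * μ)) ^ (2 * M) = -(t * (μ : ℂ) ^ (2 * M)) := by
    intro μ
    have h := kappa_mul_I_pow M (μ : ℂ)
    rw [(even_two_mul M).neg_pow]
    linear_combination (t : ℂ) * h
  rw [heatKernel]
  simp only [e]
  rw [← Complex.conj_eq_iff_re, map_mul, ← integral_conj, ← integral_neg_eq_self]
  congr 1
  · simp [Complex.conj_ofReal, map_ofNat]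
  · refine integral_congr_ae (ae_of_all _ fun μ => ?_)
    simp only [map_mul, ← Complex.exp_conj, map_neg, conj_I, conj_ofReal, map_pow, ofReal_neg,
      (even_two_mul M).neg_pow]
    ring_nf

lemma heatKernel_neg (M : ℕ) (t x : ℝ) : heatKernel (2 * M) t (-x) = heatKernel (2 * M) t x := by
  rw [← Complex.ofReal_inj, ofReal_heatKernel, ofReal_heatKernel, ← integral_neg_eq_self]
  simp [(even_two_mul M).neg_pow]

lemma heatKernel_scaling (M : ℕ) {r : ℝ} (hr : 0 < r) (x : ℝ) :
    heatKernel (2 * M) (r ^ (2 * M)) x = r⁻¹ * heatKernel (2 * M) 1 (x / r) := by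
  rw [← Complex.ofReal_inj, ofReal_mul, ofReal_heatKernel, ofReal_heatKernel]
  have h := Measure.integral_comp_mul_left (fun v : ℝ => cexp (-(I * v * (x / r : ℝ))) *
    cexp (-((1 : ℝ) * (v : ℂ) ^ (2 * M)))) r
  have hr' : (r : ℂ) ≠ 0 := by exact_mod_cast hr.ne'
  rw [mul_left_comm, ← Complex.real_smul (x := r⁻¹), ← abs_of_pos (inv_pos.2 hr), ← h]
  congr 1
  refine integral_congr_ae (ae_of_all _ fun μ => ?_)
  simp only
  push_cast
  rw [mul_pow, one_mul, show I * (r * μ) * ((x : ℂ) / r) = I * μ * x by field_simp]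

lemma measurable_heatKernel (M : ℕ) : Measurable fun p : ℝ × ℝ => heatKernel (2 * M) p.1 p.2 := by
  have h : Continuous fun p : (ℝ × ℝ) × ℝ =>
      cexp (-(I * p.2 * p.1.2)) * cexp (kappa (2 * M) * p.1.1 * (-(I * p.2)) ^ (2 * M)) := by fun_prop
  exact Complex.measurable_re.comp ((h.stronglyMeasurable.integral_prod_right
    (ν := (volume : Measure ℝ))).measurable.const_mul _)

/-- The function `e^{-v^N}`. -/
noncomputable def powExp (M : ℕ) (v : ℝ) : ℂ := cexp (-((v : ℂ) ^ (2 * M)))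

lemma norm_powExp (M : ℕ) (v : ℝ) : ‖powExp M v‖ = Real.exp (-(v ^ (2 * M))) := by
  rw [powExp, show -((v : ℂ) ^ (2 * M)) = ((-(v ^ (2 * M)) : ℝ) : ℂ) by push_cast; ring,
    norm_exp_ofReal]

lemma continuous_powExp (M : ℕ) : Continuous (powExp M) := by unfold powExp; fun_prop

lemma integrable_pow_mul_powExp {M : ℕ} (hM : 1 ≤ M) (k : ℕ) :
    Integrable fun v : ℝ => (v : ℂ) ^ k * powExp M v := by
  have h := (integrable_rpow_mul_exp_neg_mul_sq (b := 1) one_pos (s := k)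
    (by have : (0 : ℝ) ≤ k := by positivity
        linarith)).const_mul (Real.exp 1)
  simp only [Real.rpow_natCast] at h
  have hc := continuous_powExp M
  refine h.mono (by fun_prop) (ae_of_all _ fun v => ?_)
  rw [norm_mul, norm_pow, norm_real, norm_powExp, norm_mul, norm_mul, norm_pow,
    Real.norm_of_nonneg (Real.exp_pos _).le, Real.norm_of_nonneg (Real.exp_pos _).le, mul_left_comm,
    ← Real.exp_add]
  gcongr
  have h1 : v ^ 2 ≤ 1 + v ^ (2 * M) := by
    rw [pow_mul]
    rcases le_total (v ^ 2) 1 with h | h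
    · have : 0 ≤ (v ^ 2) ^ M := by positivity
      linarith
    · have := le_self_pow₀ h (by omega : M ≠ 0)
      linarith
  linarith

lemma hasDerivAt_pow_mul_powExp (M k : ℕ) (v : ℝ) :
    HasDerivAt (fun v : ℝ => (v : ℂ) ^ k * powExp M v)
      (k * (v ^ (k - 1) * powExp M v) - (2 * M) * (v ^ (k + (2 * M - 1)) * powExp M v)) v := by
  have h1 : HasDerivAt (fun z : ℂ => z ^ k * cexp (-(z ^ (2 * M))))
      (k * (v : ℂ) ^ (k - 1) * cexp (-((v : ℂ) ^ (2 * M))) + (v : ℂ) ^ k *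
        (cexp (-((v : ℂ) ^ (2 * M))) * -(((2 * M : ℕ) : ℂ) * (v : ℂ) ^ (2 * M - 1)))) v :=
    (hasDerivAt_pow k (v : ℂ)).mul (hasDerivAt_pow (2 * M) (v : ℂ)).neg.cexp
  convert! h1.comp_ofReal using 1
  rw [powExp, pow_add]
  push_cast
  ring

lemma fourier_eq_of_hasDerivAt {f : ℝ → ℂ} {f' : ℝ → ℂ} (hf : Integrable f)
    (hd : ∀ v, HasDerivAt f (f' v) v) (hf' : Integrable f') (w : ℝ) :
    𝓕 f' w = (2 * Real.pi * I * w) * 𝓕 f w := by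
  have e : deriv f = f' := funext fun v => (hd v).deriv
  have := Real.fourier_deriv hf (fun v => (hd v).differentiableAt) (by rwa [e])
  rw [e] at this
  simpa using congrFun this w

lemma norm_fourier_le (f : ℝ → ℂ) (w : ℝ) : ‖𝓕 f w‖ ≤ ∫ v, ‖f v‖ := by
  rw [Real.fourier_real_eq_integral_exp_smul]
  refine (norm_integral_le_integral_norm _).trans (le_of_eq ?_)
  simp only [norm_smul, norm_exp_ofReal_mul_I, one_mul]

/-- Two derivatives of e^{-v^N} are integrable, so w² times the transform is bounded. This makes
p(1;·) absolutely integrable although it need not be positive. -/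
lemma fourier_powExp_bound {M : ℕ} (hM : 1 ≤ M) : ∃ C : ℝ, ∀ w : ℝ,
    ‖𝓕 (powExp M) w‖ ≤ C * (1 + w ^ 2)⁻¹ := by
  have i := integrable_pow_mul_powExp hM
  have hd := hasDerivAt_pow_mul_powExp M
  have e0 : (fun v : ℝ => (v : ℂ) ^ 0 * powExp M v) = powExp M := by ext; simp
  have i0 : Integrable (powExp M) := e0 ▸ i 0
  set f1 : ℝ → ℂ := fun v => -((2 * M) * ((v : ℂ) ^ (2 * M - 1) * powExp M v)) with hf1
  have d1 : ∀ v, HasDerivAt (powExp M) (f1 v) v := by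
    intro v
    have := hd 0 v
    rw [e0] at this
    convert! this using 1
    simp [hf1]
  have i1 : Integrable f1 := ((i _).const_mul _).neg
  set f2 : ℝ → ℂ := fun v => -((2 * M) * (((2 * M - 1 : ℕ) : ℂ) * (v ^ (2 * M - 1 - 1) * powExp M v) -
    (2 * M) * (v ^ (2 * M - 1 + (2 * M - 1)) * powExp M v))) with hf2
  have d2 : ∀ v, HasDerivAt f1 (f2 v) v := fun v => ((hd (2 * M - 1) v).const_mul _).neg
  have i2 : Integrable f2 := ((((i _).const_mul _).sub ((i _).const_mul _)).const_mul _).neg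
  refine ⟨(∫ v, ‖powExp M v‖) + ∫ v, ‖f2 v‖, fun w => ?_⟩
  have h0 := norm_fourier_le (powExp M) w
  have h2 := norm_fourier_le f2 w
  rw [fourier_eq_of_hasDerivAt i1 d2 i2, fourier_eq_of_hasDerivAt i0 d1 i1, ← mul_assoc, norm_mul,
    show ‖(2 * Real.pi * I * w) * (2 * Real.pi * I * w)‖ = (2 * Real.pi) ^ 2 * w ^ 2 by
      rw [show (2 * Real.pi * I * w) * (2 * Real.pi * I * w) =
        ((-((2 * Real.pi) ^ 2 * w ^ 2) : ℝ) : ℂ) by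
          push_cast; linear_combination (4 * (Real.pi : ℂ) ^ 2 * w ^ 2) * I_sq, norm_real, norm_neg,
        Real.norm_of_nonneg (by positivity)]] at h2
  have hπ : (1 : ℝ) ≤ (2 * Real.pi) ^ 2 := by nlinarith [Real.pi_gt_three]
  have h3 : w ^ 2 * ‖𝓕 (powExp M) w‖ ≤ ∫ v, ‖f2 v‖ := by
    refine le_trans ?_ h2
    have h4 : 0 ≤ w ^ 2 * ‖𝓕 (powExp M) w‖ := by positivity
    calc w ^ 2 * ‖𝓕 (powExp M) w‖ ≤ (2 * Real.pi) ^ 2 * (w ^ 2 * ‖𝓕 (powExp M) w‖) :=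
          le_mul_of_one_le_left h4 hπ
      _ = _ := by ring
  rw [← div_eq_mul_inv, le_div_iff₀ (by positivity)]
  linarith

lemma continuous_fourier_powExp {M : ℕ} (hM : 1 ≤ M) : Continuous (𝓕 (powExp M)) := by
  have i0 : Integrable (powExp M) := by simpa using integrable_pow_mul_powExp hM 0
  exact VectorFourier.fourierIntegral_continuous Real.continuous_fourierChar
    (by fun_prop) i0

lemma integrable_fourier_powExp {M : ℕ} (hM : 1 ≤ M) : Integrable (𝓕 (powExp M)) := by
  obtain ⟨C, hC⟩ := fourier_powExp_bound hM
  exact (integrable_inv_one_add_sq.const_mul C).mono'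
    (continuous_fourier_powExp hM).aestronglyMeasurable (ae_of_all _ hC)

lemma heatKernel_one_eq (M : ℕ) (x : ℝ) :
    (heatKernel (2 * M) 1 x : ℂ) = (1 / (2 * Real.pi)) * 𝓕 (powExp M) (x / (2 * Real.pi)) := by
  rw [ofReal_heatKernel, Real.fourier_real_eq_integral_exp_smul]
  congr 1
  refine integral_congr_ae (ae_of_all _ fun μ => ?_)
  have hπ : (Real.pi : ℂ) ≠ 0 := by exact_mod_cast Real.pi_ne_zero
  simp only [smul_eq_mul, powExp, ofReal_one, one_mul]
  congr 2
  push_cast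
  field_simp

lemma integrable_heatKernel_one {M : ℕ} (hM : 1 ≤ M) : Integrable (heatKernel (2 * M) 1) := by
  have h := (integrable_fourier_powExp hM).comp_div (by positivity : 2 * Real.pi ≠ 0)
  have h2 := (h.const_mul (1 / (2 * Real.pi) : ℂ)).re
  refine h2.congr (ae_of_all _ fun x => ?_)
  simp only [← heatKernel_one_eq]
  exact ofReal_re _

lemma integral_exp_mul_heatKernel_one {M : ℕ} (hM : 1 ≤ M) (μ : ℝ) :
    ∫ x : ℝ, cexp (I * μ * x) * heatKernel (2 * M) 1 x = powExp M μ := by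
  have i0 : Integrable (powExp M) := by simpa using integrable_pow_mul_powExp hM 0
  have h := congrFun ((continuous_powExp M).fourierInv_fourier_eq i0
    (integrable_fourier_powExp hM)) μ
  rw [← h, Real.fourierInv_eq']
  have hπ : (Real.pi : ℂ) ≠ 0 := by exact_mod_cast Real.pi_ne_zero
  have h2 := Measure.integral_comp_div (fun w : ℝ => cexp (((2 * Real.pi * inner ℝ w μ : ℝ) : ℂ) * I) •
    𝓕 (powExp M) w) (2 * Real.pi)
  rw [abs_of_pos (by positivity)] at h2
  have h3 : ∀ z : ℂ, z = (1 / (2 * Real.pi)) * ((2 * Real.pi : ℝ) • z) := by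
    intro z; rw [Complex.real_smul]; push_cast; field_simp
  rw [h3 (∫ w : ℝ, cexp (((2 * Real.pi * inner ℝ w μ : ℝ) : ℂ) * I) • 𝓕 (powExp M) w), ← h2,
    ← integral_const_mul]
  refine integral_congr_ae (ae_of_all _ fun x => ?_)
  simp only [heatKernel_one_eq, smul_eq_mul]
  rw [mul_left_comm]
  congr 3
  simp
  field_simp

lemma heatKernel_eq {M : ℕ} (hM : 1 ≤ M) {t : ℝ} (ht : 0 < t) : ∃ r : ℝ, 0 < r ∧ r ^ (2 * M) = t ∧
    r = t ^ ((1 : ℝ) / (2 * M)) ∧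
    heatKernel (2 * M) t = fun x => r⁻¹ * heatKernel (2 * M) 1 (x / r) := by
  have h : (t ^ ((1 : ℝ) / (2 * M))) ^ (2 * M) = t := by
    have := Real.rpow_inv_natCast_pow ht.le (by omega : 2 * M ≠ 0)
    push_cast at this
    rwa [one_div]
  refine ⟨t ^ ((1 : ℝ) / (2 * M)), by positivity, h, rfl, ?_⟩
  ext x
  conv_lhs => rw [← h]
  exact heatKernel_scaling M (by positivity) x

lemma integrable_heatKernel {M : ℕ} (hM : 1 ≤ M) {t : ℝ} (ht : 0 < t) :
    Integrable (heatKernel (2 * M) t) := by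
  obtain ⟨r, hr, -, -, h⟩ := heatKernel_eq hM ht
  rw [h]
  exact ((integrable_heatKernel_one hM).comp_div hr.ne').const_mul _

/-- `∫_S e^{iμx} p(1;x) dx`. -/
noncomputable def profileTransform (M : ℕ) (S : Set ℝ) (μ : ℝ) : ℂ :=
  ∫ x in S, cexp (I * μ * x) * heatKernel (2 * M) 1 x

/-- Self-similarity p(t;x) = t^{-1/N}p(1; x t^{-1/N}): over a dilation-invariant set, time enters
only through μt^{1/N}. Continuity in t follows from this. -/
lemma integral_heatKernel_cone {M : ℕ} (hM : 1 ≤ M) {t : ℝ} (ht : 0 < t) {S : Set ℝ}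
    (hS : MeasurableSet S) (hcone : ∀ r x : ℝ, 0 < r → (r * x ∈ S ↔ x ∈ S)) (μ : ℝ) :
    ∫ x in S, cexp (I * μ * x) * heatKernel (2 * M) t x =
      profileTransform M S (μ * t ^ ((1 : ℝ) / (2 * M))) := by
  obtain ⟨r, hr, -, hrt, h⟩ := heatKernel_eq hM ht
  rw [h, ← hrt, profileTransform, ← integral_indicator hS, ← integral_indicator hS]
  have hr' : (r : ℂ) ≠ 0 := by exact_mod_cast hr.ne'
  have h2 := Measure.integral_comp_div (S.indicator fun x : ℝ =>
    cexp (I * (μ * r : ℝ) * x) * (heatKernel (2 * M) 1 x : ℂ)) r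
  rw [abs_of_pos hr] at h2
  have h3 : ∀ z : ℂ, z = (r : ℂ)⁻¹ * (r • z) := by
    intro z; rw [Complex.real_smul]; field_simp
  rw [h3 (∫ x, S.indicator (fun x : ℝ => cexp (I * (μ * r : ℝ) * x) * _) x), ← h2,
    ← integral_const_mul]
  refine integral_congr_ae (ae_of_all _ fun x => ?_)
  have hmem : x / r ∈ S ↔ x ∈ S := by
    rw [← hcone r (x / r) hr, mul_div_cancel₀ x hr.ne']
  by_cases hx : x ∈ S
  · simp only
    rw [Set.indicator_of_mem hx, Set.indicator_of_mem (hmem.2 hx)]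
    push_cast
    rw [show I * (μ * r) * ((x : ℂ) / r) = I * μ * x by field_simp]
    ring
  · simp only
    rw [Set.indicator_of_notMem hx, Set.indicator_of_notMem (fun h => hx (hmem.1 h)), mul_zero]

/-- The L¹ norm is independent of t. This uniform bound takes the place of the total mass 1 of a
probability transition density. -/
lemma integral_norm_heatKernel {M : ℕ} (hM : 1 ≤ M) {t : ℝ} (ht : 0 < t) :
    ∫ x, ‖heatKernel (2 * M) t x‖ = ∫ x, ‖heatKernel (2 * M) 1 x‖ := by
  obtain ⟨r, hr, -, -, h⟩ := heatKernel_eq hM ht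
  rw [h]
  simp only [norm_mul]
  rw [integral_const_mul, Measure.integral_comp_div (fun x => ‖heatKernel (2 * M) 1 x‖), smul_eq_mul,
    abs_of_pos hr, ← mul_assoc, norm_inv, Real.norm_of_nonneg hr.le, inv_mul_cancel₀ hr.ne', one_mul]

lemma integral_exp_mul_heatKernel {M : ℕ} (hM : 1 ≤ M) {t : ℝ} (ht : 0 < t) (μ : ℝ) :
    ∫ x : ℝ, cexp (I * μ * x) * heatKernel (2 * M) t x = cexp (-(t * μ ^ (2 * M))) := by
  have h := integral_heatKernel_cone hM ht MeasurableSet.univ (by simp) μ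
  rw [profileTransform, setIntegral_univ, setIntegral_univ, integral_exp_mul_heatKernel_one hM,
    powExp] at h
  obtain ⟨r, hr, hrt, hrt', -⟩ := heatKernel_eq hM ht
  rw [h, ← hrt', ← hrt]
  push_cast
  ring_nf

lemma norm_exp_I_mul (μ x : ℝ) : ‖cexp (I * μ * x)‖ = 1 := by
  rw [show I * μ * x = ((μ * x : ℝ) : ℂ) * I by push_cast; ring, norm_exp_ofReal_mul_I]

lemma integrable_exp_mul {f : ℝ → ℂ} (hf : Integrable f) (μ : ℝ) :
    Integrable fun x : ℝ => cexp (I * μ * x) * f x :=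
  hf.bdd_mul (c := 1) (by fun_prop) (ae_of_all _ fun x => (norm_exp_I_mul μ x).le)

lemma continuous_profileTransform {M : ℕ} (hM : 1 ≤ M) (S : Set ℝ) :
    Continuous (profileTransform M S) := by
  have hi := (integrable_heatKernel_one hM).ofReal (𝕜 := ℂ)
  refine continuous_of_dominated (bound := fun x => ‖(heatKernel (2 * M) 1 x : ℂ)‖) (fun μ => ?_)
    (fun μ => ae_of_all _ fun x => ?_) hi.norm.integrableOn (ae_of_all _ fun x => by fun_prop)
  · exact (integrable_exp_mul hi μ).integrableOn.1
  · rw [norm_mul, norm_exp_I_mul, one_mul]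

end PseudoProcess

namespace PseudoProcess

/-! ### Fourier transforms of functions supported on a half-line -/

lemma ae_eq_zero_of_fourier_eq_zero_complex {f : ℝ → ℂ} (hf : Integrable f)
    (h : ∀ μ : ℝ, ∫ x : ℝ, cexp (I * μ * x) * f x = 0) : f =ᵐ[volume] 0 := by
  have hc : ∀ μ : ℝ, ∫ x : ℝ, cexp (I * μ * x) * (starRingEnd ℂ) (f x) = 0 := by
    intro μ
    have h1 := congrArg (starRingEnd ℂ) (h (-μ))
    rw [← integral_conj, map_zero] at h1
    rw [← h1]
    refine integral_congr_ae (ae_of_all _ fun x => ?_)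
    simp only [map_mul, ← Complex.exp_conj, conj_I, conj_ofReal]
    push_cast
    ring_nf
  have hfc : Integrable fun x => (starRingEnd ℂ) (f x) :=
    (Complex.conjLIE.integrable_comp_iff).2 hf
  have hre : (fun x => (f x).re) =ᵐ[volume] 0 := by
    refine ae_eq_zero_of_fourier_eq_zero hf.re fun μ => ?_
    have e : ∀ x : ℝ, (((f x).re : ℝ) : ℂ) * cexp (I * μ * x) =
        (1 / 2) * (cexp (I * μ * x) * f x + cexp (I * μ * x) * (starRingEnd ℂ) (f x)) := by
      intro x; rw [← mul_add, Complex.add_conj]; push_cast; ring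
    simp only [e]
    rw [integral_const_mul, integral_add (integrable_exp_mul hf μ) (integrable_exp_mul hfc μ), h μ,
      hc μ]
    simp
  have him : (fun x => (f x).im) =ᵐ[volume] 0 := by
    refine ae_eq_zero_of_fourier_eq_zero hf.im fun μ => ?_
    have e : ∀ x : ℝ, (((f x).im : ℝ) : ℂ) * cexp (I * μ * x) =
        (-I / 2) * (cexp (I * μ * x) * f x - cexp (I * μ * x) * (starRingEnd ℂ) (f x)) := by
      intro x
      rw [← mul_sub, Complex.sub_conj]
      push_cast
      linear_combination (((f x).im : ℂ) * cexp (I * μ * x)) * I_sq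
    simp only [e]
    rw [integral_const_mul, integral_sub (integrable_exp_mul hf μ) (integrable_exp_mul hfc μ), h μ,
      hc μ]
    simp
  filter_upwards [hre, him] with x h1 h2
  exact Complex.ext h1 h2

lemma integrable_conv {f g : ℝ → ℂ} (hf : Integrable f) (hg : Integrable g) :
    Integrable fun x => ∫ t, f t * g (x - t) :=
  hf.integrable_convolution (ContinuousLinearMap.mul ℂ ℂ) hg

lemma integral_exp_mul_conv {f g : ℝ → ℂ} (hf : Integrable f) (hg : Integrable g) (μ : ℝ) :
    ∫ x : ℝ, cexp (I * μ * x) * ∫ t, f t * g (x - t) =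
      (∫ x : ℝ, cexp (I * μ * x) * f x) * ∫ x : ℝ, cexp (I * μ * x) * g x := by
  have h := integral_convolution (ContinuousLinearMap.mul ℂ ℂ) (integrable_exp_mul hf μ)
    (integrable_exp_mul hg μ)
  simp only [convolution_def, ContinuousLinearMap.mul_apply'] at h
  rw [← h]
  refine integral_congr_ae (ae_of_all _ fun x => ?_)
  simp only
  rw [← integral_const_mul]
  refine integral_congr_ae (ae_of_all _ fun t => ?_)
  simp only
  rw [show I * μ * x = I * μ * t + I * μ * (x - t : ℝ) by push_cast; ring, Complex.exp_add]
  ring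

/-- `f` is the Fourier transform of an integrable function supported in `S`. -/
def IsHalfTransform (S : Set ℝ) (f : ℝ → ℂ) : Prop :=
  ∃ g : ℝ → ℂ, Integrable g ∧ (∀ x ∉ S, g x = 0) ∧ ∀ μ : ℝ, f μ = ∫ x : ℝ, cexp (I * μ * x) * g x

namespace IsHalfTransform

variable {S : Set ℝ} {f f' : ℝ → ℂ}

lemma zero : IsHalfTransform S fun _ => 0 :=
  ⟨fun _ => 0, integrable_zero _ _ _, fun _ _ => rfl, fun μ => by simp⟩

lemma add (h : IsHalfTransform S f) (h' : IsHalfTransform S f') :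
    IsHalfTransform S fun μ => f μ + f' μ := by
  obtain ⟨g, h1, h2, h3⟩ := h
  obtain ⟨g', h1', h2', h3'⟩ := h'
  refine ⟨fun x => g x + g' x, h1.add h1', fun x hx => by simp only [h2 x hx, h2' x hx, add_zero],
    fun μ => ?_⟩
  simp only [mul_add]
  rw [integral_add (integrable_exp_mul h1 μ) (integrable_exp_mul h1' μ), h3, h3']

lemma const_mul (h : IsHalfTransform S f) (c : ℂ) : IsHalfTransform S fun μ => c * f μ := by
  obtain ⟨g, h1, h2, h3⟩ := h
  refine ⟨fun x => c * g x, h1.const_mul c, fun x hx => by simp only [h2 x hx, mul_zero], fun μ => ?_⟩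
  simp only [mul_left_comm _ c]
  rw [integral_const_mul, h3]

lemma sum {ι : Type*} {s : Finset ι} {F : ι → ℝ → ℂ} (h : ∀ i ∈ s, IsHalfTransform S (F i)) :
    IsHalfTransform S fun μ => ∑ i ∈ s, F i μ := by
  classical
  induction s using Finset.induction_on with
  | empty => simpa using zero
  | insert a s ha ih =>
    simp only [Finset.sum_insert ha]
    exact (h a (Finset.mem_insert_self a s)).add
      (ih fun i hi => h i (Finset.mem_insert_of_mem hi))

/-- Convolution of the underlying functions. Additive closure of S, true for both half-lines, keeps
the support in S. -/
lemma mul (hS : ∀ x ∈ S, ∀ y ∈ S, x + y ∈ S) (h : IsHalfTransform S f)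
    (h' : IsHalfTransform S f') : IsHalfTransform S fun μ => f μ * f' μ := by
  obtain ⟨g, h1, h2, h3⟩ := h
  obtain ⟨g', h1', h2', h3'⟩ := h'
  refine ⟨_, integrable_conv h1 h1', fun x hx => ?_, fun μ => ?_⟩
  · have : ∀ t, g t * g' (x - t) = 0 := by
      intro t
      by_cases ht : t ∈ S
      · rw [h2' (x - t) fun h => hx (by simpa using hS t ht _ h), mul_zero]
      · rw [h2 t ht, zero_mul]
    simp [this]
  · rw [integral_exp_mul_conv h1 h1', ← h3, ← h3']

lemma of_setIntegral {g : ℝ → ℂ} (hg : IntegrableOn g S) (hS : MeasurableSet S)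
    (h : ∀ μ : ℝ, f μ = ∫ x in S, cexp (I * μ * x) * g x) : IsHalfTransform S f := by
  refine ⟨S.indicator g, hg.integrable_indicator hS, fun x hx => Set.indicator_of_notMem hx _,
    fun μ => ?_⟩
  rw [h μ, ← integral_indicator hS]
  refine integral_congr_ae (ae_of_all _ fun x => ?_)
  by_cases hx : x ∈ S <;> simp [hx]

/-- The decomposition into transforms supported on `[0, ∞)` and on `(-∞, 0)` is unique. -/
lemma unique {p p' m m' : ℝ → ℂ} (hp : IsHalfTransform (Set.Ici 0) p)
    (hp' : IsHalfTransform (Set.Ici 0) p') (hm : IsHalfTransform (Set.Iio 0) m)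
    (hm' : IsHalfTransform (Set.Iio 0) m') (h : ∀ μ, p μ + m μ = p' μ + m' μ) :
    p = p' ∧ m = m' := by
  obtain ⟨u, u1, u2, u3⟩ := hp.add (hp'.const_mul (-1))
  obtain ⟨v, v1, v2, v3⟩ := hm.add (hm'.const_mul (-1))
  have h0 : ∀ μ : ℝ, ∫ x : ℝ, cexp (I * μ * x) * (u x + v x) = 0 := by
    intro μ
    simp only [mul_add]
    rw [integral_add (integrable_exp_mul u1 μ) (integrable_exp_mul v1 μ), ← u3, ← v3]
    linear_combination h μ
  have hae := ae_eq_zero_of_fourier_eq_zero_complex (u1.add v1) h0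
  have hu : u =ᵐ[volume] 0 := by
    filter_upwards [hae] with x hx
    simp only [Pi.add_apply, Pi.zero_apply] at hx
    rcases lt_or_ge x 0 with h | h
    · exact u2 x (by simpa using h)
    · rwa [v2 x (by simpa using h), add_zero] at hx
  have hp0 : p = p' := by
    ext μ
    have := u3 μ
    rw [integral_congr_ae (g := fun _ => 0) (by filter_upwards [hu] with x hx; simp [hx]),
      integral_zero] at this
    linear_combination this
  refine ⟨hp0, funext fun μ => ?_⟩
  have := h μ
  rw [hp0] at this
  exact add_left_cancel this

end IsHalfTransform

end PseudoProcess

namespace PseudoProcess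

/-! ### Coefficients of exponentials of power series -/

lemma powerSeries_unique {a b : ℕ → ℂ} {f : ℂ → ℂ}
    (ha : ∀ z : ℂ, ‖z‖ < 1 → HasSum (fun k => z ^ k * a k) (f z))
    (hb : ∀ z : ℂ, ‖z‖ < 1 → HasSum (fun k => z ^ k * b k) (f z)) : a = b := by
  have key : ∀ c : ℕ → ℂ, (∀ z : ℂ, ‖z‖ < 1 → HasSum (fun k => z ^ k * c k) (f z)) →
      HasFPowerSeriesAt f (FormalMultilinearSeries.ofScalars ℂ c) 0 := by
    intro c hc
    rw [hasFPowerSeriesAt_iff]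
    filter_upwards [Metric.ball_mem_nhds (0 : ℂ) one_pos] with z hz
    simpa [FormalMultilinearSeries.coeff_ofScalars] using hc z (by simpa using hz)
  have h := (key a ha).eq_formalMultilinearSeries (key b hb)
  ext k
  have := congrArg (fun p : FormalMultilinearSeries ℂ ℂ ℂ => p.coeff k) h
  simpa [FormalMultilinearSeries.coeff_ofScalars] using this

/-- The sum of a power series. -/
noncomputable def seriesSum (s : ℕ → ℂ) (z : ℂ) : ℂ := ∑' k, z ^ k * s k

lemma hasSum_seriesSum {s : ℕ → ℂ} {B : ℝ} (hs : ∀ k, ‖s k‖ ≤ B) {z : ℂ} (hz : ‖z‖ < 1) :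
    HasSum (fun k => z ^ k * s k) (seriesSum s z) := by
  refine (Summable.of_norm_bounded ((summable_geometric_of_lt_one (norm_nonneg z) hz).mul_right B)
    fun k => ?_).hasSum
  rw [norm_mul, norm_pow]
  gcongr
  exact hs k

lemma differentiableOn_seriesSum {s : ℕ → ℂ} {B : ℝ} (hs : ∀ k, ‖s k‖ ≤ B) :
    DifferentiableOn ℂ (seriesSum s) (Metric.ball 0 1) := by
  intro z hz
  have hz' : ‖z‖ < 1 := by simpa using hz
  obtain ⟨r, hr1, hr2⟩ := exists_between hz'
  have hr0 : 0 ≤ r := (norm_nonneg z).trans hr1.le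
  have h : DifferentiableOn ℂ (seriesSum s) (Metric.ball 0 r) := by
    refine differentiableOn_tsum_of_summable_norm (u := fun k => r ^ k * B)
      ((summable_geometric_of_lt_one hr0 hr2).mul_right B) (fun k => by fun_prop) Metric.isOpen_ball
      fun k w hw => ?_
    have hw' : ‖w‖ < r := by simpa using hw
    rw [norm_mul, norm_pow]
    gcongr
    exact hs k
  exact (h.differentiableAt (Metric.isOpen_ball.mem_nhds (by simpa using hr1))).differentiableWithinAt

/-- The Taylor coefficients of `exp (∑ s_k z^k)`. -/
noncomputable def expCoeff (s : ℕ → ℂ) (k : ℕ) : ℂ :=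
  (k.factorial : ℂ)⁻¹ * iteratedDeriv k (fun z => cexp (seriesSum s z)) 0

lemma hasSum_taylor {f : ℂ → ℂ} (hf : DifferentiableOn ℂ f (Metric.ball 0 1)) {z : ℂ}
    (hz : ‖z‖ < 1) :
    HasSum (fun k => z ^ k * ((k.factorial : ℂ)⁻¹ * iteratedDeriv k f 0)) (f z) := by
  have h := hasSum_taylorSeries_on_ball hf (z := z) (by simpa using hz)
  refine h.congr_fun fun k => ?_
  simp only [sub_zero, smul_eq_mul]
  ring

lemma hasSum_expCoeff {s : ℕ → ℂ} {B : ℝ} (hs : ∀ k, ‖s k‖ ≤ B) {z : ℂ} (hz : ‖z‖ < 1) :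
    HasSum (fun k => z ^ k * expCoeff s k) (cexp (seriesSum s z)) :=
  hasSum_taylor (differentiableOn_seriesSum hs).cexp hz

lemma iteratedDeriv_seriesSum {s : ℕ → ℂ} {B : ℝ} (hs : ∀ k, ‖s k‖ ≤ B) (k : ℕ) :
    iteratedDeriv k (seriesSum s) 0 = k.factorial * s k := by
  have h := congrFun (powerSeries_unique (fun z hz => hasSum_taylor (differentiableOn_seriesSum hs) hz)
    fun z hz => hasSum_seriesSum hs hz) k
  have : (k.factorial : ℂ) ≠ 0 := by exact_mod_cast k.factorial_ne_zero
  rw [← h, mul_inv_cancel_left₀ this]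

lemma expCoeff_zero {s : ℕ → ℂ} (h0 : s 0 = 0) : expCoeff s 0 = 1 := by
  have : seriesSum s 0 = 0 := by
    rw [seriesSum, tsum_eq_single 0 fun k hk => by simp [hk]]
    simp [h0]
  simp [expCoeff, this]

/-- Leibniz's rule applied to (e^S)' = S'e^S. The recursion builds each coefficient from s₁, s₂, …
by sums and products, operations under which half-line transforms are stable. -/
lemma expCoeff_succ {s : ℕ → ℂ} {B : ℝ} (hs : ∀ k, ‖s k‖ ≤ B) (k : ℕ) :
    expCoeff s (k + 1) = (k + 1 : ℂ)⁻¹ * ∑ i ∈ Finset.range (k + 1),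
      (i + 1) * s (i + 1) * expCoeff s (k - i) := by
  have hd := differentiableOn_seriesSum hs
  have hmem : Metric.ball (0 : ℂ) 1 ∈ 𝓝 (0 : ℂ) := Metric.ball_mem_nhds _ one_pos
  have hE := hd.cexp
  have h1 : deriv (fun z => cexp (seriesSum s z)) =ᶠ[𝓝 0]
      (deriv (seriesSum s) * fun z => cexp (seriesSum s z)) := by
    filter_upwards [hmem] with z hz
    rw [deriv_cexp (hd.differentiableAt (Metric.isOpen_ball.mem_nhds hz)), Pi.mul_apply, mul_comm]
  have c1 : ContDiffAt ℂ k (deriv (seriesSum s)) 0 :=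
    ((hd.deriv Metric.isOpen_ball).analyticAt hmem).contDiffAt
  have c2 : ContDiffAt ℂ k (fun z => cexp (seriesSum s z)) 0 := (hE.analyticAt hmem).contDiffAt
  rw [expCoeff, iteratedDeriv_succ', h1.iteratedDeriv_eq, iteratedDeriv_mul c1 c2,
    Finset.mul_sum, Finset.mul_sum]
  refine Finset.sum_congr rfl fun i hi => ?_
  have hik : i ≤ k := by simpa [Nat.lt_succ_iff] using hi
  rw [← iteratedDeriv_succ', iteratedDeriv_seriesSum hs, expCoeff, Nat.cast_choose ℂ hik,
    Nat.factorial_succ, Nat.factorial_succ]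
  have f1 : (k.factorial : ℂ) ≠ 0 := by exact_mod_cast k.factorial_ne_zero
  have f2 : (i.factorial : ℂ) ≠ 0 := by exact_mod_cast i.factorial_ne_zero
  have f3 : ((k - i).factorial : ℂ) ≠ 0 := by exact_mod_cast (k - i).factorial_ne_zero
  have f4 : (k + 1 : ℂ) ≠ 0 := by exact_mod_cast k.succ_ne_zero
  push_cast
  field_simp

/-- The factorization `E⁻ (1 - zφ) = E⁺ (1 - zwφ)`. -/
lemma exp_seriesSum_factorization {s s' : ℕ → ℂ} {B : ℝ} (hs : ∀ k, ‖s k‖ ≤ B)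
    (hs' : ∀ k, ‖s' k‖ ≤ B) {φ w : ℂ} (hφ : ‖φ‖ ≤ 1) (hw : ‖w‖ ≤ 1)
    (h : ∀ k : ℕ, s k - s' k = (φ ^ k - (w * φ) ^ k) / k) {z : ℂ} (hz : ‖z‖ < 1) :
    cexp (seriesSum s z) * (1 - z * φ) = cexp (seriesSum s' z) * (1 - z * (w * φ)) := by
  have hzφ : ‖z * φ‖ < 1 := by
    rw [norm_mul]
    exact lt_of_le_of_lt (mul_le_of_le_one_right (norm_nonneg z) hφ) hz
  have hzw : ‖z * (w * φ)‖ < 1 := by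
    rw [norm_mul, norm_mul]
    exact lt_of_le_of_lt (mul_le_of_le_one_right (norm_nonneg z)
      (mul_le_one₀ hw (norm_nonneg _) hφ)) hz
  have ne : ∀ y : ℂ, ‖y‖ < 1 → 1 - y ≠ 0 := by
    intro y hy h0
    rw [← sub_eq_zero.1 h0, norm_one] at hy
    exact lt_irrefl _ hy
  have h1 := (hasSum_seriesSum hs hz).sub (hasSum_seriesSum hs' hz)
  have h2 := (hasSum_taylorSeries_neg_log hzφ).sub (hasSum_taylorSeries_neg_log hzw)
  have e : (fun k : ℕ => z ^ k * s k - z ^ k * s' k) =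
      fun k : ℕ => (z * φ) ^ k / k - (z * (w * φ)) ^ k / k := by
    ext k
    rw [← mul_sub, h k, mul_pow z φ, mul_pow z (w * φ)]
    ring
  rw [e] at h1
  have h3 := h1.unique h2
  have h4 : seriesSum s z = seriesSum s' z + (-log (1 - z * φ) - -log (1 - z * (w * φ))) := by
    rw [← h3]; ring
  rw [h4, Complex.exp_add, Complex.exp_sub, Complex.exp_neg, Complex.exp_neg,
    Complex.exp_log (ne _ hzφ), Complex.exp_log (ne _ hzw)]
  have := ne _ hzφ
  have := ne _ hzw
  field_simp

/-- The coefficient of z^{k+1} in E⁻ - E⁺ = zφ(E⁻ - wE⁺), a rearrangement of the factorization. This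
is the recursion obeyed by the path densities. -/
lemma expCoeff_relation {s s' : ℕ → ℂ} {B : ℝ} (hs : ∀ k, ‖s k‖ ≤ B)
    (hs' : ∀ k, ‖s' k‖ ≤ B) {φ w : ℂ} (hφ : ‖φ‖ ≤ 1) (hw : ‖w‖ ≤ 1)
    (h : ∀ k : ℕ, s k - s' k = (φ ^ k - (w * φ) ^ k) / k) (k : ℕ) :
    expCoeff s (k + 1) - expCoeff s' (k + 1) = φ * (expCoeff s k - w * expCoeff s' k) := by
  set b : ℕ → ℂ := fun k => Nat.casesOn k (expCoeff s 0 - expCoeff s' 0)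
    fun k => φ * (expCoeff s k - w * expCoeff s' k) with hb
  have hz0 : expCoeff s 0 = expCoeff s' 0 := by
    have h1 := exp_seriesSum_factorization hs hs' hφ hw h (z := 0) (by simp)
    simp only [zero_mul, sub_zero, mul_one] at h1
    simp [expCoeff, h1]
  have h1 := powerSeries_unique (a := fun k => expCoeff s k - expCoeff s' k) (b := b)
    (f := fun z => cexp (seriesSum s z) - cexp (seriesSum s' z)) (fun z hz => ?_) fun z hz => ?_
  · exact congrFun h1 (k + 1)
  · refine ((hasSum_expCoeff hs hz).sub (hasSum_expCoeff hs' hz)).congr_fun fun k => by ring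
  · have h2 := ((hasSum_expCoeff hs hz).sub ((hasSum_expCoeff hs' hz).mul_left w)).mul_left (z * φ)
    rw [← hasSum_nat_add_iff' 1]
    convert! h2 using 1
    · ext k
      simp only [hb]
      ring
    · have := exp_seriesSum_factorization hs hs' hφ hw h hz
      have hb0 : b 0 = 0 := by simp [hb, hz0]
      simp only [Finset.sum_range_one, pow_zero, hb0]
      linear_combination this

end PseudoProcess

namespace PseudoProcess

/-! ### Pseudo-expectations as iterated integrals -/

/-- The functional `w(X_0) ⋯ w(X_{k-1}) G(X_k)` of the discrete path. -/
noncomputable def pathFun (w : ℝ → ℝ) (G : ℝ → ℂ) (k : ℕ) (x : Fin k → ℝ) : ℂ :=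
  (∏ i ∈ Finset.range k, (w (samplePath x i) : ℂ)) * G (samplePath x k)

/-- One step of the weighted pseudo-process: `w(x) ∫ G(y) p(h; x - y) dy`. -/
noncomputable def transferOp (N : ℕ) (h : ℝ) (w : ℝ → ℝ) (G : ℝ → ℂ) (x : ℝ) : ℂ :=
  w x * ∫ y, G y * (heatKernel N h (x - y) : ℂ)

/-- The density of the weighted pseudo-process after `k + 1` steps. -/
noncomputable def stepDensity (N : ℕ) (h : ℝ) (w : ℝ → ℝ) : ℕ → ℝ → ℂ
  | 0, y => w 0 * heatKernel N h y
  | k + 1, y => ∫ t, (w t * stepDensity N h w k t) * (heatKernel N h (y - t) : ℂ)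

lemma measurable_samplePath {k : ℕ} (i : ℕ) : Measurable fun x : Fin k → ℝ => samplePath x i := by
  cases i with
  | zero => exact measurable_const
  | succ i =>
    by_cases h : i < k
    · simp only [samplePath, h, dif_pos]; exact measurable_pi_apply _
    · simp only [samplePath, h, dif_neg, not_false_eq_true]; exact measurable_const

lemma samplePath_snoc {k : ℕ} (x : Fin k → ℝ) (y : ℝ) {i : ℕ} (hi : i ≤ k) :
    samplePath (Fin.snoc x y : Fin (k + 1) → ℝ) i = samplePath x i := by
  cases i with
  | zero => rfl
  | succ i =>
    have h1 : i < k := hi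
    simp [samplePath, h1, h1.trans (Nat.lt_succ_self k), Fin.snoc]

lemma samplePath_snoc_last {k : ℕ} (x : Fin k → ℝ) (y : ℝ) :
    samplePath (Fin.snoc x y : Fin (k + 1) → ℝ) (k + 1) = y := by
  simp [samplePath, Fin.snoc]

/-- The signed density `p(h; X_0 - X_1) ⋯ p(h; X_{k-1} - X_k)` of the discrete path. -/
noncomputable def pathKernel (N : ℕ) (h : ℝ) (k : ℕ) (x : Fin k → ℝ) : ℂ :=
  ∏ i : Fin k, (heatKernel N h (samplePath x i - samplePath x (i + 1)) : ℂ)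

lemma pathKernel_snoc (N : ℕ) (h : ℝ) {k : ℕ} (x : Fin k → ℝ) (y : ℝ) :
    pathKernel N h (k + 1) (Fin.snoc x y : Fin (k + 1) → ℝ) =
      pathKernel N h k x * heatKernel N h (samplePath x k - y) := by
  rw [pathKernel, Fin.prod_univ_castSucc, pathKernel]
  congr 1
  · refine Finset.prod_congr rfl fun i _ => ?_
    rw [Fin.val_castSucc, samplePath_snoc x y i.2.le, samplePath_snoc x y i.2]
  · rw [Fin.val_last, samplePath_snoc x y le_rfl, samplePath_snoc_last]

lemma pathFun_snoc (w : ℝ → ℝ) (G : ℝ → ℂ) {k : ℕ} (x : Fin k → ℝ) (y : ℝ) :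
    pathFun w G (k + 1) (Fin.snoc x y : Fin (k + 1) → ℝ) =
      (∏ i ∈ Finset.range k, (w (samplePath x i) : ℂ)) * w (samplePath x k) * G y := by
  rw [pathFun, Finset.prod_range_succ, samplePath_snoc_last, samplePath_snoc x y le_rfl]
  congr 2
  refine Finset.prod_congr rfl fun i hi => ?_
  rw [samplePath_snoc x y (Finset.mem_range.1 hi).le]

lemma measurable_heatKernel_right (M : ℕ) (h : ℝ) : Measurable fun x => heatKernel (2 * M) h x := by
  have h1 : Measurable fun x : ℝ => (h, x) := by fun_prop
  have h2 := (measurable_heatKernel M).comp h1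
  exact h2

lemma measurable_pathKernel (M : ℕ) (h : ℝ) (k : ℕ) : Measurable (pathKernel (2 * M) h k) := by
  refine Finset.measurable_prod _ fun i _ => Complex.measurable_ofReal.comp ?_
  exact (measurable_heatKernel_right M h).comp
    ((measurable_samplePath _).sub (measurable_samplePath _))

lemma measurable_pathFun {w : ℝ → ℝ} (hw : Measurable w) {G : ℝ → ℂ} (hG : Measurable G) (k : ℕ) :
    Measurable (pathFun w G k) :=
  (Finset.measurable_prod _ fun i _ => Complex.measurable_ofReal.comp
    (hw.comp (measurable_samplePath i))).mul (hG.comp (measurable_samplePath k))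

lemma norm_pathFun_le {w : ℝ → ℝ} {G : ℝ → ℂ} {C : ℝ} (hw : ∀ x, ‖w x‖ ≤ 1) (hC : ∀ x, ‖G x‖ ≤ C)
    (k : ℕ) (x : Fin k → ℝ) : ‖pathFun w G k x‖ ≤ C := by
  rw [pathFun, norm_mul, norm_prod]
  refine (mul_le_of_le_one_left (norm_nonneg _) ?_).trans (hC _)
  exact Finset.prod_le_one (fun _ _ => norm_nonneg _) fun i _ => by rw [norm_real]; exact hw _

lemma piFinSuccAbove_symm_apply {k : ℕ} (p : ℝ × (Fin k → ℝ)) :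
    (MeasurableEquiv.piFinSuccAbove (fun _ : Fin (k + 1) => ℝ) (Fin.last k)).symm p =
      (Fin.snoc p.2 p.1 : Fin (k + 1) → ℝ) := by
  change Fin.insertNth (α := fun _ => ℝ) (Fin.last k) p.1 p.2 = _
  rw [Fin.insertNth_last']

/-- Integrating the new coordinate first, translation invariance replaces the kernel by its L¹ norm,
whatever the shift s. -/
lemma integrable_mul_comp_sub {X : Type*} [MeasureSpace X] [SFinite (volume : Measure X)]
    {p : ℝ → ℝ} (hp : Measurable p) (hpi : Integrable p) {g : X → ℂ} (hg : Measurable g)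
    (hgi : Integrable g) {s : X → ℝ} (hs : Measurable s) :
    Integrable (fun z : ℝ × X => g z.2 * (p (s z.2 - z.1) : ℂ)) (volume.prod volume) := by
  have hm : Measurable fun z : ℝ × X => g z.2 * (p (s z.2 - z.1) : ℂ) := by fun_prop
  have hi := hpi.ofReal (𝕜 := ℂ)
  rw [integrable_prod_iff' hm.aestronglyMeasurable]
  have h1 : ∀ x, Integrable fun y => g x * (p (s x - y) : ℂ) := fun x =>
    (hi.comp_sub_left (s x)).const_mul (g x)
  refine ⟨ae_of_all _ h1, ?_⟩
  simp only [norm_mul]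
  have e : ∀ x : X, ∫ y : ℝ, ‖g x‖ * ‖(p (s x - y) : ℂ)‖ = ‖g x‖ * ∫ y, ‖(p y : ℂ)‖ := by
    intro x
    rw [integral_const_mul, integral_sub_left_eq_self (fun y => ‖(p y : ℂ)‖)]
  simp only [e]
  exact hgi.norm.mul_const _

lemma integrable_pathKernel_prod {M : ℕ} (hM : 1 ≤ M) {h : ℝ} (hh : 0 < h) {k : ℕ}
    (hk : Integrable (pathKernel (2 * M) h k)) :
    Integrable (fun p : ℝ × (Fin k → ℝ) =>
      pathKernel (2 * M) h k p.2 * (heatKernel (2 * M) h (samplePath p.2 k - p.1) : ℂ))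
      (volume.prod volume) := by
  have h1 := integrable_mul_comp_sub (measurable_heatKernel_right M h) (integrable_heatKernel hM hh)
    (measurable_pathKernel M h k) hk (measurable_samplePath k)
  exact h1

lemma integrable_pathKernel {M : ℕ} (hM : 1 ≤ M) {h : ℝ} (hh : 0 < h) (k : ℕ) :
    Integrable (pathKernel (2 * M) h k) := by
  induction k with
  | zero =>
    have : pathKernel (2 * M) h 0 = fun _ => 1 := by ext; simp [pathKernel]
    rw [this, Measure.volume_pi_eq_dirac 0]
    exact integrable_const _
  | succ k ih =>
    have hmp := (volume_preserving_piFinSuccAbove (fun _ : Fin (k + 1) => ℝ) (Fin.last k)).symm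
    rw [← hmp.integrable_comp_emb (MeasurableEquiv.measurableEmbedding _)]
    refine (integrable_pathKernel_prod hM hh ih).congr (ae_of_all _ fun p => ?_)
    simp only [Function.comp_apply]
    rw [piFinSuccAbove_symm_apply, pathKernel_snoc]

lemma measurable_transferOp (M : ℕ) (h : ℝ) {w : ℝ → ℝ} (hw : Measurable w) {G : ℝ → ℂ}
    (hG : Measurable G) : Measurable (transferOp (2 * M) h w G) := by
  have : Measurable fun p : ℝ × ℝ => G p.2 * (heatKernel (2 * M) h (p.1 - p.2) : ℂ) :=
    (hG.comp measurable_snd).mul (Complex.measurable_ofReal.comp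
      ((measurable_heatKernel_right M h).comp (measurable_fst.sub measurable_snd)))
  exact (Complex.measurable_ofReal.comp hw).mul
    (this.stronglyMeasurable.integral_prod_right (ν := volume)).measurable

lemma norm_transferOp_le {M : ℕ} (hM : 1 ≤ M) {h : ℝ} (hh : 0 < h) {w : ℝ → ℝ}
    (hw : ∀ x, ‖w x‖ ≤ 1) {G : ℝ → ℂ} {C : ℝ} (hC : ∀ x, ‖G x‖ ≤ C) (x : ℝ) :
    ‖transferOp (2 * M) h w G x‖ ≤ C * ∫ y, ‖heatKernel (2 * M) h y‖ := by
  rw [transferOp, norm_mul, norm_real]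
  refine (mul_le_of_le_one_left (norm_nonneg _) (hw x)).trans ?_
  have hi := (integrable_heatKernel hM hh)
  have hi2 : Integrable fun y => ‖heatKernel (2 * M) h (x - y)‖ := (hi.comp_sub_left x).norm
  refine (norm_integral_le_of_norm_le (hi2.const_mul C) (ae_of_all _ fun y => ?_)).trans ?_
  · rw [norm_mul, norm_real]
    gcongr
    exact hC y
  · rw [integral_const_mul, integral_sub_left_eq_self (fun y => ‖heatKernel (2 * M) h y‖)]

/-- Integrating out the last position turns the observable G into `transferOp` applied to G, now a
function of the previous position. -/
lemma tameExpectation_pathFun {M : ℕ} (hM : 1 ≤ M) (n : ℕ) {w : ℝ → ℝ} (hwm : Measurable w)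
    (hw : ∀ x, ‖w x‖ ≤ 1) (k : ℕ) {G : ℝ → ℂ} (hG : Measurable G) {C : ℝ} (hC : ∀ x, ‖G x‖ ≤ C) :
    tameExpectation (2 * M) n k (pathFun w G k) = (transferOp (2 * M) (1 / 2 ^ n) w)^[k] G 0 := by
  have hh : (0 : ℝ) < 1 / 2 ^ n := by positivity
  induction k generalizing G C with
  | zero =>
    rw [tameExpectation, Measure.volume_pi_eq_dirac 0, integral_dirac]
    simp [pathFun, samplePath]
  | succ k ih =>
    rw [Function.iterate_succ_apply, ← ih (measurable_transferOp M _ hwm hG)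
      (norm_transferOp_le hM hh hw hC)]
    have hmp := (volume_preserving_piFinSuccAbove (fun _ : Fin (k + 1) => ℝ) (Fin.last k)).symm
    rw [tameExpectation, ← hmp.integral_comp (MeasurableEquiv.measurableEmbedding _)]
    have e : ∀ p : ℝ × (Fin k → ℝ), pathFun w G (k + 1) (Fin.snoc p.2 p.1 : Fin (k + 1) → ℝ) *
        pathKernel (2 * M) (1 / 2 ^ n) (k + 1) (Fin.snoc p.2 p.1 : Fin (k + 1) → ℝ) =
        ((∏ i ∈ Finset.range k, (w (samplePath p.2 i) : ℂ)) * w (samplePath p.2 k) * G p.1) *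
        (pathKernel (2 * M) (1 / 2 ^ n) k p.2 *
          (heatKernel (2 * M) (1 / 2 ^ n) (samplePath p.2 k - p.1) : ℂ)) := by
      intro p
      rw [pathFun_snoc, pathKernel_snoc]
    change ∫ p, pathFun w G (k + 1) _ * pathKernel (2 * M) (1 / 2 ^ n) (k + 1) _ = _
    simp only [piFinSuccAbove_symm_apply, e]
    rw [Measure.volume_eq_prod, integral_prod_symm]
    · refine integral_congr_ae (ae_of_all _ fun x => ?_)
      simp only [pathFun, transferOp]
      rw [← integral_const_mul, ← integral_const_mul, ← integral_mul_const]
      refine integral_congr_ae (ae_of_all _ fun y => ?_)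
      simp only [pathKernel]
      ring
    · refine (integrable_pathKernel_prod hM hh (integrable_pathKernel hM hh k)).bdd_mul (c := C)
        ?_ (ae_of_all _ fun p => ?_)
      · refine Measurable.aestronglyMeasurable (((Finset.measurable_prod _ fun i _ =>
          Complex.measurable_ofReal.comp (hwm.comp ((measurable_samplePath i).comp
            measurable_snd))).mul (Complex.measurable_ofReal.comp (hwm.comp
            ((measurable_samplePath k).comp measurable_snd)))).mul (hG.comp measurable_fst))
      · rw [← Finset.prod_range_succ, norm_mul, norm_prod]
        refine (mul_le_of_le_one_left (norm_nonneg _) ?_).trans (hC _)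
        exact Finset.prod_le_one (fun _ _ => norm_nonneg _) fun i _ => by rw [norm_real]; exact hw _

lemma integrable_mul_bounded {f : ℝ → ℂ} (hf : Integrable f) {w : ℝ → ℝ} (hwm : Measurable w)
    (hw : ∀ x, ‖w x‖ ≤ 1) : Integrable fun t => (w t : ℂ) * f t :=
  hf.bdd_mul (c := 1) (Complex.measurable_ofReal.comp hwm).aestronglyMeasurable
    (ae_of_all _ fun x => by rw [norm_real]; exact hw x)

lemma integrable_stepDensity {M : ℕ} (hM : 1 ≤ M) {h : ℝ} (hh : 0 < h) {w : ℝ → ℝ}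
    (hwm : Measurable w) (hw : ∀ x, ‖w x‖ ≤ 1) (k : ℕ) :
    Integrable (stepDensity (2 * M) h w k) := by
  have hi := (integrable_heatKernel hM hh).ofReal (𝕜 := ℂ)
  induction k with
  | zero => exact hi.const_mul _
  | succ k ih => exact integrable_conv (integrable_mul_bounded ih hwm hw) hi

/-- Passage from the backward operator acting on observables to the forward density, using that the
kernel is even. The index is shifted by one because the law after no step is a point mass without
density. -/
lemma transferOp_iterate_eq {M : ℕ} (hM : 1 ≤ M) {h : ℝ} (hh : 0 < h) {w : ℝ → ℝ}
    (hwm : Measurable w) (hw : ∀ x, ‖w x‖ ≤ 1) (k : ℕ) {G : ℝ → ℂ} (hG : Measurable G) {C : ℝ}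
    (hC : ∀ x, ‖G x‖ ≤ C) :
    (transferOp (2 * M) h w)^[k + 1] G 0 = ∫ y, G y * stepDensity (2 * M) h w k y := by
  have hi := (integrable_heatKernel hM hh).ofReal (𝕜 := ℂ)
  induction k generalizing G C with
  | zero =>
    simp only [zero_add, Function.iterate_one, transferOp, stepDensity, zero_sub, heatKernel_neg]
    rw [← integral_const_mul]
    exact integral_congr_ae (ae_of_all _ fun y => by ring)
  | succ k ih =>
    rw [Function.iterate_succ_apply, ih (measurable_transferOp M _ hwm hG)
      (norm_transferOp_le hM hh hw hC)]
    have hst := integrable_stepDensity hM hh hwm hw k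
    have hc := ((integrable_mul_bounded hst hwm hw).convolution_integrand
      (ContinuousLinearMap.mul ℂ ℂ) hi).bdd_mul (c := C) (f := fun p : ℝ × ℝ => G p.1)
      (hG.comp measurable_fst).aestronglyMeasurable (ae_of_all _ fun p => hC p.1)
    simp only [ContinuousLinearMap.mul_apply'] at hc
    simp only [stepDensity, ← integral_const_mul]
    rw [integral_integral_swap hc]
    refine integral_congr_ae (ae_of_all _ fun x => ?_)
    simp only [transferOp]
    rw [← integral_const_mul, ← integral_mul_const]
    refine integral_congr_ae (ae_of_all _ fun y => ?_)
    simp only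
    rw [← heatKernel_neg, neg_sub]
    ring

end PseudoProcess

namespace PseudoProcess

/-! ### The terms of the discretized functional -/

/-- The indicator of `[0, ∞)`. -/
noncomputable def nonnegInd (x : ℝ) : ℝ := Set.indicator (Set.Ici (0 : ℝ)) (fun _ => (1 : ℝ)) x

/-- The weight `e^{-νh 1_{[0,∞)}(x)}`. -/
noncomputable def sojournWeight (ν h x : ℝ) : ℝ := Real.exp (-(ν * h * nonnegInd x))

/-- `∫_0^h e^{-cr} dr`. -/
noncomputable def expMass (c h : ℝ) : ℝ := (1 - Real.exp (-(c * h))) / c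

lemma measurable_nonnegInd : Measurable nonnegInd := measurable_const.indicator measurableSet_Ici

lemma nonnegInd_nonneg (x : ℝ) : 0 ≤ nonnegInd x := Set.indicator_nonneg (fun _ _ => zero_le_one) _

lemma measurable_sojournWeight (ν h : ℝ) : Measurable (sojournWeight ν h) :=
  Real.measurable_exp.comp ((measurable_nonnegInd.const_mul _).neg)

lemma norm_sojournWeight_le {ν h : ℝ} (hν : 0 ≤ ν) (hh : 0 ≤ h) (x : ℝ) :
    ‖sojournWeight ν h x‖ ≤ 1 := by
  have := nonnegInd_nonneg x
  rw [sojournWeight, Real.norm_of_nonneg (Real.exp_pos _).le, Real.exp_le_one_iff]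
  have : 0 ≤ ν * h * nonnegInd x := by positivity
  linarith

lemma stepProcess_eq (n : ℕ) (X : ℕ → ℝ) {i : ℕ} {u : ℝ} (h1 : (i : ℝ) / 2 ^ n ≤ u)
    (h2 : u < ((i : ℝ) + 1) / 2 ^ n) : stepProcess n X u = X i := by
  have h3 : (0 : ℝ) < 2 ^ n := by positivity
  rw [div_le_iff₀ h3] at h1
  rw [lt_div_iff₀ h3] at h2
  have h4 : ⌊2 ^ n * u⌋₊ = i := by
    have h5 : (0 : ℝ) ≤ i := by positivity
    rw [Nat.floor_eq_iff (by nlinarith)]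
    constructor <;> nlinarith
  rw [stepProcess, h4]

lemma ae_stepProcess_eq (n : ℕ) (X : ℕ → ℝ) (i : ℕ) {t : ℝ} (h1 : (i : ℝ) / 2 ^ n ≤ t)
    (h2 : t ≤ ((i : ℝ) + 1) / 2 ^ n) :
    ∀ᵐ u : ℝ, u ∈ Set.uIoc ((i : ℝ) / 2 ^ n) t → stepProcess n X u = X i := by
  have hne : ∀ᵐ u : ℝ, u ≠ t := by simp [ae_iff]
  filter_upwards [hne] with u hu hmem
  rw [Set.uIoc_of_le h1] at hmem
  exact stepProcess_eq n X hmem.1.le ((lt_of_le_of_ne hmem.2 hu).trans_le h2)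

lemma integral_step (n : ℕ) (X : ℕ → ℝ) (i : ℕ) {t : ℝ} (h1 : (i : ℝ) / 2 ^ n ≤ t)
    (h2 : t ≤ ((i : ℝ) + 1) / 2 ^ n) :
    IntervalIntegrable (fun u => nonnegInd (stepProcess n X u)) volume ((i : ℝ) / 2 ^ n) t ∧
    ∫ u in ((i : ℝ) / 2 ^ n)..t, nonnegInd (stepProcess n X u) =
      (t - (i : ℝ) / 2 ^ n) * nonnegInd (X i) := by
  have h := ae_stepProcess_eq n X i h1 h2
  constructor
  · refine IntervalIntegrable.congr_ae (f := fun _ => nonnegInd (X i)) intervalIntegrable_const ?_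
    refine (ae_restrict_iff' measurableSet_uIoc).2 ?_
    filter_upwards [h] with u hu hmem
    rw [hu hmem]
  · rw [intervalIntegral.integral_congr_ae (g := fun _ => nonnegInd (X i))]
    · rw [intervalIntegral.integral_const, smul_eq_mul]
    · filter_upwards [h] with u hu hmem
      rw [hu hmem]

lemma sojournTime_eq (n : ℕ) (X : ℕ → ℝ) (k : ℕ) {t : ℝ} (h1 : (k : ℝ) / 2 ^ n ≤ t)
    (h2 : t ≤ ((k : ℝ) + 1) / 2 ^ n) :
    sojournTime n X t = ∑ i ∈ Finset.range k, 1 / 2 ^ n * nonnegInd (X i) +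
      (t - (k : ℝ) / 2 ^ n) * nonnegInd (X k) := by
  have hstep : ∀ i : ℕ, (i : ℝ) / 2 ^ n ≤ ((i : ℝ) + 1) / 2 ^ n := fun i => by gcongr; linarith
  have hk : ∀ i : ℕ, IntervalIntegrable (fun u => nonnegInd (stepProcess n X u)) volume
      ((i : ℝ) / 2 ^ n) (((i + 1 : ℕ) : ℝ) / 2 ^ n) := by
    intro i
    push_cast
    exact (integral_step n X i (hstep i) le_rfl).1
  have hsum := intervalIntegral.sum_integral_adjacent_intervals
    (a := fun i : ℕ => (i : ℝ) / 2 ^ n) (n := k) fun i _ => hk i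
  have hall := IntervalIntegrable.trans_iterate (a := fun i : ℕ => (i : ℝ) / 2 ^ n) (n := k)
    fun i _ => hk i
  change ∫ u in (0 : ℝ)..t, nonnegInd (stepProcess n X u) = _
  simp only [Nat.cast_zero, zero_div] at hsum hall
  rw [← intervalIntegral.integral_add_adjacent_intervals hall (integral_step n X k h1 h2).1, ← hsum,
    (integral_step n X k h1 h2).2]
  congr 1
  refine Finset.sum_congr rfl fun i _ => ?_
  push_cast
  rw [(integral_step n X i (hstep i) le_rfl).2]
  ring

/-- The observable of the last position in the discretized functional. -/
noncomputable def endFun (lam ν μ h x : ℝ) : ℂ :=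
  cexp (I * μ * x) * expMass (lam + ν * nonnegInd x) h

/-- On the k-th cell the path stays at X_k, so positions before k enter only through their full-cell
weights. The last position contributes e^{iμX_k} and the integral of e^{-cr} over one cell, with c =
λ or λ + ν according to the sign of X_k. -/
lemma laplaceFourierTerm_eq {lam ν : ℝ} (hlam : 0 < lam) (hν : 0 < ν) (μ : ℝ) (n k : ℕ)
    (x : Fin k → ℝ) : laplaceFourierTerm lam μ ν n k x =
      cexp (-(lam * (1 / 2 ^ n : ℝ))) ^ k *
        pathFun (sojournWeight ν (1 / 2 ^ n)) (endFun lam ν μ (1 / 2 ^ n)) k x := by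
  set h : ℝ := 1 / 2 ^ n with hh
  set X := samplePath x with hX
  have hle : (k : ℝ) / 2 ^ n ≤ ((k : ℝ) + 1) / 2 ^ n := by gcongr; linarith
  have hkh : (k : ℝ) / 2 ^ n = k * h := by rw [hh]; ring
  have hkh1 : ((k : ℝ) + 1) / 2 ^ n = k * h + h := by rw [hh]; ring
  set c : ℝ := lam + ν * nonnegInd (X k) with hc
  have hc0 : 0 < c := by
    have := nonnegInd_nonneg (X k)
    positivity
  have h1 : laplaceFourierTerm lam μ ν n k x = ∫ t in ((k : ℝ) / 2 ^ n)..(((k : ℝ) + 1) / 2 ^ n),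
      cexp (-(lam * h)) ^ k * (∏ i ∈ Finset.range k, (sojournWeight ν h (X i) : ℂ)) *
        cexp (I * μ * X k) * cexp (-(c : ℂ) * (t - k * h : ℝ)) := by
    rw [laplaceFourierTerm]
    refine intervalIntegral.integral_congr_ae ?_
    filter_upwards [ae_stepProcess_eq n X k hle le_rfl] with t ht hmem
    rw [ht hmem]
    rw [Set.uIoc_of_le hle] at hmem
    rw [sojournTime_eq n X k hmem.1.le hmem.2]
    simp only [sojournWeight]
    push_cast
    rw [← Complex.exp_sum, ← Complex.exp_nat_mul, ← Complex.exp_add, ← Complex.exp_add,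
      ← Complex.exp_add]
    congr 1
    rw [Finset.sum_neg_distrib, hc]
    simp only [mul_assoc (ν : ℂ), ← Finset.mul_sum]
    have e2 : (1 / 2 ^ n : ℂ) = h := by rw [hh]; push_cast; ring
    have e3 : (k / 2 ^ n : ℂ) = k * h := by rw [hh]; push_cast; ring
    rw [e2, e3]
    push_cast
    ring
  rw [h1, intervalIntegral.integral_const_mul, pathFun, endFun, ← hX, ← hc]
  have h2 : ∫ t in ((k : ℝ) / 2 ^ n)..(((k : ℝ) + 1) / 2 ^ n), cexp (-(c : ℂ) * (t - k * h : ℝ)) =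
      expMass c h := by
    rw [hkh, hkh1, intervalIntegral.integral_comp_sub_right (fun r : ℝ => cexp (-(c : ℂ) * r)),
      integral_exp_mul_complex (by simpa using hc0.ne'), expMass, sub_self, add_sub_cancel_left]
    have : (c : ℂ) ≠ 0 := by exact_mod_cast hc0.ne'
    push_cast
    simp only [mul_zero, Complex.exp_zero]
    rw [neg_mul]
    field_simp
    ring
  rw [h2]
  ring

lemma measurable_endFun (lam ν μ h : ℝ) : Measurable (endFun lam ν μ h) := by
  have := measurable_nonnegInd
  unfold endFun expMass
  fun_prop

lemma norm_endFun_le {lam ν : ℝ} (hlam : 0 < lam) (hν : 0 < ν) (μ : ℝ) {h : ℝ} (hh : 0 < h) (x : ℝ) :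
    ‖endFun lam ν μ h x‖ ≤ 1 / lam := by
  have h0 := nonnegInd_nonneg x
  have h1 : lam ≤ lam + ν * nonnegInd x := le_add_of_nonneg_right (by positivity)
  have h2 : 0 < lam + ν * nonnegInd x := by positivity
  rw [endFun, norm_mul, norm_exp_I_mul, one_mul, norm_real, expMass, Real.norm_of_nonneg]
  · gcongr
    linarith [Real.exp_pos (-((lam + ν * nonnegInd x) * h))]
  · refine div_nonneg ?_ h2.le
    rw [sub_nonneg, Real.exp_le_one_iff]
    have : 0 ≤ (lam + ν * nonnegInd x) * h := by positivity
    linarith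

lemma isTame_laplaceFourierTerm {lam ν : ℝ} (hlam : 0 < lam) (hν : 0 < ν) (μ : ℝ) (n k : ℕ) :
    IsTame (laplaceFourierTerm lam μ ν n k) := by
  have e : laplaceFourierTerm lam μ ν n k = fun x => cexp (-(lam * (1 / 2 ^ n : ℝ))) ^ k *
        pathFun (sojournWeight ν (1 / 2 ^ n)) (endFun lam ν μ (1 / 2 ^ n)) k x :=
    funext (laplaceFourierTerm_eq hlam hν μ n k)
  have hh : (0 : ℝ) < 1 / 2 ^ n := by positivity
  rw [e]
  refine ⟨(measurable_pathFun (measurable_sojournWeight _ _) (measurable_endFun _ _ _ _) k).const_mul _,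
    ‖cexp (-(lam * (1 / 2 ^ n : ℝ))) ^ k‖ * (1 / lam), fun x => ?_⟩
  rw [norm_mul]
  gcongr
  exact norm_pathFun_le (norm_sojournWeight_le hν.le hh.le) (norm_endFun_le hlam hν μ hh) k x

lemma tameExpectation_laplaceFourierTerm {M : ℕ} (hM : 1 ≤ M) {lam ν : ℝ} (hlam : 0 < lam)
    (hν : 0 < ν) (μ : ℝ) (n k : ℕ) :
    tameExpectation (2 * M) n k (laplaceFourierTerm lam μ ν n k) =
      cexp (-(lam * (1 / 2 ^ n : ℝ))) ^ k *
        (transferOp (2 * M) (1 / 2 ^ n) (sojournWeight ν (1 / 2 ^ n)))^[k]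
          (endFun lam ν μ (1 / 2 ^ n)) 0 := by
  have hh : (0 : ℝ) < 1 / 2 ^ n := by positivity
  rw [← tameExpectation_pathFun hM n (measurable_sojournWeight _ _)
    (norm_sojournWeight_le hν.le hh.le) k (measurable_endFun _ _ _ _) (norm_endFun_le hlam hν μ hh),
    tameExpectation, tameExpectation, ← integral_const_mul]
  refine integral_congr_ae (ae_of_all _ fun x => ?_)
  simp only [laplaceFourierTerm_eq hlam hν]
  ring

end PseudoProcess

namespace PseudoProcess

/-! ### The discrete Wiener-Hopf factorization -/

/-- Strong induction along `expCoeff_succ`. -/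
lemma isHalfTransform_expCoeff {S : Set ℝ} (hS : ∀ x ∈ S, ∀ y ∈ S, x + y ∈ S) {s : ℕ → ℝ → ℂ}
    {B : ℝ} (hb : ∀ μ k, ‖s k μ‖ ≤ B) (h0 : ∀ μ, s 0 μ = 0)
    (hs : ∀ k, IsHalfTransform S (s (k + 1))) (k : ℕ) :
    IsHalfTransform S fun μ => expCoeff (fun j => s j μ) (k + 1) := by
  induction k using Nat.strong_induction_on with
  | _ k ih =>
    have e : (fun μ => expCoeff (fun j => s j μ) (k + 1)) = fun μ => (k + 1 : ℂ)⁻¹ *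
        ∑ i ∈ Finset.range (k + 1), (i + 1) * s (i + 1) μ * expCoeff (fun j => s j μ) (k - i) :=
      funext fun μ => expCoeff_succ (hb μ) k
    rw [e]
    refine IsHalfTransform.const_mul (IsHalfTransform.sum fun i hi => ?_) _
    have h1 : IsHalfTransform S fun μ => ((i : ℂ) + 1) * s (i + 1) μ := (hs i).const_mul _
    -- The term i = k carries the coefficient of order 0, the constant 1. It is the transform of no
    -- integrable function and must be removed before using the product rule.
    rcases Nat.eq_or_lt_of_le (Nat.lt_succ_iff.1 (Finset.mem_range.1 hi)) with h | h
    · have e2 : ∀ μ, expCoeff (fun j => s j μ) (k - i) = 1 := by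
        intro μ
        rw [h, Nat.sub_self]
        exact expCoeff_zero (h0 μ)
      simpa only [e2, mul_one] using h1
    · have h2 := ih (k - i - 1) (by omega)
      rw [show k - i - 1 + 1 = k - i by omega] at h2
      exact h1.mul hS h2

/-- `∫_S e^{iμx} p(t;x) dx`. -/
noncomputable def halfHeat (M : ℕ) (S : Set ℝ) (t μ : ℝ) : ℂ :=
  ∫ x in S, cexp (I * μ * x) * heatKernel (2 * M) t x

lemma norm_halfHeat_le {M : ℕ} (hM : 1 ≤ M) (S : Set ℝ) {t : ℝ} (ht : 0 < t) (μ : ℝ) :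
    ‖halfHeat M S t μ‖ ≤ ∫ x, ‖heatKernel (2 * M) 1 x‖ := by
  have hi := (integrable_heatKernel hM ht)
  rw [← integral_norm_heatKernel hM ht]
  refine (norm_integral_le_integral_norm _).trans ?_
  simp only [norm_mul, norm_exp_I_mul, one_mul, norm_real]
  exact setIntegral_le_integral hi.norm (ae_of_all _ fun x => norm_nonneg _)

lemma isHalfTransform_halfHeat {M : ℕ} (hM : 1 ≤ M) {S : Set ℝ} (hS : MeasurableSet S) {t : ℝ}
    (ht : 0 < t) : IsHalfTransform S (halfHeat M S t) :=
  IsHalfTransform.of_setIntegral (g := fun x => (heatKernel (2 * M) t x : ℂ))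
    ((integrable_heatKernel hM ht).ofReal (𝕜 := ℂ)).integrableOn hS fun _ => rfl

lemma integral_Ici_add_Iio {f : ℝ → ℂ} (hf : Integrable f) :
    (∫ x in Set.Ici (0 : ℝ), f x) + ∫ x in Set.Iio (0 : ℝ), f x = ∫ x, f x := by
  have := integral_add_compl (measurableSet_Ici (a := (0 : ℝ))) hf
  rwa [Set.compl_Ici] at this

lemma halfHeat_add {M : ℕ} (hM : 1 ≤ M) {t : ℝ} (ht : 0 < t) (μ : ℝ) :
    halfHeat M (Set.Ici 0) t μ + halfHeat M (Set.Iio 0) t μ = cexp (-(t * μ ^ (2 * M))) := by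
  rw [← integral_exp_mul_heatKernel hM ht]
  exact integral_Ici_add_Iio (integrable_exp_mul ((integrable_heatKernel hM ht).ofReal (𝕜 := ℂ)) μ)

/-- The coefficients of the logarithm of the factor `E⁻`. -/
noncomputable def logCoeffMinus (M : ℕ) (ν h μ : ℝ) (k : ℕ) : ℂ :=
  ((1 - Real.exp (-(ν * h)) ^ k) / k : ℝ) * halfHeat M (Set.Iio 0) (k * h) μ

/-- The coefficients of the logarithm of the factor `E⁺`. -/
noncomputable def logCoeffPlus (M : ℕ) (ν h μ : ℝ) (k : ℕ) : ℂ :=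
  -((1 - Real.exp (-(ν * h)) ^ k) / k : ℝ) * halfHeat M (Set.Ici 0) (k * h) μ

lemma exp_neg_mul_mem {ν h : ℝ} (hν : 0 < ν) (hh : 0 < h) :
    0 < Real.exp (-(ν * h)) ∧ Real.exp (-(ν * h)) < 1 := by
  have := mul_pos hν hh
  exact ⟨Real.exp_pos _, by rw [Real.exp_lt_one_iff]; linarith⟩

lemma norm_logFactor_le {ν h : ℝ} (hν : 0 < ν) (hh : 0 < h) (k : ℕ) :
    ‖(((1 - Real.exp (-(ν * h)) ^ k) / k : ℝ) : ℂ)‖ ≤ 1 := by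
  obtain ⟨h1, h2⟩ := exp_neg_mul_mem hν hh
  have h3 : Real.exp (-(ν * h)) ^ k ≤ 1 := pow_le_one₀ h1.le h2.le
  have h4 : 0 ≤ Real.exp (-(ν * h)) ^ k := by positivity
  rw [norm_real, Real.norm_of_nonneg (div_nonneg (by linarith) (by positivity))]
  rcases Nat.eq_zero_or_pos k with rfl | hk
  · simp
  · have : (1 : ℝ) ≤ k := by exact_mod_cast hk
    rw [div_le_one (by positivity)]
    linarith

lemma norm_logCoeffMinus_le {M : ℕ} (hM : 1 ≤ M) {ν h : ℝ} (hν : 0 < ν) (hh : 0 < h) (μ : ℝ)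
    (k : ℕ) : ‖logCoeffMinus M ν h μ k‖ ≤ ∫ x, ‖heatKernel (2 * M) 1 x‖ := by
  rcases Nat.eq_zero_or_pos k with rfl | hk
  · simp only [logCoeffMinus, pow_zero, sub_self, zero_div, ofReal_zero, zero_mul, norm_zero]
    exact integral_nonneg fun _ => norm_nonneg _
  · rw [logCoeffMinus, norm_mul]
    have hk' : (0 : ℝ) < k := by exact_mod_cast hk
    exact (mul_le_of_le_one_left (norm_nonneg _) (norm_logFactor_le hν hh k)).trans
      (norm_halfHeat_le hM _ (by positivity) μ)

lemma norm_logCoeffPlus_le {M : ℕ} (hM : 1 ≤ M) {ν h : ℝ} (hν : 0 < ν) (hh : 0 < h) (μ : ℝ)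
    (k : ℕ) : ‖logCoeffPlus M ν h μ k‖ ≤ ∫ x, ‖heatKernel (2 * M) 1 x‖ := by
  rcases Nat.eq_zero_or_pos k with rfl | hk
  · simp only [logCoeffPlus, pow_zero, sub_self, zero_div, ofReal_zero, neg_zero, zero_mul, norm_zero]
    exact integral_nonneg fun _ => norm_nonneg _
  · rw [logCoeffPlus, norm_mul, norm_neg]
    have hk' : (0 : ℝ) < k := by exact_mod_cast hk
    exact (mul_le_of_le_one_left (norm_nonneg _) (norm_logFactor_le hν hh k)).trans
      (norm_halfHeat_le hM _ (by positivity) μ)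

/-- The two half-line transforms of p(kh;·) add up to φ^k. So log E⁻ - log E⁺ is the series of
-log(1 - zφ) + log(1 - zwφ), the hypothesis of `exp_seriesSum_factorization`. -/
lemma logCoeff_sub {M : ℕ} (hM : 1 ≤ M) {ν h : ℝ} (hh : 0 < h) (μ : ℝ) (k : ℕ) :
    logCoeffMinus M ν h μ k - logCoeffPlus M ν h μ k =
      (cexp (-(h * μ ^ (2 * M))) ^ k -
        ((Real.exp (-(ν * h)) : ℂ) * cexp (-(h * μ ^ (2 * M)))) ^ k) / k := by
  rcases Nat.eq_zero_or_pos k with rfl | hk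
  · simp [logCoeffMinus, logCoeffPlus]
  · have hk' : (0 : ℝ) < k := by exact_mod_cast hk
    have h1 := halfHeat_add hM (show 0 < k * h by positivity) μ
    have h2 : cexp (-((k * h : ℝ) * (μ : ℂ) ^ (2 * M))) = cexp (-(h * μ ^ (2 * M))) ^ k := by
      rw [← Complex.exp_nat_mul]; push_cast; ring_nf
    rw [h2] at h1
    rw [logCoeffMinus, logCoeffPlus, mul_pow, ← h1]
    push_cast
    ring

lemma norm_exp_neg_pow_le (M : ℕ) {h : ℝ} (hh : 0 < h) (μ : ℝ) :
    ‖cexp (-(h * (μ : ℂ) ^ (2 * M)))‖ ≤ 1 := by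
  rw [show -((h : ℂ) * (μ : ℂ) ^ (2 * M)) = ((-(h * μ ^ (2 * M)) : ℝ) : ℂ) by push_cast; ring,
    norm_exp_ofReal, Real.exp_le_one_iff, neg_nonpos]
  have : 0 ≤ μ ^ (2 * M) := (even_two_mul M).pow_nonneg μ
  positivity

lemma sojournWeight_of_nonneg (ν h : ℝ) {x : ℝ} (hx : 0 ≤ x) :
    sojournWeight ν h x = Real.exp (-(ν * h)) := by
  simp [sojournWeight, nonnegInd, hx]

lemma sojournWeight_of_neg (ν h : ℝ) {x : ℝ} (hx : x < 0) : sojournWeight ν h x = 1 := by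
  simp [sojournWeight, nonnegInd, hx]

/-- A formula for the transform over the whole line determines the transforms over both half-lines:
the two coefficients come from functions living on opposite half-lines, and such a decomposition is
unique. -/
lemma stepDensity_transform_of_sum {M : ℕ} (hM : 1 ≤ M) {ν h : ℝ} (hν : 0 < ν) (hh : 0 < h)
    (k : ℕ) (c : ℂ)
    (key : ∀ μ : ℝ, ∫ x : ℝ, cexp (I * μ * x) * stepDensity (2 * M) h (sojournWeight ν h) k x =
      c * (expCoeff (logCoeffMinus M ν h μ) (k + 1) - expCoeff (logCoeffPlus M ν h μ) (k + 1))) :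
    (∀ μ : ℝ, ∫ x in Set.Ici (0 : ℝ), cexp (I * μ * x) *
      stepDensity (2 * M) h (sojournWeight ν h) k x =
        -c * expCoeff (logCoeffPlus M ν h μ) (k + 1)) ∧
    (∀ μ : ℝ, ∫ x in Set.Iio (0 : ℝ), cexp (I * μ * x) *
      stepDensity (2 * M) h (sojournWeight ν h) k x =
        c * expCoeff (logCoeffMinus M ν h μ) (k + 1)) := by
  have hst := integrable_stepDensity hM hh (measurable_sojournWeight ν h)
    (norm_sojournWeight_le hν.le hh.le) k
  have hplus : IsHalfTransform (Set.Ici 0) fun μ => -c *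
      expCoeff (logCoeffPlus M ν h μ) (k + 1) := by
    refine (isHalfTransform_expCoeff (s := fun j μ => logCoeffPlus M ν h μ j)
      (fun x hx y hy => add_nonneg hx hy) (fun μ k => norm_logCoeffPlus_le hM hν hh μ k)
      (fun μ => by simp [logCoeffPlus]) (fun j => ?_) k).const_mul _
    exact (isHalfTransform_halfHeat hM measurableSet_Ici (by push_cast; positivity)).const_mul _
  have hminus : IsHalfTransform (Set.Iio 0) fun μ => c *
      expCoeff (logCoeffMinus M ν h μ) (k + 1) := by
    refine (isHalfTransform_expCoeff (s := fun j μ => logCoeffMinus M ν h μ j)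
      (fun x hx y hy => Set.mem_Iio.2 (add_neg (Set.mem_Iio.1 hx) (Set.mem_Iio.1 hy)))
      (fun μ k => norm_logCoeffMinus_le hM hν hh μ k)
      (fun μ => by simp [logCoeffMinus]) (fun j => ?_) k).const_mul _
    exact (isHalfTransform_halfHeat hM measurableSet_Iio (by push_cast; positivity)).const_mul _
  have hp : IsHalfTransform (Set.Ici 0) fun μ => ∫ x in Set.Ici (0 : ℝ), cexp (I * μ * x) *
      stepDensity (2 * M) h (sojournWeight ν h) k x :=
    IsHalfTransform.of_setIntegral hst.integrableOn measurableSet_Ici fun _ => rfl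
  have hm : IsHalfTransform (Set.Iio 0) fun μ => ∫ x in Set.Iio (0 : ℝ), cexp (I * μ * x) *
      stepDensity (2 * M) h (sojournWeight ν h) k x :=
    IsHalfTransform.of_setIntegral hst.integrableOn measurableSet_Iio fun _ => rfl
  have hu := IsHalfTransform.unique hp hplus hm hminus fun μ => by
    rw [integral_Ici_add_Iio (integrable_exp_mul hst μ), key μ]; ring
  exact ⟨congrFun hu.1, congrFun hu.2⟩

lemma integral_exp_mul_weighted {ν h : ℝ} {f : ℝ → ℂ} (hν : 0 ≤ ν) (hh : 0 ≤ h)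
    (hf : Integrable f) (μ : ℝ) :
    ∫ x : ℝ, cexp (I * μ * x) * (sojournWeight ν h x * f x) =
      Real.exp (-(ν * h)) * (∫ x in Set.Ici (0 : ℝ), cexp (I * μ * x) * f x) +
        ∫ x in Set.Iio (0 : ℝ), cexp (I * μ * x) * f x := by
  rw [← integral_Ici_add_Iio (integrable_exp_mul (integrable_mul_bounded hf
    (measurable_sojournWeight ν h) (norm_sojournWeight_le hν hh)) μ), ← integral_const_mul]
  congr 1
  · refine setIntegral_congr_fun measurableSet_Ici fun x hx => ?_
    rw [sojournWeight_of_nonneg ν h hx]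
    ring
  · refine setIntegral_congr_fun measurableSet_Iio fun x hx => ?_
    rw [sojournWeight_of_neg ν h hx]
    push_cast
    ring

/-- Let f_k be the transform of the density after k + 1 steps and c = w/(1 - w). Splitting f_k at 0
gives -c e⁺_{k+1} and c e⁻_{k+1}. The next step weights the first part by w and multiplies by φ,
which yields cφ(e⁻_{k+1} - w e⁺_{k+1}), and `expCoeff_relation` closes the induction. -/
lemma integral_stepDensity {M : ℕ} (hM : 1 ≤ M) {ν h : ℝ} (hν : 0 < ν) (hh : 0 < h) (k : ℕ)
    (μ : ℝ) : ∫ x : ℝ, cexp (I * μ * x) * stepDensity (2 * M) h (sojournWeight ν h) k x =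
      (Real.exp (-(ν * h)) / (1 - Real.exp (-(ν * h))) : ℂ) *
        (expCoeff (logCoeffMinus M ν h μ) (k + 1) - expCoeff (logCoeffPlus M ν h μ) (k + 1)) := by
  obtain ⟨hw0, hw1⟩ := exp_neg_mul_mem hν hh
  set w : ℝ := Real.exp (-(ν * h)) with hw
  have hw1' : (1 : ℂ) - w ≠ 0 := by
    rw [← ofReal_one, ← ofReal_sub, ofReal_ne_zero]; linarith
  have hwn : ‖(w : ℂ)‖ ≤ 1 := by rw [norm_real, Real.norm_of_nonneg hw0.le]; exact hw1.le
  have hwm := measurable_sojournWeight ν h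
  have hwb := norm_sojournWeight_le hν.le hh.le
  have hrel := fun μ : ℝ => expCoeff_relation (norm_logCoeffMinus_le hM hν hh μ)
    (norm_logCoeffPlus_le hM hν hh μ) (norm_exp_neg_pow_le M hh μ) hwn (logCoeff_sub hM hh μ)
  have hheat : Integrable fun x => (heatKernel (2 * M) h x : ℂ) :=
    (integrable_heatKernel hM hh).ofReal (𝕜 := ℂ)
  have hst := integrable_stepDensity hM hh hwm hwb
  induction k generalizing μ with
  | zero =>
    rw [hrel μ 0, expCoeff_zero (by simp [logCoeffMinus]), expCoeff_zero (by simp [logCoeffPlus])]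
    simp only [stepDensity, sojournWeight_of_nonneg ν h le_rfl, ← hw, mul_left_comm _ (w : ℂ)]
    rw [integral_const_mul, integral_exp_mul_heatKernel hM hh]
    field_simp
  | succ k ih =>
    obtain ⟨h1, h2⟩ := stepDensity_transform_of_sum hM hν hh k _ ih
    simp only [stepDensity]
    rw [integral_exp_mul_conv (integrable_mul_bounded (hst k) hwm hwb) hheat,
      integral_exp_mul_heatKernel hM hh, integral_exp_mul_weighted hν.le hh.le (hst k), h1, h2,
      hrel μ (k + 1), ← hw]
    ring

/-- The sum of the transforms of the discretized pseudo-process. -/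
theorem hasSum_tameExpectation {M : ℕ} (hM : 1 ≤ M) {lam ν : ℝ} (hlam : 0 < lam) (hν : 0 < ν)
    (μ : ℝ) (n : ℕ) {h : ℝ} (hh : h = 1 / 2 ^ n) :
    HasSum (fun k => tameExpectation (2 * M) n k (laplaceFourierTerm lam μ ν n k))
      (expMass (lam + ν) h + (Real.exp (-(ν * h)) / (1 - Real.exp (-(ν * h))) : ℂ) *
        (expMass lam h * (cexp (seriesSum (logCoeffMinus M ν h μ) (cexp (-(lam * h)))) - 1) -
        expMass (lam + ν) h *
          (cexp (seriesSum (logCoeffPlus M ν h μ) (cexp (-(lam * h)))) - 1))) := by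
  have hh0 : 0 < h := by rw [hh]; positivity
  set c : ℂ := (Real.exp (-(ν * h)) / (1 - Real.exp (-(ν * h))) : ℂ) with hc
  set z : ℂ := cexp (-(lam * h)) with hz
  have hz1 : ‖z‖ < 1 := by
    rw [hz, show -((lam : ℂ) * h) = ((-(lam * h) : ℝ) : ℂ) by push_cast; ring, norm_exp_ofReal]
    exact (exp_neg_mul_mem hlam hh0).2
  have hwm := measurable_sojournWeight ν h
  have hwb := norm_sojournWeight_le hν.le hh0.le
  -- The mass of the last cell is constant on each half-line, with rate λ + ν on [0,∞) and λ on
  -- (-∞,0), so only the two half-line transforms are needed.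
  have e : ∀ k : ℕ, tameExpectation (2 * M) n (k + 1) (laplaceFourierTerm lam μ ν n (k + 1)) =
      c * (expMass lam h * (z ^ (k + 1) * expCoeff (logCoeffMinus M ν h μ) (k + 1)) -
        expMass (lam + ν) h * (z ^ (k + 1) * expCoeff (logCoeffPlus M ν h μ) (k + 1))) := by
    intro k
    obtain ⟨h1, h2⟩ := stepDensity_transform_of_sum hM hν hh0 k _
      (integral_stepDensity hM hν hh0 k)
    have hst := integrable_stepDensity hM hh0 hwm hwb k
    rw [tameExpectation_laplaceFourierTerm hM hlam hν, ← hh,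
      transferOp_iterate_eq hM hh0 hwm hwb k (measurable_endFun _ _ _ _)
      (norm_endFun_le hlam hν μ hh0), ← integral_Ici_add_Iio (hst.bdd_mul
        (measurable_endFun _ _ _ _).aestronglyMeasurable
        (ae_of_all _ (norm_endFun_le hlam hν μ hh0)))]
    have k1 : ∫ x in Set.Ici (0 : ℝ), endFun lam ν μ h x *
        stepDensity (2 * M) h (sojournWeight ν h) k x = expMass (lam + ν) h *
          (-c * expCoeff (logCoeffPlus M ν h μ) (k + 1)) := by
      rw [← h1 μ, ← integral_const_mul]
      refine setIntegral_congr_fun measurableSet_Ici fun x hx => ?_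
      have hx' : (0 : ℝ) ≤ x := hx
      simp only [endFun, nonnegInd, Set.indicator_of_mem hx, mul_one]
      ring
    have k2 : ∫ x in Set.Iio (0 : ℝ), endFun lam ν μ h x *
        stepDensity (2 * M) h (sojournWeight ν h) k x = expMass lam h *
          (c * expCoeff (logCoeffMinus M ν h μ) (k + 1)) := by
      rw [← h2 μ, ← integral_const_mul]
      refine setIntegral_congr_fun measurableSet_Iio fun x hx => ?_
      have hx' : ¬ x ∈ Set.Ici (0 : ℝ) := by simpa using hx
      simp only [endFun, nonnegInd, Set.indicator_of_notMem hx', mul_zero, add_zero]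
      ring
    rw [k1, k2]
    ring
  -- The starting point 0 belongs to [0,∞), so the first cell has rate λ + ν.
  have e0 : tameExpectation (2 * M) n 0 (laplaceFourierTerm lam μ ν n 0) = expMass (lam + ν) h := by
    rw [tameExpectation_laplaceFourierTerm hM hlam hν, ← hh]
    simp [endFun, nonnegInd]
  rw [← hasSum_nat_add_iff' 1]
  simp only [e, Finset.sum_range_one, e0, add_sub_cancel_left]
  have hshift : ∀ s : ℕ → ℂ, (∃ B : ℝ, ∀ k, ‖s k‖ ≤ B) → s 0 = 0 →
      HasSum (fun k => z ^ (k + 1) * expCoeff s (k + 1)) (cexp (seriesSum s z) - 1) := by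
    rintro s ⟨B, hB⟩ h0
    have h1 := (hasSum_nat_add_iff' 1).2 (hasSum_expCoeff hB hz1)
    simpa [expCoeff_zero h0] using h1
  exact (((hshift _ ⟨_, norm_logCoeffMinus_le hM hν hh0 μ⟩ (by simp [logCoeffMinus])).mul_left _).sub
    ((hshift _ ⟨_, norm_logCoeffPlus_le hM hν hh0 μ⟩ (by simp [logCoeffPlus])).mul_left _)).mul_left c

end PseudoProcess

namespace PseudoProcess

/-! ### Passage to the limit -/

lemma le_mul_ceil_div {h : ℝ} (hh : 0 < h) (t : ℝ) : t ≤ h * ⌈t / h⌉₊ := by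
  have := Nat.le_ceil (t / h)
  rwa [div_le_iff₀' hh] at this

lemma measurable_comp_ceil (f : ℝ → ℂ) (h : ℝ) : Measurable fun t : ℝ => f (h * ⌈t / h⌉₊) := by
  have h1 : Measurable fun t : ℝ => ⌈t / h⌉₊ := Nat.measurable_ceil.comp (measurable_id.div_const h)
  have h2 : Measurable fun n : ℕ => f (h * n) := measurable_from_top
  exact h2.comp h1

lemma norm_comp_ceil_le {f : ℝ → ℂ} {C lam : ℝ} (hC : 0 ≤ C) (hlam : 0 < lam)
    (hb : ∀ t : ℝ, 0 < t → ‖f t‖ ≤ C * Real.exp (-(lam * t))) {h : ℝ} (hh : 0 < h) {t : ℝ}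
    (ht : 0 < t) : ‖f (h * ⌈t / h⌉₊)‖ ≤ C * Real.exp (-(lam * t)) := by
  have h1 := le_mul_ceil_div hh t
  refine (hb _ (ht.trans_le h1)).trans ?_
  gcongr

lemma integrableOn_exp_neg {lam : ℝ} (hlam : 0 < lam) (C : ℝ) :
    IntegrableOn (fun t : ℝ => C * Real.exp (-(lam * t))) (Set.Ioi 0) := by
  have := (integrableOn_exp_mul_Ioi (a := -lam) (by linarith) 0).const_mul C
  simp only [neg_mul] at this
  exact this

/-- The sum over right endpoints is the integral of the step function f(h⌈t/h⌉). Since h⌈t/h⌉ ≥ t,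
the exponential bound on f dominates all these step functions at once. -/
lemma hasSum_riemann {f : ℝ → ℂ} {C lam : ℝ} (hC : 0 ≤ C) (hlam : 0 < lam)
    (hb : ∀ t : ℝ, 0 < t → ‖f t‖ ≤ C * Real.exp (-(lam * t))) {h : ℝ} (hh : 0 < h) :
    HasSum (fun k : ℕ => (h : ℂ) * f ((k + 1 : ℕ) * h))
      (∫ t in Set.Ioi (0 : ℝ), f (h * ⌈t / h⌉₊)) := by
  have hunion : (⋃ k : ℕ, Set.Ioc ((k : ℝ) * h) ((k + 1 : ℕ) * h)) = Set.Ioi (0 : ℝ) := by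
    ext t
    simp only [Set.mem_iUnion, Set.mem_Ioc, Set.mem_Ioi]
    constructor
    · rintro ⟨k, h1, -⟩
      exact lt_of_le_of_lt (by positivity) h1
    · intro ht
      have h1 : 0 < ⌈t / h⌉₊ := Nat.ceil_pos.2 (by positivity)
      refine ⟨⌈t / h⌉₊ - 1, ?_, ?_⟩
      · rw [← lt_div_iff₀ hh]
        exact Nat.lt_ceil.1 (by omega)
      · rw [Nat.sub_add_cancel h1, mul_comm]
        exact le_mul_ceil_div hh t
  have hval : ∀ k : ℕ, ∀ t ∈ Set.Ioc ((k : ℝ) * h) ((k + 1 : ℕ) * h), ⌈t / h⌉₊ = k + 1 := by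
    intro k t ht
    rw [Nat.ceil_eq_iff (by omega)]
    exact ⟨by rw [lt_div_iff₀ hh]; simpa using ht.1, by rw [div_le_iff₀ hh]; exact ht.2⟩
  have hdisj : Pairwise (Function.onFun Disjoint
      fun k : ℕ => Set.Ioc ((k : ℝ) * h) ((k + 1 : ℕ) * h)) := by
    intro i j hij
    refine Set.disjoint_left.2 fun t hi hj => hij ?_
    have := (hval i t hi).symm.trans (hval j t hj)
    omega
  have hint : IntegrableOn (fun t : ℝ => f (h * ⌈t / h⌉₊))
      (⋃ k : ℕ, Set.Ioc ((k : ℝ) * h) ((k + 1 : ℕ) * h)) := by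
    rw [hunion]
    exact Integrable.mono' (integrableOn_exp_neg hlam C)
      (measurable_comp_ceil f h).aestronglyMeasurable
      ((ae_restrict_mem measurableSet_Ioi).mono fun t ht => norm_comp_ceil_le hC hlam hb hh ht)
  have hs := hasSum_integral_iUnion (fun k => measurableSet_Ioc) hdisj hint
  rw [hunion] at hs
  refine hs.congr_fun fun k => ?_
  rw [setIntegral_congr_fun (g := fun _ => f ((k + 1 : ℕ) * h)) measurableSet_Ioc fun t ht => by
    simp only [hval k t ht, mul_comm h]]
  rw [setIntegral_const, Measure.real, Real.volume_Ioc,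
    show ((k + 1 : ℕ) : ℝ) * h - k * h = h by push_cast; ring, ENNReal.toReal_ofReal hh.le,
    Complex.real_smul]

lemma tendsto_mul_ceil_div (t : ℝ) (ht : 0 < t) :
    Tendsto (fun h : ℝ => h * (⌈t / h⌉₊ : ℝ)) (𝓝[>] 0) (𝓝 t) := by
  have h1 : Tendsto (fun h : ℝ => t + h) (𝓝[>] 0) (𝓝 t) := by
    have : Tendsto (fun h : ℝ => t + h) (𝓝 0) (𝓝 (t + 0)) := (continuous_const.add continuous_id).tendsto 0
    rw [add_zero] at this
    exact this.mono_left nhdsWithin_le_nhds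
  refine tendsto_of_tendsto_of_tendsto_of_le_of_le' tendsto_const_nhds h1 ?_ ?_
  · filter_upwards [self_mem_nhdsWithin] with h hh
    exact le_mul_ceil_div hh t
  · filter_upwards [self_mem_nhdsWithin] with h hh
    have hh' : (0 : ℝ) < h := hh
    have h2 := (Nat.ceil_lt_add_one (show 0 ≤ t / h by positivity)).le
    calc h * (⌈t / h⌉₊ : ℝ) ≤ h * (t / h + 1) := by gcongr
      _ = t + h := by field_simp

/-- Convergence of Riemann sums of a function with an exponential bound. -/
theorem tendsto_riemann_sum {f : ℝ → ℂ} {C lam : ℝ} (hC : 0 ≤ C) (hlam : 0 < lam)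
    (hf : ContinuousOn f (Set.Ioi 0))
    (hb : ∀ t : ℝ, 0 < t → ‖f t‖ ≤ C * Real.exp (-(lam * t))) :
    Tendsto (fun h : ℝ => ∑' k : ℕ, (h : ℂ) * f ((k + 1 : ℕ) * h)) (𝓝[>] 0)
      (𝓝 (∫ t in Set.Ioi (0 : ℝ), f t)) := by
  have h1 : Tendsto (fun h : ℝ => ∫ t in Set.Ioi (0 : ℝ), f (h * ⌈t / h⌉₊)) (𝓝[>] 0)
      (𝓝 (∫ t in Set.Ioi (0 : ℝ), f t)) := by
    refine tendsto_integral_filter_of_dominated_convergence (fun t => C * Real.exp (-(lam * t)))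
      (Eventually.of_forall fun h => (measurable_comp_ceil f h).aestronglyMeasurable) ?_
      (integrableOn_exp_neg hlam C) ?_
    · filter_upwards [self_mem_nhdsWithin] with h hh
      exact (ae_restrict_mem measurableSet_Ioi).mono fun t ht => norm_comp_ceil_le hC hlam hb hh ht
    · refine (ae_restrict_mem measurableSet_Ioi).mono fun t ht => ?_
      exact (hf.continuousAt (Ioi_mem_nhds ht)).tendsto.comp (tendsto_mul_ceil_div t ht)
  refine h1.congr' ?_
  filter_upwards [self_mem_nhdsWithin] with h hh
  exact (hasSum_riemann hC hlam hb hh).tsum_eq.symm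

lemma tendsto_one_sub_exp_div (c : ℝ) :
    Tendsto (fun h : ℝ => (1 - Real.exp (-(c * h))) / h) (𝓝[>] 0) (𝓝 c) := by
  have h1 : HasDerivAt (fun h : ℝ => -Real.exp (-(c * h))) c 0 := by
    have h0 : HasDerivAt (fun h : ℝ => -(c * h)) (-(c * 1)) 0 :=
      ((hasDerivAt_id (0 : ℝ)).const_mul c).fun_neg
    have := h0.exp.fun_neg
    simp only [mul_zero, neg_zero, Real.exp_zero, one_mul, mul_one, neg_neg] at this
    exact this
  have h2 := h1.tendsto_slope_zero_right
  refine h2.congr fun h => ?_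
  simp only [zero_add, mul_zero, neg_zero, Real.exp_zero, smul_eq_mul]
  ring

lemma continuousOn_halfHeat {M : ℕ} (hM : 1 ≤ M) {S : Set ℝ} (hS : MeasurableSet S)
    (hcone : ∀ r x : ℝ, 0 < r → (r * x ∈ S ↔ x ∈ S)) (μ : ℝ) :
    ContinuousOn (fun t => halfHeat M S t μ) (Set.Ioi 0) := by
  have h1 : ContinuousOn (fun t : ℝ => profileTransform M S (μ * t ^ ((1 : ℝ) / (2 * M))))
      (Set.Ioi 0) :=
    ((continuous_profileTransform hM S).comp (continuous_const.mul
      (continuous_id.rpow_const fun _ => Or.inr (by positivity)))).continuousOn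
  exact h1.congr fun t ht => integral_heatKernel_cone hM ht hS hcone μ

lemma mem_Iio_cone (r x : ℝ) (hr : 0 < r) : r * x ∈ Set.Iio (0 : ℝ) ↔ x ∈ Set.Iio (0 : ℝ) := by
  simp [mul_neg_iff, hr, not_lt.2 hr.le]

lemma mem_Ici_cone (r x : ℝ) (hr : 0 < r) : r * x ∈ Set.Ici (0 : ℝ) ↔ x ∈ Set.Ici (0 : ℝ) := by
  simp [mul_nonneg_iff_of_pos_left hr]

/-- The integrand of the logarithm of the limit of `E⁻`. -/
noncomputable def logIntegrand (M : ℕ) (lam ν μ t : ℝ) : ℂ :=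
  (Real.exp (-(lam * t)) * ((1 - Real.exp (-(ν * t))) / t) : ℝ) * halfHeat M (Set.Iio 0) t μ

lemma continuousOn_logIntegrand {M : ℕ} (hM : 1 ≤ M) (lam ν μ : ℝ) :
    ContinuousOn (logIntegrand M lam ν μ) (Set.Ioi 0) := by
  refine ContinuousOn.mul (continuous_ofReal.comp_continuousOn (ContinuousOn.mul (by fun_prop)
    (ContinuousOn.div (by fun_prop) (by fun_prop) fun t ht => ne_of_gt ht)))
    (continuousOn_halfHeat hM measurableSet_Iio mem_Iio_cone μ)

lemma norm_logIntegrand_le {M : ℕ} (hM : 1 ≤ M) (lam : ℝ) {ν : ℝ} (hν : 0 < ν) (μ : ℝ) {t : ℝ}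
    (ht : 0 < t) : ‖logIntegrand M lam ν μ t‖ ≤
      (ν * ∫ x, ‖heatKernel (2 * M) 1 x‖) * Real.exp (-(lam * t)) := by
  have h1 := norm_halfHeat_le hM (Set.Iio 0) ht μ
  have h2 : 1 - Real.exp (-(ν * t)) ≤ ν * t := by
    have := Real.add_one_le_exp (-(ν * t)); linarith
  have h3 := (exp_neg_mul_mem hν ht).2
  rw [logIntegrand, norm_mul, norm_real, Real.norm_of_nonneg]
  · have h4 : (1 - Real.exp (-(ν * t))) / t ≤ ν := by rwa [div_le_iff₀ ht]
    calc _ ≤ Real.exp (-(lam * t)) * ν * ∫ x, ‖heatKernel (2 * M) 1 x‖ := by gcongr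
      _ = _ := by ring
  · exact mul_nonneg (Real.exp_pos _).le (div_nonneg (by linarith) ht.le)

/-- Writing 1/k = h/(kh), the k-th term is h times `logIntegrand` at kh. -/
lemma tendsto_seriesSum_logCoeffMinus {M : ℕ} (hM : 1 ≤ M) {lam ν : ℝ} (hlam : 0 < lam)
    (hν : 0 < ν) (μ : ℝ) :
    Tendsto (fun h : ℝ => seriesSum (logCoeffMinus M ν h μ) (cexp (-(lam * h)))) (𝓝[>] 0)
      (𝓝 (∫ t in Set.Ioi (0 : ℝ), logIntegrand M lam ν μ t)) := by
  have hρ : 0 ≤ ∫ x, ‖heatKernel (2 * M) 1 x‖ := integral_nonneg fun _ => norm_nonneg _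
  refine (tendsto_riemann_sum (C := ν * ∫ x, ‖heatKernel (2 * M) 1 x‖) (by positivity) hlam
    (continuousOn_logIntegrand hM lam ν μ) fun t ht => norm_logIntegrand_le hM lam hν μ ht).congr' ?_
  filter_upwards [self_mem_nhdsWithin] with h hh
  have hh' : (0 : ℝ) < h := hh
  have hz1 : ‖cexp (-(lam * h))‖ < 1 := by
    rw [show -((lam : ℂ) * h) = ((-(lam * h) : ℝ) : ℂ) by push_cast; ring, norm_exp_ofReal]
    exact (exp_neg_mul_mem hlam hh').2
  have hs := (hasSum_nat_add_iff' 1).2 (hasSum_seriesSum (norm_logCoeffMinus_le hM hν hh' μ) hz1)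
  have h0 : logCoeffMinus M ν h μ 0 = 0 := by simp [logCoeffMinus]
  simp only [Finset.sum_range_one, h0, mul_zero, sub_zero] at hs
  rw [← hs.tsum_eq]
  refine tsum_congr fun k => ?_
  rw [logIntegrand, logCoeffMinus, ← Complex.exp_nat_mul, ← Real.exp_nat_mul]
  have e1 : Real.exp (-(ν * (((k + 1 : ℕ) : ℝ) * h))) = Real.exp (((k + 1 : ℕ) : ℝ) * -(ν * h)) := by
    ring_nf
  have e2 : ((Real.exp (-(lam * (((k + 1 : ℕ) : ℝ) * h))) : ℝ) : ℂ) =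
      cexp (((k + 1 : ℕ) : ℂ) * -(lam * h)) := by
    push_cast; ring_nf
  have hk : ((k + 1 : ℕ) : ℂ) ≠ 0 := by exact_mod_cast k.succ_ne_zero
  have hhc : (h : ℂ) ≠ 0 := by exact_mod_cast hh'.ne'
  rw [ofReal_mul, e2, e1, ofReal_div, ofReal_div, ofReal_mul, ofReal_natCast]
  field_simp

/-- Only E⁻ needs an analytic limit E. Dividing the factors 1 - zφ and 1 - zwφ by h, the
factorization yields E⁺ → E(λ + m)/(λ + ν + m) with m = μ^N. The prefactor w/(1 - w) times the cell
mass tends to 1/ν, and (E - lim E⁺)/ν is the stated limit. -/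
lemma tendsto_discrete_sum {M : ℕ} (hM : 1 ≤ M) {lam ν : ℝ} (hlam : 0 < lam) (hν : 0 < ν) (μ : ℝ) :
    Tendsto (fun h : ℝ =>
      (expMass (lam + ν) h + (Real.exp (-(ν * h)) / (1 - Real.exp (-(ν * h))) : ℂ) *
        (expMass lam h * (cexp (seriesSum (logCoeffMinus M ν h μ) (cexp (-(lam * h)))) - 1) -
        expMass (lam + ν) h *
          (cexp (seriesSum (logCoeffPlus M ν h μ) (cexp (-(lam * h)))) - 1)) : ℂ)) (𝓝[>] 0)
      (𝓝 (cexp (∫ t in Set.Ioi (0 : ℝ), logIntegrand M lam ν μ t) /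
        ((lam + ν + μ ^ (2 * M) : ℝ) : ℂ))) := by
  set E := cexp (∫ t in Set.Ioi (0 : ℝ), logIntegrand M lam ν μ t) with hE
  set m : ℝ := μ ^ (2 * M) with hm
  have hm0 : 0 ≤ m := (even_two_mul M).pow_nonneg μ
  have tE : Tendsto (fun h : ℝ => cexp (seriesSum (logCoeffMinus M ν h μ) (cexp (-(lam * h)))))
      (𝓝[>] 0) (𝓝 E) :=
    (Complex.continuous_exp.tendsto _).comp (tendsto_seriesSum_logCoeffMinus hM hlam hν μ)
  have tq : ∀ c : ℝ, Tendsto (fun h : ℝ => (((1 - Real.exp (-(c * h))) / h : ℝ) : ℂ)) (𝓝[>] 0)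
      (𝓝 (c : ℂ)) := fun c => (continuous_ofReal.tendsto _).comp (tendsto_one_sub_exp_div c)
  have tmass : ∀ c : ℝ, 0 < c → Tendsto (fun h : ℝ => (expMass c h : ℂ) / h) (𝓝[>] 0) (𝓝 1) := by
    intro c hc
    have hc' : (c : ℂ) ≠ 0 := by exact_mod_cast hc.ne'
    have := (tq c).div_const (c : ℂ)
    rw [div_self hc'] at this
    refine this.congr fun h => ?_
    rw [expMass]
    push_cast
    rw [div_right_comm]
  have th : Tendsto (fun h : ℝ => (h : ℂ)) (𝓝[>] 0) (𝓝 0) := by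
    have := (continuous_ofReal.tendsto (0 : ℝ)).mono_left (nhdsWithin_le_nhds (s := Set.Ioi 0))
    simpa using this
  have tw : Tendsto (fun h : ℝ => (Real.exp (-(ν * h)) : ℂ)) (𝓝[>] 0) (𝓝 1) := by
    have h1 : Continuous fun h : ℝ => (Real.exp (-(ν * h)) : ℂ) := by fun_prop
    have := (h1.tendsto 0).mono_left (nhdsWithin_le_nhds (s := Set.Ioi 0))
    simpa using this
  have hνc : (ν : ℂ) ≠ 0 := by exact_mod_cast hν.ne'
  have hD : ((lam + ν + m : ℝ) : ℂ) ≠ 0 := by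
    rw [ofReal_ne_zero]; positivity
  have tEp : Tendsto (fun h : ℝ => cexp (seriesSum (logCoeffPlus M ν h μ) (cexp (-(lam * h)))))
      (𝓝[>] 0) (𝓝 (E * ((lam + m : ℝ) : ℂ) / ((lam + ν + m : ℝ) : ℂ))) := by
    refine ((tE.mul (tq (lam + m))).div (tq (lam + ν + m)) hD).congr' ?_
    filter_upwards [self_mem_nhdsWithin] with h hh
    have hh' : (0 : ℝ) < h := hh
    have hz1 : ‖cexp (-(lam * h))‖ < 1 := by
      rw [show -((lam : ℂ) * h) = ((-(lam * h) : ℝ) : ℂ) by push_cast; ring, norm_exp_ofReal]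
      exact (exp_neg_mul_mem hlam hh').2
    have hwn : ‖(Real.exp (-(ν * h)) : ℂ)‖ ≤ 1 := by
      rw [norm_real, Real.norm_of_nonneg (Real.exp_pos _).le]
      exact (exp_neg_mul_mem hν hh').2.le
    have hf := exp_seriesSum_factorization (norm_logCoeffMinus_le hM hν hh' μ)
      (norm_logCoeffPlus_le hM hν hh' μ) (norm_exp_neg_pow_le M hh' μ) hwn (logCoeff_sub hM hh' μ) hz1
    have e1 : cexp (-(lam * h)) * cexp (-(h * μ ^ (2 * M))) =
        (Real.exp (-((lam + m) * h)) : ℂ) := by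
      rw [← Complex.exp_add]; push_cast; rw [hm]; push_cast; ring_nf
    have e2 : cexp (-(lam * h)) * ((Real.exp (-(ν * h)) : ℂ) * cexp (-(h * μ ^ (2 * M)))) =
        (Real.exp (-((lam + ν + m) * h)) : ℂ) := by
      rw [ofReal_exp, ← Complex.exp_add, ← Complex.exp_add]; push_cast; rw [hm]; push_cast; ring_nf
    rw [e1, e2] at hf
    have h3 := (exp_neg_mul_mem (show 0 < lam + ν + m by positivity) hh').2
    have h4 : (1 : ℂ) - (Real.exp (-((lam + ν + m) * h)) : ℂ) ≠ 0 := by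
      rw [← ofReal_one, ← ofReal_sub, ofReal_ne_zero]; linarith
    have hhc : (h : ℂ) ≠ 0 := by exact_mod_cast hh'.ne'
    simp only [Pi.div_apply]
    rw [ofReal_div, ofReal_div, ofReal_sub, ofReal_sub, ofReal_one, ← mul_div_assoc, hf]
    field_simp
  have tall := ((tmass (lam + ν) (by positivity)).mul th).add ((tw.div (tq ν) hνc).mul
    (((tmass lam hlam).mul (tE.sub_const 1)).sub ((tmass (lam + ν) (by positivity)).mul
      (tEp.sub_const 1))))
  have elim : (1 : ℂ) * 0 + 1 / (ν : ℂ) * (1 * (E - 1) - 1 *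
      (E * ((lam + m : ℝ) : ℂ) / ((lam + ν + m : ℝ) : ℂ) - 1)) = E / ((lam + ν + m : ℝ) : ℂ) := by
    push_cast at hD ⊢
    field_simp
    ring
  rw [elim] at tall
  refine tall.congr' ?_
  filter_upwards [self_mem_nhdsWithin] with h hh
  have hh' : (0 : ℝ) < h := hh
  have hhc : (h : ℂ) ≠ 0 := by exact_mod_cast hh'.ne'
  have h3 := (exp_neg_mul_mem hν hh').2
  have h4 : (1 : ℂ) - (Real.exp (-(ν * h)) : ℂ) ≠ 0 := by
    rw [← ofReal_one, ← ofReal_sub, ofReal_ne_zero]; linarith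
  simp only [Pi.div_apply]
  rw [ofReal_div, ofReal_sub, ofReal_one]
  field_simp

lemma tendsto_one_div_two_pow : Tendsto (fun n : ℕ => (1 : ℝ) / 2 ^ n) atTop (𝓝[>] 0) := by
  rw [tendsto_nhdsWithin_iff]
  refine ⟨?_, Eventually.of_forall fun n => by simp⟩
  have := tendsto_pow_atTop_nhds_zero_of_lt_one (r := (1 : ℝ) / 2) (by norm_num) (by norm_num)
  simpa only [one_div, inv_pow] using this

theorem hasPseudoExpectation_laplaceFourierTerm {M : ℕ} (hM : 1 ≤ M) {lam ν : ℝ} (hlam : 0 < lam)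
    (hν : 0 < ν) (μ : ℝ) :
    HasPseudoExpectation (2 * M) (laplaceFourierTerm lam μ ν)
      (cexp (∫ t in Set.Ioi (0 : ℝ), logIntegrand M lam ν μ t) /
        ((lam + ν + μ ^ (2 * M) : ℝ) : ℂ)) := by
  refine ⟨isTame_laplaceFourierTerm hlam hν μ,
    fun n => (hasSum_tameExpectation hM hlam hν μ n rfl).summable.norm, ?_⟩
  refine ((tendsto_discrete_sum hM hlam hν μ).comp tendsto_one_div_two_pow).congr fun n => ?_
  exact (hasSum_tameExpectation hM hlam hν μ n rfl).tsum_eq.symm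

end PseudoProcess

namespace PseudoProcess

/-! ### Closed form of the Laplace-Fourier transform -/

/-- Since 1/θ is the conjugate of θ, iμ/θ has imaginary part μ Re θ, nonzero unless μ = 0. The
principal logarithm is therefore a primitive along all a > 0. -/
lemma add_I_mul_div_mem_slitPlane {M : ℕ} (hM : 1 ≤ M) {θ : ℂ} (hθ : θ ∈ rootsJ (2 * M)) {a : ℝ}
    (ha : 0 < a) (μ : ℝ) : (a : ℂ) + I * μ / θ ∈ slitPlane := by
  have h := ((mem_rootsJ hM).1 hθ).2
  rw [div_eq_mul_inv, inv_eq_conj_of_mem_rootsJ hM hθ]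
  rcases eq_or_ne μ 0 with rfl | hμ
  · left
    simpa using ha
  · right
    simp [hμ, h.ne']

lemma sub_I_mul_div_mem_slitPlane {M : ℕ} (hM : 1 ≤ M) {θ : ℂ} (hθ : θ ∈ rootsJ (2 * M)) {a : ℝ}
    (ha : 0 < a) (μ : ℝ) : (a : ℂ) - I * μ / θ ∈ slitPlane := by
  have h := add_I_mul_div_mem_slitPlane hM hθ ha (-μ)
  convert! h using 1
  push_cast
  ring

/-- The underlying function is θe^{-θax} on x ≥ 0; the opposite sign of iμ/θ corresponds to θe^{θax}
on x < 0 in `isHalfTransform_inv_add`. -/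
lemma isHalfTransform_inv_sub {M : ℕ} (hM : 1 ≤ M) {θ : ℂ} (hθ : θ ∈ rootsJ (2 * M)) {a : ℝ}
    (ha : 0 < a) : IsHalfTransform (Set.Ici 0) fun μ => ((a : ℂ) - I * μ / θ)⁻¹ := by
  have hre := re_mul_ofReal_pos hM hθ ha
  have hθ0 := ne_zero_of_mem_rootsJ hM hθ
  refine IsHalfTransform.of_setIntegral (g := fun x => θ * cexp (-(θ * a) * x)) ?_
    measurableSet_Ici fun μ => ?_
  · rw [integrableOn_Ici_iff_integrableOn_Ioi]
    exact (integrableOn_exp_mul_complex_Ioi (by rw [neg_re]; linarith) 0).const_mul θ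
  · have e : ∀ x : ℝ, cexp (I * μ * x) * (θ * cexp (-(θ * a) * x)) =
        θ * cexp ((I * μ - θ * a) * x) := by
      intro x
      rw [mul_left_comm, ← Complex.exp_add]
      ring_nf
    have h0 := slitPlane_ne_zero (sub_I_mul_div_mem_slitPlane hM hθ ha μ)
    have h1 : θ * a - I * μ ≠ 0 := by
      have : θ * a - I * μ = θ * (a - I * μ / θ) := by field_simp
      rw [this]
      exact mul_ne_zero hθ0 h0
    have h2 : I * μ - θ * a ≠ 0 := by
      rw [← neg_sub]; exact neg_ne_zero.2 h1
    have hlt : (I * μ - θ * a).re < 0 := by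
      rw [sub_re]
      simp only [mul_re, I_re, I_im, ofReal_re, ofReal_im] at hre ⊢
      linarith
    simp only [e]
    rw [integral_const_mul, integral_Ici_eq_integral_Ioi, integral_exp_mul_complex_Ioi hlt]
    simp only [ofReal_zero, mul_zero, Complex.exp_zero]
    rw [inv_eq_of_mul_eq_one_left]
    field_simp
    ring

lemma isHalfTransform_inv_add {M : ℕ} (hM : 1 ≤ M) {θ : ℂ} (hθ : θ ∈ rootsJ (2 * M)) {a : ℝ}
    (ha : 0 < a) : IsHalfTransform (Set.Iio 0) fun μ => ((a : ℂ) + I * μ / θ)⁻¹ := by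
  have hre := re_mul_ofReal_pos hM hθ ha
  have hθ0 := ne_zero_of_mem_rootsJ hM hθ
  refine IsHalfTransform.of_setIntegral (g := fun x => θ * cexp ((θ * a) * x)) ?_
    measurableSet_Iio fun μ => ?_
  · rw [← integrableOn_Iic_iff_integrableOn_Iio]
    exact (integrableOn_exp_mul_complex_Iic hre 0).const_mul θ
  · have e : ∀ x : ℝ, cexp (I * μ * x) * (θ * cexp ((θ * a) * x)) =
        θ * cexp ((I * μ + θ * a) * x) := by
      intro x
      rw [mul_left_comm, ← Complex.exp_add]
      ring_nf
    have h0 := slitPlane_ne_zero (add_I_mul_div_mem_slitPlane hM hθ ha μ)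
    have h1 : I * μ + θ * a ≠ 0 := by
      have : I * μ + θ * a = θ * (a + I * μ / θ) := by field_simp; ring
      rw [this]
      exact mul_ne_zero hθ0 h0
    have hlt : 0 < (I * μ + θ * a).re := by
      rw [add_re]
      simp only [mul_re, I_re, I_im, ofReal_re, ofReal_im] at hre ⊢
      linarith
    simp only [e]
    rw [integral_const_mul, ← integral_Iic_eq_integral_Iio, integral_exp_mul_complex_Iic hlt]
    simp only [ofReal_zero, mul_zero, Complex.exp_zero]
    rw [inv_eq_of_mul_eq_one_left]
    field_simp
    ring

lemma integrable_laplace_heatKernel {M : ℕ} (hM : 1 ≤ M) {α : ℝ} (hα : 0 < α) :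
    Integrable (fun p : ℝ × ℝ => cexp (-(α * p.1)) * heatKernel (2 * M) p.1 p.2)
      ((volume.restrict (Set.Ioi 0)).prod volume) := by
  have hmeas : AEStronglyMeasurable (fun p : ℝ × ℝ => cexp (-(α * p.1)) *
      heatKernel (2 * M) p.1 p.2) ((volume.restrict (Set.Ioi 0)).prod volume) :=
    ((by fun_prop : Measurable fun p : ℝ × ℝ => cexp (-(α * p.1))).mul
      (measurable_heatKernel M).complex_ofReal).aestronglyMeasurable
  have hnorm : ∀ t : ℝ, ‖cexp (-(α * t))‖ = Real.exp (-(α * t)) := by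
    intro t
    rw [show -((α : ℂ) * t) = ((-(α * t) : ℝ) : ℂ) by push_cast; ring, norm_exp_ofReal]
  rw [integrable_prod_iff hmeas]
  constructor
  · refine (ae_restrict_mem measurableSet_Ioi).mono fun t ht => ?_
    have h : Integrable fun x => (heatKernel (2 * M) t x : ℂ) :=
      (integrable_heatKernel hM ht).ofReal (𝕜 := ℂ)
    exact h.const_mul (cexp (-(α * t)))
  · refine (integrableOn_exp_neg hα (∫ x, ‖heatKernel (2 * M) 1 x‖)).congr ?_
    refine (ae_restrict_mem measurableSet_Ioi).mono fun t ht => ?_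
    simp only [norm_mul, hnorm, norm_real]
    rw [integral_const_mul, integral_norm_heatKernel hM ht, mul_comm]

lemma isHalfTransform_laplace_halfHeat {M : ℕ} (hM : 1 ≤ M) {S : Set ℝ} (hS : MeasurableSet S)
    {α : ℝ} (hα : 0 < α) : IsHalfTransform S fun μ =>
      ∫ t in Set.Ioi (0 : ℝ), cexp (-(α * t)) * halfHeat M S t μ := by
  have h := integrable_laplace_heatKernel hM hα
  refine IsHalfTransform.of_setIntegral (g := fun x => ∫ t in Set.Ioi (0 : ℝ),
    cexp (-(α * t)) * heatKernel (2 * M) t x) h.integral_prod_right.integrableOn hS fun μ => ?_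
  have h1 : Integrable (fun p : ℝ × ℝ => cexp (I * μ * p.2) *
      (cexp (-(α * p.1)) * heatKernel (2 * M) p.1 p.2))
      ((volume.restrict (Set.Ioi 0)).prod volume) :=
    h.bdd_mul (c := 1) (by fun_prop) (ae_of_all _ fun x => (norm_exp_I_mul μ x.2).le)
  have h2 : Integrable (fun p : ℝ × ℝ => cexp (I * μ * p.2) *
      (cexp (-(α * p.1)) * heatKernel (2 * M) p.1 p.2))
      ((volume.restrict (Set.Ioi 0)).prod (volume.restrict S)) :=
    h1.mono_measure (Measure.prod_mono le_rfl Measure.restrict_le_self)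
  have h3 := integral_integral_swap (f := fun t x : ℝ => cexp (I * μ * x) *
      (cexp (-(α * t)) * heatKernel (2 * M) t x)) h2
  simp only [← integral_const_mul, halfHeat]
  rw [← h3]
  simp only [mul_left_comm]

/-- Over both half-lines together the left side is N a^{N-1}/(a^N + μ^N), which
`sum_rootsJ_inv_sub_add` splits into fractions living on [0,∞) and on (-∞,0). Uniqueness of the
splitting identifies each part. -/
lemma laplace_halfHeat {M : ℕ} (hM : 1 ≤ M) {a : ℝ} (ha : 0 < a) (μ : ℝ) :
    2 * M * (a : ℂ) ^ (2 * M - 1) *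
      ∫ t in Set.Ioi (0 : ℝ), cexp (-((a ^ (2 * M) : ℝ) * t)) * halfHeat M (Set.Iio 0) t μ =
      ∑ θ ∈ rootsJ (2 * M), ((a : ℂ) + I * μ / θ)⁻¹ := by
  have hα : 0 < a ^ (2 * M) := pow_pos ha _
  have hint : ∀ (S : Set ℝ) (_ : MeasurableSet S) (_ : ∀ r x : ℝ, 0 < r → (r * x ∈ S ↔ x ∈ S))
      (μ : ℝ), IntegrableOn (fun t : ℝ => cexp (-((a ^ (2 * M) : ℝ) * t)) * halfHeat M S t μ)
        (Set.Ioi 0) := by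
    intro S hS hcone μ
    refine (integrableOn_exp_neg hα (∫ x, ‖heatKernel (2 * M) 1 x‖)).mono'
      ((ContinuousOn.mul (by fun_prop) (continuousOn_halfHeat hM hS hcone μ)).aestronglyMeasurable
        measurableSet_Ioi) ((ae_restrict_mem measurableSet_Ioi).mono fun t ht => ?_)
    rw [norm_mul, show -(((a ^ (2 * M) : ℝ) : ℂ) * t) = ((-(a ^ (2 * M) * t) : ℝ) : ℂ) by
      push_cast; ring, norm_exp_ofReal, mul_comm]
    gcongr
    exact norm_halfHeat_le hM S ht μ
  refine congrFun (IsHalfTransform.unique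
    ((isHalfTransform_laplace_halfHeat hM measurableSet_Ici hα).const_mul
      (2 * M * (a : ℂ) ^ (2 * M - 1)))
    (IsHalfTransform.sum fun θ hθ => isHalfTransform_inv_sub hM hθ ha)
    ((isHalfTransform_laplace_halfHeat hM measurableSet_Iio hα).const_mul
      (2 * M * (a : ℂ) ^ (2 * M - 1)))
    (IsHalfTransform.sum fun θ hθ => isHalfTransform_inv_add hM hθ ha) fun μ => ?_).2 μ
  rw [sum_rootsJ_inv_sub_add hM a (I * μ)
    (fun θ hθ => slitPlane_ne_zero (sub_I_mul_div_mem_slitPlane hM hθ ha μ))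
    (fun θ hθ => slitPlane_ne_zero (add_I_mul_div_mem_slitPlane hM hθ ha μ)), kappa_mul_I_pow,
    ← mul_add, ← integral_add (hint _ measurableSet_Ici mem_Ici_cone μ)
      (hint _ measurableSet_Iio mem_Iio_cone μ), sub_neg_eq_add]
  have hm : 0 ≤ μ ^ (2 * M) := (even_two_mul M).pow_nonneg μ
  have e : Set.EqOn (fun t : ℝ => cexp (-((a ^ (2 * M) : ℝ) * t)) * halfHeat M (Set.Ici 0) t μ +
      cexp (-((a ^ (2 * M) : ℝ) * t)) * halfHeat M (Set.Iio 0) t μ)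
      (fun t : ℝ => cexp (-((a ^ (2 * M) + μ ^ (2 * M) : ℝ) : ℂ) * t)) (Set.Ioi 0) := by
    intro t ht
    simp only
    rw [← mul_add, halfHeat_add hM ht, ← Complex.exp_add]
    push_cast
    ring_nf
  rw [setIntegral_congr_fun measurableSet_Ioi e, integral_exp_mul_complex_Ioi (by
    rw [neg_re, ofReal_re]; linarith)]
  push_cast
  simp only [mul_zero, Complex.exp_zero, neg_div_neg_eq, mul_one_div]

lemma integral_pow_mul_exp (n : ℕ) (a₀ a₁ t : ℝ) (ht : t ≠ 0) :
    ∫ a in a₀..a₁, (n : ℝ) * a ^ (n - 1) * Real.exp (-(a ^ n * t)) =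
      (Real.exp (-(a₀ ^ n * t)) - Real.exp (-(a₁ ^ n * t))) / t := by
  have h : ∀ a ∈ Set.uIcc a₀ a₁, HasDerivAt (fun a : ℝ => -Real.exp (-(a ^ n * t)) / t)
      ((n : ℝ) * a ^ (n - 1) * Real.exp (-(a ^ n * t))) a := by
    intro a _
    have h0 := ((((hasDerivAt_pow n a).mul_const t).fun_neg).exp.fun_neg).div_const t
    convert! h0 using 1
    field_simp
  rw [intervalIntegral.integral_eq_sub_of_hasDerivAt h (Continuous.intervalIntegrable (by fun_prop) _ _)]
  ring

/-- Frullani: (e^{-a₀^N t} - e^{-a₁^N t})/t = ∫ N a^{N-1} e^{-a^N t} da over [a₀, a₁]. Exchanging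
integrals leaves the Laplace transform of `laplace_halfHeat` for each a. -/
lemma integral_logIntegrand {M : ℕ} (hM : 1 ≤ M) {a₀ a₁ : ℝ} (h0 : 0 < a₀) (h1 : a₀ ≤ a₁) (μ : ℝ) :
    ∫ t in Set.Ioi (0 : ℝ), logIntegrand M (a₀ ^ (2 * M)) (a₁ ^ (2 * M) - a₀ ^ (2 * M)) μ t =
      ∫ a in a₀..a₁, ∑ θ ∈ rootsJ (2 * M), ((a : ℂ) + I * μ / θ)⁻¹ := by
  set G : ℝ → ℝ → ℂ := fun t a => (((2 * M : ℕ) * a ^ (2 * M - 1) *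
    Real.exp (-(a ^ (2 * M) * t)) : ℝ) : ℂ) * halfHeat M (Set.Iio 0) t μ with hG
  have hcont : ContinuousOn (Function.uncurry G) (Set.Ioi 0 ×ˢ Set.Ioc a₀ a₁) := by
    refine ContinuousOn.mul (Continuous.continuousOn (by fun_prop)) ?_
    exact (continuousOn_halfHeat hM measurableSet_Iio mem_Iio_cone μ).comp continuousOn_fst
      fun p hp => hp.1
  have hα : 0 < a₀ ^ (2 * M) := pow_pos h0 _
  have hint : Integrable (Function.uncurry G)
      ((volume.restrict (Set.Ioi 0)).prod (volume.restrict (Set.Ioc a₀ a₁))) := by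
    have hb := (integrableOn_exp_neg hα ((2 * M : ℕ) * a₁ ^ (2 * M - 1) *
      ∫ x, ‖heatKernel (2 * M) 1 x‖)).comp_fst (volume.restrict (Set.Ioc a₀ a₁))
    refine hb.mono' ?_ ?_
    · rw [Measure.prod_restrict]
      exact hcont.aestronglyMeasurable (measurableSet_Ioi.prod measurableSet_Ioc)
    · rw [Measure.prod_restrict]
      refine (ae_restrict_mem (measurableSet_Ioi.prod measurableSet_Ioc)).mono fun p hp => ?_
      obtain ⟨hp1, hp2, hp3⟩ := hp
      have hp1' : 0 < p.1 := hp1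
      have hp2' : 0 < p.2 := h0.trans hp2
      have hn := norm_halfHeat_le hM (Set.Iio 0) hp1 μ
      have hh : ‖Function.uncurry G p‖ = (2 * M : ℕ) * p.2 ^ (2 * M - 1) *
          Real.exp (-(p.2 ^ (2 * M) * p.1)) * ‖halfHeat M (Set.Iio 0) p.1 μ‖ := by
        simp only [Function.uncurry, hG]
        rw [norm_mul, norm_real, Real.norm_of_nonneg (by positivity)]
      rw [hh]
      calc _ ≤ (2 * M : ℕ) * a₁ ^ (2 * M - 1) * Real.exp (-(a₀ ^ (2 * M) * p.1)) *
          ∫ x, ‖heatKernel (2 * M) 1 x‖ := by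
            have ha₁ : 0 < a₁ := h0.trans_le h1
            gcongr
        _ = _ := by ring
  have e1 : Set.EqOn (logIntegrand M (a₀ ^ (2 * M)) (a₁ ^ (2 * M) - a₀ ^ (2 * M)) μ)
      (fun t => ∫ a in Set.Ioc a₀ a₁, G t a) (Set.Ioi 0) := by
    intro t ht
    simp only [hG]
    rw [integral_mul_const, integral_complex_ofReal, ← intervalIntegral.integral_of_le h1,
      integral_pow_mul_exp _ _ _ _ (ne_of_gt ht), logIntegrand]
    congr 2
    rw [← mul_div_assoc, mul_sub, mul_one, ← Real.exp_add]
    ring_nf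
  rw [setIntegral_congr_fun measurableSet_Ioi e1, integral_integral_swap hint,
    intervalIntegral.integral_of_le h1]
  refine setIntegral_congr_fun measurableSet_Ioc fun a ha => ?_
  simp only [hG]
  rw [← laplace_halfHeat hM (h0.trans ha.1), ← integral_const_mul]
  refine integral_congr_ae (ae_of_all _ fun t => ?_)
  simp only
  push_cast
  ring

/-- Each fraction integrates to a difference of logarithms, and the exponential turns the sum over
roots into a product of ratios. -/
lemma exp_integral_logIntegrand {M : ℕ} (hM : 1 ≤ M) {a₀ a₁ : ℝ} (h0 : 0 < a₀) (h1 : a₀ ≤ a₁)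
    (μ : ℝ) :
    cexp (∫ t in Set.Ioi (0 : ℝ), logIntegrand M (a₀ ^ (2 * M)) (a₁ ^ (2 * M) - a₀ ^ (2 * M)) μ t) =
      ∏ θ ∈ rootsJ (2 * M), ((a₁ : ℂ) + I * μ / θ) / ((a₀ : ℂ) + I * μ / θ) := by
  have hpos : ∀ a ∈ Set.uIcc a₀ a₁, 0 < a := by
    intro a ha
    rw [Set.uIcc_of_le h1] at ha
    exact h0.trans_le ha.1
  have hi : ∀ θ ∈ rootsJ (2 * M),
      IntervalIntegrable (fun a : ℝ => ((a : ℂ) + I * μ / θ)⁻¹) volume a₀ a₁ := fun θ hθ =>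
    ContinuousOn.intervalIntegrable (ContinuousOn.inv₀ (by fun_prop) fun a ha =>
      slitPlane_ne_zero (add_I_mul_div_mem_slitPlane hM hθ (hpos a ha) μ))
  rw [integral_logIntegrand hM h0 h1, intervalIntegral.integral_finsetSum hi, Complex.exp_sum]
  refine Finset.prod_congr rfl fun θ hθ => ?_
  have hd : ∀ a ∈ Set.uIcc a₀ a₁, HasDerivAt (fun a : ℝ => Complex.log ((a : ℂ) + I * μ / θ))
      ((a : ℂ) + I * μ / θ)⁻¹ a := by
    intro a ha
    have h2 : HasDerivAt (fun a : ℝ => (a : ℂ) + I * μ / θ) 1 a :=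
      (hasDerivAt_id a).ofReal_comp.add_const _
    have h3 := h2.clog_real (add_I_mul_div_mem_slitPlane hM hθ (hpos a ha) μ)
    rwa [one_div] at h3
  rw [intervalIntegral.integral_eq_sub_of_hasDerivAt hd (hi θ hθ), Complex.exp_sub,
    Complex.exp_log (slitPlane_ne_zero (add_I_mul_div_mem_slitPlane hM hθ (h0.trans_le h1) μ)),
    Complex.exp_log (slitPlane_ne_zero (add_I_mul_div_mem_slitPlane hM hθ h0 μ))]

lemma exists_eq_pow_and_rpow {M : ℕ} (hM : 1 ≤ M) {lam : ℝ} (hlam : 0 < lam) : ∃ b : ℝ, 0 < b ∧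
    lam = b ^ (2 * M) ∧ lam ^ ((1 : ℝ) / ((2 * M : ℕ) : ℝ)) = b ∧
    lam ^ (-((M : ℝ) - 1) / ((2 * M : ℕ) : ℝ)) = (b ^ (M - 1))⁻¹ := by
  refine ⟨lam ^ ((1 : ℝ) / ((2 * M : ℕ) : ℝ)), by positivity, ?_, rfl, ?_⟩
  · rw [one_div, Real.rpow_inv_natCast_pow hlam.le (by omega)]
  · rw [← Real.rpow_natCast, ← Real.rpow_mul hlam.le, ← Real.rpow_neg hlam.le, Nat.cast_sub hM]
    congr 1
    push_cast
    ring

theorem isJointDensity_jointDensity {M : ℕ} (hM : 1 ≤ M) :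
    IsJointDensity (2 * M) (jointDensity M) where
  eq_zero _ _ _ h := jointDensity_eq_zero h
  continuousOn := continuousOn_jointDensity hM
  integrable _ hlam := integrable_exp_mul_jointDensity hM hlam
  transform lam μ ν hlam hν := by
    have h := hasPseudoExpectation_laplaceFourierTerm hM hlam hν μ
    obtain ⟨a₀, h0, e0, -⟩ := exists_eq_pow_and_rpow hM hlam
    obtain ⟨a₁, h1, e1, -⟩ := exists_eq_pow_and_rpow hM (add_pos hlam hν)
    have hle : a₀ ≤ a₁ := by
      refine le_of_pow_le_pow_left₀ (n := 2 * M) (by omega) h1.le ?_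
      rw [← e0, ← e1]; linarith
    have eν : ν = a₁ ^ (2 * M) - a₀ ^ (2 * M) := by rw [← e0, ← e1]; ring
    -- The denominator λ + ν + μ^N is a₁^N + μ^N. Its factors a₁ + iμ/θ cancel the numerators of E,
    -- leaving the two products that form the transform of `jointDensity`.
    have hprod := prod_rootsJ_sub_mul_add hM (a₁ : ℂ) (I * μ)
    rw [kappa_mul_I_pow, sub_neg_eq_add] at hprod
    have hne : ∏ θ ∈ rootsJ (2 * M), ((a₁ : ℂ) + I * μ / θ) ≠ 0 := Finset.prod_ne_zero_iff.2
      fun θ hθ => slitPlane_ne_zero (add_I_mul_div_mem_slitPlane hM hθ h1 μ)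
    rw [(jointDensity_transform hM hlam hν.le μ).2]
    rw [e1, e0, integral_halfDensity_transform hM h1, integral_halfDensity_transform hM h0]
    rw [e1, e0, eν, exp_integral_logIntegrand hM h0 hle, ← eν] at h
    convert! h using 1
    push_cast
    rw [← hprod, Finset.prod_div_distrib, Finset.prod_inv_distrib, Finset.prod_inv_distrib]
    have e2 : ∏ θ ∈ rootsJ (2 * M), ((a₀ : ℂ) - I * -μ / θ) =
        ∏ θ ∈ rootsJ (2 * M), ((a₀ : ℂ) + I * μ / θ) :=
      Finset.prod_congr rfl fun θ _ => by ring
    rw [e2]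
    field_simp

end PseudoProcess

/-! ### Existence, uniqueness and the Laplace transform formulas. -/

theorem mainTheorem5 (N : ℕ) (hN : Even N) (hN2 : 2 ≤ N) :
    (∃ q : ℝ → ℝ → ℝ → ℝ, IsJointDensity N q) ∧
    (∀ q : ℝ → ℝ → ℝ → ℝ, IsJointDensity N q →
      ∀ lam s x : ℝ, 0 < lam → 0 < s → 0 ≤ x → (2 < N ∨ 0 < x) →
        IntegrableOn (fun t : ℝ => Real.exp (-(lam * t)) * q t s x) (Set.Ioi 0) ∧
        (∀ θj ∈ rootsJ N, ∀ θk ∈ rootsK N,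
          IntervalIntegrable (convolutionIntegrand N θj θk lam s x) volume 0 s) ∧
        ((∫ t in Set.Ioi (0 : ℝ), Real.exp (-(lam * t)) * q t s x : ℝ) : ℂ) =
          -((Real.exp (-(lam * s)) * lam ^ (-(((rootsK N).card : ℝ) - 1) / N) : ℝ) : ℂ) *
            ∑ θj ∈ rootsJ N, ∑ θk ∈ rootsK N,
              rootCoeff (rootsJ N) θj * rootCoeff (rootsK N) θk * θk *
                ∫ σ in (0 : ℝ)..s, convolutionIntegrand N θj θk lam s x σ) ∧
    (∀ θj ∈ rootsJ N, ∀ lam x : ℝ, 0 < lam → 0 ≤ x → (2 < N ∨ 0 < x) →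
      IntegrableOn (fun τ : ℝ =>
        cexp (-(lam * τ)) * kernelI N ((rootsJ N).card - 1) θj τ x) (Set.Ioi 0) ∧
      (∫ τ in Set.Ioi (0 : ℝ), cexp (-(lam * τ)) * kernelI N ((rootsJ N).card - 1) θj τ x) =
        ((lam ^ (-(((rootsJ N).card : ℝ) - 1) / N) : ℝ) : ℂ) *
          cexp (-(θj * ((lam ^ ((1 : ℝ) / N) : ℝ) : ℂ) * x))) := by
  obtain ⟨M, rfl⟩ := hN.exists_two_nsmul N
  simp only [smul_eq_mul] at hN2 ⊢
  have hM : 1 ≤ M := by omega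
  refine ⟨⟨_, isJointDensity_jointDensity hM⟩, fun q hq lam s x hlam hs hx h => ?_,
    fun θ hθ lam x hlam hx h => ?_⟩
  · have h' : 2 ≤ M ∨ 0 < x := h.imp_left fun h => by omega
    obtain rfl := hq.unique (isJointDensity_jointDensity hM)
    obtain ⟨b, hb, rfl, -, h2⟩ := exists_eq_pow_and_rpow hM hlam
    obtain ⟨i1, i2⟩ := laplace_jointDensity hM hb hs hx
    refine ⟨i1, ?_, ?_⟩
    · intro θ hθ θk hθk
      rw [rootsK_eq_image_neg hM, Finset.mem_image] at hθk
      obtain ⟨θ', hθ', rfl⟩ := hθk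
      exact (integral_convolutionIntegrand hM hθ hθ' hb hs hx h').1
    · rw [i2, card_rootsK hM, h2, neg_mul_comm, ← Finset.sum_neg_distrib]
      push_cast
      congr 1
      refine Finset.sum_congr rfl fun θ hθ => ?_
      have hsum : ∀ f : ℂ → ℂ, ∑ θk ∈ rootsK (2 * M), f θk = ∑ θ' ∈ rootsJ (2 * M), f (-θ') := by
        intro f
        rw [rootsK_eq_image_neg hM, Finset.sum_image fun x _ y _ h => neg_injective h]
      rw [hsum, ← Finset.sum_neg_distrib]
      refine Finset.sum_congr rfl fun θ' hθ' => ?_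
      rw [(integral_convolutionIntegrand hM hθ hθ' hb hs hx h').2, rootCoeff_rootsK_neg hM]
      ring
  · have h' : 2 ≤ M ∨ 0 < x := h.imp_left fun h => by omega
    obtain ⟨b, hb, rfl, h1, h2⟩ := exists_eq_pow_and_rpow hM hlam
    obtain ⟨i1, i2⟩ := laplace_kernelI hM hθ hb hx h'
    rw [card_rootsJ hM]
    refine ⟨i1, ?_⟩
    rw [i2, h1, h2]
    push_cast
    rfl
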